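/- **Lemma (Projection formula).** Let $k$ be a field. Throughout, a *curve* is a geometrically irreducible, smooth, proper (equivalently, projective) curve over $k$. For a curve $X$ let $\operatorname{Div}(X)$ be the free abelian group on the closed points of $X$, with $\deg(\sum_j e_jQ_j)=\sum_j e_j[k(Q_j):k]$, let $\operatorname{Div}^0(X)=\ker(\deg)$, let $\operatorname{Pic}(X)=\operatorname{Div}(X)/\{\operatorname{div}(f): f\in k(X)^\times\}$, and let $\operatorname{Div}_t(X)$ be the group of divisors whose class in $\operatorname{Pic}(X)$ is torsion. For $D\in \operatorname{Div}_t(X)$ and $E=\sum_j e_jQ_j\in\operatorname{Div}^0(X)$ put $$\langle D,E\rangle_X=\prod_j N_{k(Q_j)/k}\big(\operatorname{lc}_{Q_j}(f,n)\big)^{e_j}\in k^\times\otimes\mathbb{Q}/\mathbb{Z},\qquad \operatorname{lc}_Q(f,n)=\Big(\frac{f}{\pi^{\operatorname{ord}_Q(f)}}\Big)(Q)\otimes\frac1n\in k(Q)^\times\otimes\mathbb{Q}/\mathbb{Z},$$ where $n>0$ and $f\in k(X)^\times$ are such that $\operatorname{div}(f)=nD$, and $\pi$ is a uniformizer at $Q$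 (the value depends only on the classes of $D$ and $E$ in $\operatorname{Pic}(X)$, not on the choices). The *intrinsic subgroup* of $X$ is $$\operatorname{Pic}(X)_{\rm tors}^{\rm is}=\{a\in\operatorname{Pic}(X)_{\rm tors}: \langle a,b\rangle_X=0\text{ for all }b\in\operatorname{Pic}(X)_{\rm tors}\}.$$ Let $\phi:X\to Y$ be a finite morphism over $k$ of curves over $k$, and let $$\phi_*\Big(\sum_i d_iP_i\Big)=\sum_i d_i[k(P_i):k(\phi(P_i))]\,\phi(P_i),\qquad \phi^*\Big(\sum_j e_jQ_j\Big)=\sum_j e_j\sum_{P\in\phi^{-1}(Q_j)}\operatorname{ram}_P(\phi)\,P$$ be the push-forward and the pull-back of divisors, $\operatorname{ram}_P(\phi)$ being the ramification index. Then for all $D\in\operatorname{Div}_t(X)$ and $E\in\operatorname{Div}^0(Y)$ one has $\phi_*D\in\operatorname{Div}_t(Y)$, $\phi^*E\in\operatorname{Div}^0(X)$ and $$\langle\phi_*D,E\rangle_Y=\langle D,\phi^*E\rangle_X .$$ Consequently, $\phi_*$ and $\phi^*$ map principal divisors to principal divisors, and the induced maps $\phi_*:\operatorname{Pic}(X)\to\operatorname{Pic}(Y)$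 and $\phi^*:\operatorname{Pic}(Y)\to\operatorname{Pic}(X)$ satisfy $$\phi^*\big(\operatorname{Pic}(Y)_{\rm tors}^{\rm is}\big)\subset\operatorname{Pic}(X)_{\rm tors}^{\rm is},\qquad \phi_*\big(\operatorname{Pic}(X)_{\rm tors}^{\rm is}\big)\subset\operatorname{Pic}(Y)_{\rm tors}^{\rm is}.$$ -/

import Mathlib

open CategoryTheory AlgebraicGeometry TopologicalSpace
open scoped TensorProduct Polynomial

universe u

noncomputable section

namespace CurvePairing

/-! ### Smooth algebras over a field are reduced -/

theorem isReduced_of_smooth (k S : Type*) [Field k] [CommRing S] [Algebra k S]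
    [Algebra.Smooth k S] : _root_.IsReduced S := by
  refine ⟨fun a ha => ?_⟩
  -- `a ⊗ X` is nilpotent in `S ⊗ k[X]`, hence integral over `S`
  have hnil : IsNilpotent (a ⊗ₜ[k] (Polynomial.X : k[X])) := by
    obtain ⟨n, hn⟩ := ha
    exact ⟨n, by rw [Algebra.TensorProduct.tmul_pow, hn, TensorProduct.zero_tmul]⟩
  have hint : IsIntegral S (a ⊗ₜ[k] (Polynomial.X : k[X])) := by
    obtain ⟨n, hn⟩ := hnil
    refine ⟨Polynomial.X ^ n, Polynomial.monic_X_pow n, ?_⟩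
    simp [hn]
  obtain ⟨x, hx⟩ := (TensorProduct.toIntegralClosure_bijective_of_smooth
    (R := k) (S := S) (B := k[X])).2 ⟨_, hint⟩
  have hx' := congrArg Subtype.val hx
  -- the coefficient of `X` vanishes on the image of `S ⊗ integralClosure k k[X]`
  let c : S ⊗[k] k[X] →ₗ[k] S :=
    (TensorProduct.rid k S).toLinearMap ∘ₗ (Polynomial.lcoeff k 1).lTensor S
  have hc : ∀ y : S ⊗[k] integralClosure k k[X],
      c ((TensorProduct.toIntegralClosure k S k[X] y : S ⊗[k] k[X])) = 0 := by
    intro y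
    induction y with
    | zero => simp
    | add y z hy hz => simp [hy, hz]
    | tmul s p =>
      have hp : (p : k[X]).natDegree = 0 := by
        obtain ⟨q, hq, hq0⟩ := p.2
        by_contra hne
        have hdeg : ((q.map (algebraMap k k[X])).eval (p : k[X])) = 0 := by
          rwa [Polynomial.eval_map]
        have h1 : (q.comp (p : k[X])) = 0 := by
          rw [← hq0]; rfl
        have h2 := Polynomial.natDegree_comp (p := q) (q := (p : k[X]))
        rw [h1, Polynomial.natDegree_zero] at h2
        rcases mul_eq_zero.1 h2.symm with h3 | h3
        · rw [Polynomial.eq_one_of_monic_natDegree_zero hq h3] at h1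
          simp at h1
        · exact hne h3
      have : (p : k[X]).coeff 1 = 0 :=
        Polynomial.coeff_eq_zero_of_natDegree_lt (by omega)
      simp [c, TensorProduct.toIntegralClosure, this]
  have h1 := hc x
  rw [hx'] at h1
  simpa [c] using h1

/-! ### Curves -/

/-- A geometrically irreducible smooth projective curve over a field `k`: a `k`-scheme that is
smooth of relative dimension one, proper and geometrically irreducible over `k`. (A proper curve
over a field is automatically projective.) -/
structure Curve (k : Type u) [Field k] where
  /-- the underlying scheme -/
  toScheme : Scheme.{u}
  /-- the structure morphism -/
  str : toScheme ⟶ Spec (CommRingCat.of k)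
  smooth : SmoothOfRelativeDimension 1 str
  proper : IsProper str
  geomIrred : GeometricallyIrreducible str

variable {k : Type u} [Field k]

namespace Curve

variable (X : Curve k)

instance : SmoothOfRelativeDimension 1 X.str := X.smooth
instance : Smooth X.str := SmoothOfRelativeDimension.smooth 1 X.str
instance : IsProper X.str := X.proper
instance : GeometricallyIrreducible X.str := X.geomIrred

instance : IsLocallyNoetherian X.toScheme := LocallyOfFiniteType.isLocallyNoetherian X.str

instance : CompactSpace X.toScheme := QuasiCompact.compactSpace_of_compactSpace X.str

instance : IsNoetherian X.toScheme where

instance : IrreducibleSpace X.toScheme :=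
  GeometricallyIrreducible.irreducibleSpace_of_subsingleton X.str

instance : AlgebraicGeometry.IsReduced X.toScheme := by
  have hst : ∀ x : X.toScheme, _root_.IsReduced (X.toScheme.presheaf.stalk x) := by
    intro x
    obtain ⟨_, ⟨V : X.toScheme.Opens, hV, rfl⟩, hxV, -⟩ :=
      X.toScheme.isBasis_affineOpens.exists_subset_of_mem_open (Set.mem_univ x) isOpen_univ
    have hU : IsAffineOpen (⊤ : (Spec (CommRingCat.of k)).Opens) := isAffineOpen_top _
    have hsm := X.str.smooth_appLE hU hV le_top
    let e : k →+* Γ(Spec (CommRingCat.of k), ⊤) :=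
      (Scheme.ΓSpecIso (CommRingCat.of k)).inv.hom
    have he : Function.Bijective e :=
      (Scheme.ΓSpecIso (CommRingCat.of k)).symm.commRingCatIsoToRingEquiv.bijective
    let ψ : k →+* Γ(X.toScheme, V) := (X.str.appLE ⊤ V le_top).hom.comp e
    have hψ : ψ.Smooth := (RingHom.Smooth.of_bijective he).comp hsm
    let : Algebra k Γ(X.toScheme, V) := ψ.toAlgebra
    have : Algebra.Smooth k Γ(X.toScheme, V) := hψ
    have : _root_.IsReduced Γ(X.toScheme, V) := isReduced_of_smooth k _
    have : AlgebraicGeometry.IsReduced V.toScheme := by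
      have : IsAffine V.toScheme := hV
      have : _root_.IsReduced Γ(V.toScheme, ⊤) :=
        isReduced_of_injective V.topIso.hom.hom
          V.topIso.commRingCatIsoToRingEquiv.injective
      exact isReduced_of_isAffine_isReduced _
    have := isReduced_stalk_of_isReduced V.toScheme ⟨x, hxV⟩
    exact isReduced_of_injective (V.stalkIso ⟨x, hxV⟩).inv.hom
      (V.stalkIso ⟨x, hxV⟩).symm.commRingCatIsoToRingEquiv.injective
  exact isReduced_of_isReduced_stalk _

instance : IsIntegral X.toScheme := isIntegral_of_irreducibleSpace_of_isReduced _

/-! ### Divisors -/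

/-- The closed points of the curve. -/
abbrev Pt : Type u := closedPoints X.toScheme

/-- The function field `k(X)`. -/
abbrev FunField : Type u := X.toScheme.functionField

/-- The local ring at a closed point. -/
abbrev localRing (Q : X.Pt) : Type u := X.toScheme.presheaf.stalk Q.1

/-- The residue field `k(Q)` of a closed point. -/
abbrev resField (Q : X.Pt) : Type u := X.toScheme.residueField Q.1

/-- `k(Q)` as an extension of the base field `k`, via the structure morphism. -/
instance resFieldAlgebra (Q : X.Pt) : Algebra k (X.resField Q) :=
  (Spec.preimage (X.toScheme.fromSpecResidueField Q.1 ≫ X.str)).hom.toAlgebra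

/-- The group `Div(X)` of divisors: the free abelian group on the closed points. -/
abbrev Div : Type u := X.Pt →₀ ℤ

/-- The degree of a divisor, `deg (∑ eⱼ Qⱼ) = ∑ eⱼ [k(Qⱼ) : k]`. -/
def deg : X.Div →+ ℤ :=
  Finsupp.liftAddHom fun Q => AddMonoidHom.mulRight (Module.finrank k (X.resField Q) : ℤ)

/-- The group `Div⁰(X)` of divisors of degree zero. -/
def Div0 : AddSubgroup X.Div := X.deg.ker

/-- The order of a rational function at a closed point. -/
def ordAt (f : X.FunField) (Q : X.Pt) : ℤ := Scheme.ord f Q.1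

theorem finite_ordAt (f : X.FunField) : (Function.support (X.ordAt f)).Finite := by
  by_cases hf : f = 0
  · subst hf
    have : Function.support (X.ordAt 0) = ∅ := by
      ext Q
      simp [ordAt]
    rw [this]
    exact Set.finite_empty
  obtain ⟨U, -, f', hU, rfl, hf'⟩ := exists_isUnit_germ_eq _ f hf
  -- the complement of `U` is a finite union of irreducible closed sets
  obtain ⟨S, hS, hcl, hirr, hcov⟩ := NoetherianSpace.exists_finite_set_isClosed_irreducible
    (show IsClosed ((U : Set X.toScheme)ᶜ) from U.isOpen.isClosed_compl)
  refine Set.Finite.of_finite_image (f := Subtype.val) (Set.Finite.subset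
    (Set.Finite.image (fun t : S => (hirr t.1 t.2).genericPoint)
      (@Set.finite_univ _ hS.to_subtype)) ?_) Subtype.val_injective.injOn
  rintro _ ⟨Q, hQ, rfl⟩
  have hQ1 : Order.coheight Q.1 = 1 := by
    by_contra h
    exact hQ (by simp [ordAt, h])
  have hQU : Q.1 ∉ U := fun h => hQ (Scheme.ord_of_isUnit hf' h)
  obtain ⟨t, htS, hQt⟩ : Q.1 ∈ ⋃₀ S := hcov ▸ hQU
  refine ⟨⟨t, htS⟩, Set.mem_univ _, ?_⟩
  set z := (hirr t htS).genericPoint with hz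
  have hzcl : closure {z} = t := by
    rw [hz, (hirr t htS).closure_genericPoint (hcl t htS)]
  have hzt : z ∈ t := hzcl ▸ subset_closure rfl
  have hle : Q.1 ≤ z := specializes_iff_mem_closure.2 (hzcl ▸ hQt)
  have hztop : z < ⊤ := by
    refine lt_of_le_not_ge le_top fun h => ?_
    have hzU : z ∉ (U : Set X.toScheme) := by
      have : z ∈ (U : Set X.toScheme)ᶜ := hcov ▸ ⟨t, htS, hzt⟩
      exact this
    have hηU : genericPoint X.toScheme ∈ (U : Set X.toScheme) :=
      (genericPoint_spec X.toScheme).mem_open_set_iff U.isOpen |>.2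
        ⟨_, Set.mem_univ _, hU.some.2⟩
    exact hzU ((show z ⤳ genericPoint X.toScheme from h).mem_open U.isOpen hηU)
  have hge : z ≤ Q.1 := by
    by_contra h
    have h1 := Order.coheight_add_one_le (lt_of_le_not_ge hle h)
    have h2 := Order.coheight_add_one_le hztop
    rw [hQ1] at h1
    have h3 : (1 : ℕ∞) ≤ Order.coheight z := le_trans le_add_self h2
    have h4 : (1 + 1 : ℕ∞) ≤ 1 := le_trans (add_le_add_left h3 1) h1
    exact absurd h4 (by norm_num)
  exact (Specializes.antisymm (show z ⤳ Q.1 from hle) (show Q.1 ⤳ z from hge)).eq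

/-- The divisor `div(f) = ∑ ord_Q(f) Q` of a rational function. -/
def divisor (f : X.FunField) : X.Div := Finsupp.ofSupportFinite (X.ordAt f) (X.finite_ordAt f)

/-- The homomorphism `div : k(X)ˣ → Div(X)`. -/
def divHom : Additive X.FunFieldˣ →+ X.Div :=
  AddMonoidHom.mk' (fun f => X.divisor (f.toMul : X.FunFieldˣ)) fun f g => by
    ext Q
    exact Scheme.ord_mul (f.toMul).ne_zero (g.toMul).ne_zero

/-- The subgroup of principal divisors. -/
def principal : AddSubgroup X.Div := X.divHom.range

/-- The Picard group of `X`, as the group of divisor classes. -/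
abbrev Pic : Type u := X.Div ⧸ X.principal

/-- The class `[D]` of a divisor in the Picard group. -/
abbrev cls : X.Div →+ X.Pic := QuotientAddGroup.mk' X.principal

/-- The torsion subgroup `Pic(X)_tors`. -/
abbrev PicTors : AddSubgroup X.Pic := AddCommGroup.torsion X.Pic

/-- The group `Div_t(X)` of the divisors whose class in `Pic(X)` is torsion. -/
def DivT : AddSubgroup X.Div := X.PicTors.comap X.cls

theorem exists_of_mem_DivT (D : X.DivT) :
    ∃ p : ℕ × X.FunFieldˣ, 0 < p.1 ∧ X.divisor p.2 = p.1 • (D : X.Div) := by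
  obtain ⟨n, hn, h⟩ := isOfFinAddOrder_iff_nsmul_eq_zero.1 (show IsOfFinAddOrder (X.cls D) from D.2)
  rw [← map_nsmul] at h
  obtain ⟨f, hf⟩ := (QuotientAddGroup.eq_zero_iff _).1 h
  exact ⟨(n, f.toMul), hn, hf⟩

/-! ### The pairing -/

/-- `ℚ/ℤ`. -/
abbrev QmodZ : Type := AddCircle (1 : ℚ)

open Classical in
/-- The value `g(Q) ∈ k(Q)ˣ` of a rational function `g` that is a unit in the local ring at `Q`
(and the junk value `1` for all other `g`). -/
def value (g : X.FunField) (Q : X.Pt) : (X.resField Q)ˣ :=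
  if h : ∃ u : (X.localRing Q)ˣ, algebraMap (X.localRing Q) X.FunField u = g then
    Units.map (X.toScheme.residue Q.1).hom h.choose
  else 1

open Classical in
/-- A uniformizer at `Q`. -/
def uniformizer (Q : X.Pt) : X.FunField :=
  if h : ∃ π : X.FunField, X.ordAt π Q = 1 then h.choose else 1

/-- The leading coefficient
`lc_Q(f, n) = (f / π ^ ord_Q(f))(Q) ⊗ 1/n ∈ k(Q)ˣ ⊗ ℚ/ℤ`, for `n ∣ ord_Q(f)`. -/
def lc (Q : X.Pt) (f : X.FunField) (n : ℕ) : Additive (X.resField Q)ˣ ⊗[ℤ] QmodZ :=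
  Additive.ofMul (X.value (f / X.uniformizer Q ^ X.ordAt f Q) Q) ⊗ₜ[ℤ] (((1 / n : ℚ)) : QmodZ)

/-- The map `k(Q)ˣ ⊗ ℚ/ℤ → kˣ ⊗ ℚ/ℤ` induced by the norm of the finite extension `k(Q)/k`. -/
def normMap (Q : X.Pt) :
    Additive (X.resField Q)ˣ ⊗[ℤ] QmodZ →ₗ[ℤ] Additive kˣ ⊗[ℤ] QmodZ :=
  (MonoidHom.toAdditive (Units.map (Algebra.norm k : X.resField Q →* k))).toIntLinearMap.rTensor
    QmodZ

/-- For `E = ∑ eⱼ Qⱼ`, the element `∏ N_{k(Qⱼ)/k}(lc_{Qⱼ}(f, n)) ^ eⱼ` of `kˣ ⊗ ℚ/ℤ`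
(which is written additively here). -/
def pairingValue (f : X.FunField) (n : ℕ) (E : X.Div) : Additive kˣ ⊗[ℤ] QmodZ :=
  E.sum fun Q e => e • X.normMap Q (X.lc Q f n)

/-- The pairing `⟨D, E⟩ ∈ kˣ ⊗ ℚ/ℤ` of `D ∈ Div_t(X)` and `E ∈ Div⁰(X)`: choose `n > 0` and
`f ∈ k(X)ˣ` with `div(f) = n D`. (For `E` of degree zero the result does not depend on the choice.
Every element of `Div_t(X)` has degree zero.) -/
def pairing (D : X.DivT) (E : X.Div) : Additive kˣ ⊗[ℤ] QmodZ :=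
  X.pairingValue ((X.exists_of_mem_DivT D).choose.2 : X.FunField)
    (X.exists_of_mem_DivT D).choose.1 E

/-- The intrinsic subgroup of `Pic(X)_tors`: the torsion classes `a` such that `⟨a, b⟩ = 0` for all
torsion classes `b`, where `⟨[D], [E]⟩ = ⟨D, E⟩`. -/
def intrinsic : Set X.Pic :=
  {a | a ∈ X.PicTors ∧ ∀ D E : X.DivT, X.cls D = a → X.pairing D E = 0}

end Curve

/-! ### Finite morphisms -/

variable {X Y : Curve k} (φ : X.toScheme ⟶ Y.toScheme) [IsFinite φ]

/-- The image of a closed point under a finite morphism. -/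
def mapPt (P : X.Pt) : Y.Pt := ⟨φ P.1, by
  have := φ.isClosedMap _ (show IsClosed {P.1} from P.2)
  rwa [Set.image_singleton] at this⟩

/-- The ramification index of `φ` at `P`. -/
def ram (P : X.Pt) : ℕ :=
  letI := (φ.stalkMap P.1).hom.toAlgebra
  (IsLocalRing.maximalIdeal (X.localRing P)).ramificationIdx (Y.toScheme.presheaf.stalk (φ P.1))

/-- The push-forward `φ_* (∑ dᵢ Pᵢ) = ∑ dᵢ [k(Pᵢ) : k(φ(Pᵢ))] φ(Pᵢ)`. -/
def pushDiv : X.Div →+ Y.Div :=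
  Finsupp.liftAddHom fun P =>
    (Finsupp.singleAddHom (mapPt φ P)).comp (AddMonoidHom.mulRight (φ.residueDegree P.1 : ℤ))

theorem finite_fiber (Q : Y.Pt) : {P : X.Pt | mapPt φ P = Q}.Finite := by
  refine Set.Finite.of_finite_image ((φ.finite_preimage_singleton Q.1).subset ?_)
    Subtype.val_injective.injOn
  rintro _ ⟨P, hP, rfl⟩
  exact congrArg Subtype.val hP

/-- The pull-back `φ^* (∑ eⱼ Qⱼ) = ∑ eⱼ ∑_{P ∈ φ⁻¹(Qⱼ)} ram_P(φ) P`. -/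
def pullDiv : Y.Div →+ X.Div :=
  Finsupp.liftAddHom fun Q =>
    ∑ P ∈ (finite_fiber φ Q).toFinset,
      (Finsupp.singleAddHom P).comp (AddMonoidHom.mulRight (ram φ P : ℤ))

end CurvePairing

end

/-!
Write `f(E)` for the product of the norms to `k` of the values of a function `f` along a divisor
`E` disjoint from `div f` (`evalDiv`). If `div f = n D`, then `⟨D, E⟩ = f(E) ⊗ 1/n` as soon as
`D` and `E` are disjoint. Three facts make the pairing manageable.

* It does not depend on the choice of `(n, f)` (`pairing_eq`). Two choices differ, up to powers,
  by a function without zeros and poles; such a function is algebraic over `k` and takes the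
  value one along divisors of degree zero (`prod_norm_eval_of_isIntegral`).
* It depends only on the class of `D` (`pairing_congr`): adding `div g` to `D` multiplies `f` by
  `g ^ n`, and `n`-th powers are killed by `1/n`. By weak approximation, `D` can therefore be
  moved off any finite set of points (`exists_disjoint`).
* It is symmetric on divisors of torsion class (`pairing_comm`), by Weil's reciprocity law
  `f(div g) = g(div f)`.

The projection formula (`pairing_pushDiv`) follows from `φ_* (div f) = div (N f)`
(`divisor_norm`) and `N(f)(E) = f(φ^* E)` (`evalDiv_norm`), where `N` is the norm of the
extension of function fields. The statements on intrinsic subgroups follow formally: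
`⟨φ_* a, b⟩ = ⟨a, φ^* b⟩ = 0` if `a` is intrinsic on `X`, and
`⟨φ^* a, b⟩ = ⟨b, φ^* a⟩ = ⟨φ_* b, a⟩ = ⟨a, φ_* b⟩ = 0` if `a` is intrinsic on `Y`.

The local formulas for norms concern the discrete places of a finite extension `K/F` over a place
`A` of `F` (`IsFibre`). The integral closure `B` of the valuation ring of `A` is the intersection
of the valuation rings over it, and its nonzero elements are products of units and of elements
with one simple zero (`IsFibre.induction_on`). The order of a norm (`IsFibre.ord_norm`) is then a
length, and the value of a norm (`IsFibre.eval_norm`) is a determinant on `B/ϖB`, which is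
computed along a filtration by residue fields.

Weil reciprocity (`IsComplete.weil_reciprocity`) and the vanishing of the degree of principal
divisors are proved for a field `K` over `k` with a family of places comprising all its
nontrivial valuations over `k` (`IsComplete`). Every function is a quotient of functions `t` with
`dt ≠ 0`, and for these `K` is a finite separable extension of `k(t)`. The formulas for norms
reduce reciprocity for `t` and `g` to the same law on the line, for the coordinate and the norm
of `g`, where it is read off from the factorization of the latter.

The link with geometry is that the closed points of a curve are the places of its function field
(`isComplete_place`), by the valuative criterion. Smoothness enters through charts which are
étale over the affine line: they show that the local rings are discrete valuation rings and that
the differentials of the function field have rank one.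
-/

theorem Finset.prod_zpow_eq_zpow_sum₀ {ι G : Type*} [CommGroupWithZero G] {a : G} (ha : a ≠ 0)
    (s : Finset ι) (n : ι → ℤ) : ∏ i ∈ s, a ^ n i = a ^ ∑ i ∈ s, n i := by
  classical
  induction s using Finset.induction_on with
  | empty => simp
  | insert b s hb ih => rw [Finset.sum_insert hb, Finset.prod_insert hb, zpow_add₀ ha, ih]

/-! ### Discrete places of a field -/

/-- A discrete place of a field `K` over a subfield `k`: a discrete valuation ring of `K` which
contains `k`, together with a model `κ` of its residue field. Keeping the residue field as data
allows the residue field of a scheme at a point to be used without transport. -/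
structure Place (k K : Type u) [Field k] [Field K] [Algebra k K] where
  /-- the valuation ring -/
  ring : ValuationSubring K
  dvr : IsDiscreteValuationRing ring
  /-- the residue field -/
  κ : Type u
  [field : Field κ]
  [algebra : Algebra k κ]
  /-- the evaluation map -/
  ev : ring →+* κ
  ev_surjective : Function.Surjective ev
  algebraMap_mem : ∀ c : k, algebraMap k K c ∈ ring
  ev_algebraMap : ∀ c : k, ev ⟨_, algebraMap_mem c⟩ = algebraMap k κ c

namespace Place

attribute [instance] Place.dvr Place.field Place.algebra

section Basic

variable {k K : Type u} [Field k] [Field K] [Algebra k K] (P : Place k K)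

/-- The normalized discrete valuation of a place, with the value `0` at `0`. -/
noncomputable def ord (x : K) : ℤ := WithZero.log (Ring.ordFrac P.ring x)

open Classical in
/-- The value of a function at a place, with the value `0` at a pole. -/
noncomputable def eval (x : K) : P.κ := if h : x ∈ P.ring then P.ev ⟨x, h⟩ else 0

theorem eval_of_mem {x : K} (h : x ∈ P.ring) : P.eval x = P.ev ⟨x, h⟩ := dif_pos h

theorem eval_coe (x : P.ring) : P.eval (x : K) = P.ev x := dif_pos x.2

theorem ord_mul {x y : K} (hx : x ≠ 0) (hy : y ≠ 0) : P.ord (x * y) = P.ord x + P.ord y := by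
  rw [ord, map_mul, WithZero.log_mul] <;> simp [ord, hx, hy]

@[simp] theorem ord_one : P.ord 1 = 0 := by simp [ord]

@[simp] theorem ord_zero : P.ord 0 = 0 := by simp [ord]

theorem ord_inv (x : K) : P.ord x⁻¹ = -P.ord x := by
  simp [ord, map_inv₀, WithZero.log_inv]

theorem ord_div {x y : K} (hx : x ≠ 0) (hy : y ≠ 0) : P.ord (x / y) = P.ord x - P.ord y := by
  rw [div_eq_mul_inv, ord_mul _ hx (inv_ne_zero hy), ord_inv, sub_eq_add_neg]

theorem ord_zpow (x : K) (n : ℤ) : P.ord (x ^ n) = n * P.ord x := by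
  simp [ord, WithZero.log_zpow]

theorem ord_pow (x : K) (n : ℕ) : P.ord (x ^ n) = n * P.ord x := by
  simpa using P.ord_zpow x n

theorem ord_prod {ι : Type*} (s : Finset ι) (f : ι → K) (hf : ∀ i ∈ s, f i ≠ 0) :
    P.ord (∏ i ∈ s, f i) = ∑ i ∈ s, P.ord (f i) := by
  classical
  induction s using Finset.induction_on with
  | empty => simp
  | insert a s ha ih =>
    rw [Finset.prod_insert ha, Finset.sum_insert ha,
      P.ord_mul (hf a (by simp)) (Finset.prod_ne_zero_iff.2 fun i hi => hf i (by simp [hi])),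
      ih fun i hi => hf i (by simp [hi])]

theorem isUnit_iff_ord (x : P.ring) : IsUnit x ↔ (x : K) ≠ 0 ∧ P.ord x = 0 := by
  rw [Ring.isUnit_iff_ordFrac_one_of_isDiscreteValuationRing (K := K)]
  change Ring.ordFrac P.ring (x : K) = 1 ↔ _
  by_cases hx : (x : K) = 0
  · simp [hx]
  have : Ring.ordFrac P.ring (x : K) ≠ 0 := by simpa using hx
  constructor
  · intro h; exact ⟨hx, by simp [ord, h]⟩
  · rintro ⟨-, h⟩
    rw [ord] at h
    rw [← WithZero.exp_log this, h, WithZero.exp_zero]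

theorem ord_nonneg_of_mem {x : K} (h : x ∈ P.ring) : 0 ≤ P.ord x := by
  by_cases hx : x = 0
  · simp [hx]
  have h1 : 1 ≤ Ring.ordFrac P.ring (algebraMap P.ring K ⟨x, h⟩) :=
    Ring.ordFrac_ge_one_of_ne_zero (by simpa [Subtype.ext_iff] using hx)
  have := WithZero.log_le_log one_ne_zero (by simp [hx]) |>.2 h1
  simpa using! this

/-- The convention `ord 0 = 0` makes this true at `0` as well. -/
theorem mem_ring_iff {x : K} : x ∈ P.ring ↔ 0 ≤ P.ord x := by
  refine ⟨P.ord_nonneg_of_mem, fun h => ?_⟩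
  by_cases hx : x = 0
  · simp [hx]
  rcases P.ring.mem_or_inv_mem x with h1 | h1
  · exact h1
  have h2 := P.ord_nonneg_of_mem h1
  rw [ord_inv] at h2
  have h3 : IsUnit (⟨x⁻¹, h1⟩ : P.ring) :=
    (P.isUnit_iff_ord _).2 ⟨inv_ne_zero hx, by simp [ord_inv]; omega⟩
  obtain ⟨y, hy⟩ := h3.exists_right_inv
  have : (y : K) = x := by
    have := congrArg (Subtype.val) hy
    simp only [MulMemClass.coe_mul, OneMemClass.coe_one] at this
    field_simp at this
    exact this
  exact this ▸ y.2

theorem exists_ord_eq_one : ∃ x : K, x ≠ 0 ∧ P.ord x = 1 := by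
  obtain ⟨ϖ, hϖ⟩ := IsDiscreteValuationRing.exists_irreducible P.ring
  refine ⟨ϖ, by simpa using hϖ.ne_zero, ?_⟩
  have := Ring.ordFrac_irreducible (K := K) hϖ
  change Ring.ordFrac P.ring (ϖ : K) = _ at this
  rw [ord, this, WithZero.log_exp]

/-- The ultrametric inequality. The bounds on the summands are only required where these are
nonzero, as `ord 0 = 0` carries no information. -/
theorem ord_add {x y : K} (h : x + y ≠ 0) (n : ℤ) (hx : x ≠ 0 → n ≤ P.ord x)
    (hy : y ≠ 0 → n ≤ P.ord y) : n ≤ P.ord (x + y) := by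
  by_cases hx0 : x = 0
  · simp only [hx0, zero_add] at h ⊢; exact hy h
  by_cases hy0 : y = 0
  · simp only [hy0, add_zero] at h ⊢; exact hx h
  have h1 := Ring.ordFrac_add (R := P.ring) x y h
  have h2 : min (P.ord x) (P.ord y) ≤ P.ord (x + y) := by
    rcases inf_le_iff.1 h1 with h1 | h1
    · exact inf_le_iff.2 (Or.inl ((WithZero.log_le_log (by simpa) (by simpa)).2 h1))
    · exact inf_le_iff.2 (Or.inr ((WithZero.log_le_log (by simpa) (by simpa)).2 h1))
  exact (le_min (hx hx0) (hy hy0)).trans h2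

theorem ord_neg (x : K) : P.ord (-x) = P.ord x := by
  by_cases hx : x = 0
  · simp [hx]
  have h1 : P.ord (-1) = 0 := by
    have := P.ord_mul (x := -1) (y := -1) (by simp) (by simp)
    simp only [mul_neg, mul_one, neg_neg, ord_one] at this
    omega
  rw [← neg_one_mul, P.ord_mul (by simp) hx, h1, zero_add]

theorem ord_add_eq_right {x y : K} (hy : y ≠ 0) (h : x ≠ 0 → P.ord y < P.ord x) :
    x + y ≠ 0 ∧ P.ord (x + y) = P.ord y := by
  have h0 : x + y ≠ 0 := by
    intro h0
    have hxy : x = -y := eq_neg_of_add_eq_zero_left h0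
    have := h (by rw [hxy]; exact neg_ne_zero.2 hy)
    rw [hxy, ord_neg] at this
    omega
  refine ⟨h0, le_antisymm ?_ (P.ord_add h0 _ (fun hx => (h hx).le) fun _ => le_rfl)⟩
  by_contra hcon
  have h1 : P.ord y + 1 ≤ P.ord (-x + (x + y)) := P.ord_add (by simpa) _
    (fun hx => by rw [ord_neg]; exact h (by simpa using hx)) (fun _ => by omega)
  rw [neg_add_cancel_left] at h1
  omega

theorem le_ord_sum {ι : Type*} (s : Finset ι) (f : ι → K) (n : ℤ)
    (hf : ∀ i ∈ s, f i ≠ 0 → n ≤ P.ord (f i)) : ∑ i ∈ s, f i ≠ 0 → n ≤ P.ord (∑ i ∈ s, f i) := by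
  classical
  induction s using Finset.induction_on with
  | empty => simp
  | insert a s ha ih =>
    rw [Finset.sum_insert ha]
    intro h
    exact P.ord_add h n (hf a (by simp)) (ih fun i hi => hf i (by simp [hi]))

theorem ker_ev : RingHom.ker P.ev = IsLocalRing.maximalIdeal P.ring := by
  have := RingHom.ker_isMaximal_of_surjective P.ev P.ev_surjective
  exact IsLocalRing.eq_maximalIdeal this

theorem ev_eq_zero_iff (x : P.ring) : P.ev x = 0 ↔ (x : K) = 0 ∨ 0 < P.ord x := by
  rw [← RingHom.mem_ker, ker_ev, IsLocalRing.mem_maximalIdeal, mem_nonunits_iff, isUnit_iff_ord]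
  have := P.ord_nonneg_of_mem x.2
  by_cases hx : (x : K) = 0
  · simp [hx]
  · simp only [ne_eq, hx, not_false_eq_true, true_and, false_or]
    omega

theorem mem_of_ord_eq_zero {x : K} (h : P.ord x = 0) : x ∈ P.ring := P.mem_ring_iff.2 h.ge

theorem eval_ne_zero {x : K} (hx : x ≠ 0) (h : P.ord x = 0) : P.eval x ≠ 0 := by
  rw [P.eval_of_mem (P.mem_of_ord_eq_zero h)]
  intro h1
  rcases (P.ev_eq_zero_iff _).1 h1 with h2 | h2
  · exact hx h2
  · simp only [h, lt_self_iff_false] at h2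

theorem eval_mul {x y : K} (hx : x ∈ P.ring) (hy : y ∈ P.ring) :
    P.eval (x * y) = P.eval x * P.eval y := by
  rw [P.eval_of_mem hx, P.eval_of_mem hy, P.eval_of_mem (mul_mem hx hy), ← map_mul]
  rfl

theorem eval_add {x y : K} (hx : x ∈ P.ring) (hy : y ∈ P.ring) :
    P.eval (x + y) = P.eval x + P.eval y := by
  rw [P.eval_of_mem hx, P.eval_of_mem hy, P.eval_of_mem (add_mem hx hy), ← map_add]
  rfl

@[simp] theorem eval_one : P.eval 1 = 1 := by
  rw [P.eval_of_mem (one_mem _)]; exact map_one P.ev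

@[simp] theorem eval_algebraMap (c : k) : P.eval (algebraMap k K c) = algebraMap k P.κ c := by
  rw [P.eval_of_mem (P.algebraMap_mem c), P.ev_algebraMap]

theorem eval_inv {x : K} (hx : x ≠ 0) (h : P.ord x = 0) : P.eval x⁻¹ = (P.eval x)⁻¹ := by
  refine eq_inv_of_mul_eq_one_left ?_
  rw [← P.eval_mul (P.mem_of_ord_eq_zero (by rw [ord_inv, h, neg_zero]))
    (P.mem_of_ord_eq_zero h), inv_mul_cancel₀ hx, eval_one]

theorem eval_zpow {x : K} (hx : x ≠ 0) (h : P.ord x = 0) (n : ℤ) :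
    P.eval (x ^ n) = P.eval x ^ n := by
  have hpow : ∀ m : ℕ, P.eval (x ^ m) = P.eval x ^ m := by
    intro m
    induction m with
    | zero => simp
    | succ m ih =>
      rw [pow_succ, P.eval_mul (P.mem_of_ord_eq_zero (by rw [ord_pow, h, mul_zero]))
        (P.mem_of_ord_eq_zero h), ih, pow_succ]
  cases n with
  | ofNat m => simpa using hpow m
  | negSucc m =>
    rw [zpow_negSucc, zpow_negSucc, P.eval_inv (pow_ne_zero _ hx)
      (by rw [ord_pow, h, mul_zero]), hpow]

theorem eval_prod {ι : Type*} (s : Finset ι) (f : ι → K) (hf : ∀ i ∈ s, f i ∈ P.ring) :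
    P.eval (∏ i ∈ s, f i) = ∏ i ∈ s, P.eval (f i) := by
  classical
  induction s using Finset.induction_on with
  | empty => simp
  | insert a s ha ih =>
    rw [Finset.prod_insert ha, Finset.prod_insert ha,
      P.eval_mul (hf a (by simp)) (prod_mem fun i hi => hf i (by simp [hi])),
      ih fun i hi => hf i (by simp [hi])]

/-- Nonzero constants are units at every place. -/
theorem ord_algebraMap (c : k) : P.ord (algebraMap k K c) = 0 := by
  by_cases hc : c = 0
  · simp [hc]
  have h1 := P.ord_nonneg_of_mem (P.algebraMap_mem c)
  have h2 := P.ord_nonneg_of_mem (P.algebraMap_mem c⁻¹)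
  rw [map_inv₀, ord_inv] at h2
  omega

theorem ring_ne_top : P.ring ≠ ⊤ := by
  intro h
  obtain ⟨x, hx0, hx⟩ := P.exists_ord_eq_one
  have : x⁻¹ ∈ P.ring := h ▸ ValuationSubring.mem_top _
  have := P.ord_nonneg_of_mem this
  rw [ord_inv] at this
  omega

/-- A discrete valuation ring of a field is a maximal proper subring. -/
theorem eq_of_ring_le {V : ValuationSubring K} (h : P.ring ≤ V) (hV : V ≠ ⊤) : P.ring = V := by
  refine le_antisymm h fun x hx => ?_
  by_contra hxP
  apply hV
  rw [eq_top_iff]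
  intro y _
  have hx0 : x ≠ 0 := by rintro rfl; exact hxP (zero_mem _)
  have hox : P.ord x < 0 := by
    by_contra hh; exact hxP (P.mem_ring_iff.2 (not_lt.1 hh))
  by_cases hy : y = 0
  · subst hy; exact zero_mem _
  -- a large power of `x` absorbs the pole of `y`
  obtain ⟨n, hn⟩ : ∃ n : ℕ, 0 ≤ P.ord y - n * P.ord x := by
    refine ⟨(P.ord y).natAbs, ?_⟩
    have : (-(P.ord y).natAbs : ℤ) ≤ P.ord y := by omega
    nlinarith
  have h1 : y / x ^ n ∈ P.ring := P.mem_ring_iff.2 (by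
    rw [P.ord_div hy (pow_ne_zero _ hx0), ord_pow]; exact hn)
  have h2 : y = y / x ^ n * x ^ n := by field_simp
  rw [h2]
  exact mul_mem (h h1) (pow_mem hx n)

theorem ring_eq_of_ord_nonneg {Q : Place k K} (h : ∀ x, 0 ≤ P.ord x → 0 ≤ Q.ord x) :
    P.ring = Q.ring :=
  P.eq_of_ring_le (fun x hx => Q.mem_ring_iff.2 (h x (P.mem_ring_iff.1 hx))) Q.ring_ne_top

end Basic

section OfDVR

variable {k K : Type u} [Field k] [Field K] [Algebra k K]
  (R : Type u) [CommRing R] [IsDomain R] [IsDiscreteValuationRing R] [Algebra R K]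
  [IsFractionRing R K]

/-- The image of a valuation ring in its fraction field, as a valuation subring. -/
noncomputable def rangeRing : ValuationSubring K where
  toSubring := (algebraMap R K).range
  mem_or_inv_mem' x := by
    obtain ⟨r, h⟩ := ValuationRing.isInteger_or_isInteger R x
    · exact Or.inl ⟨r, h⟩
    · rename_i h
      obtain ⟨r, h⟩ := h
      exact Or.inr ⟨r, h⟩

/-- A valuation ring is isomorphic to its image in the fraction field. -/
noncomputable def rangeRingEquiv : R ≃+* rangeRing (K := K) R :=
  RingEquiv.ofBijective (algebraMap R K).rangeRestrict
    ⟨fun _ _ h => IsFractionRing.injective R K (congrArg Subtype.val h),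
      (algebraMap R K).rangeRestrict_surjective⟩

instance rangeRing_dvr : IsDiscreteValuationRing (rangeRing (K := K) R) :=
  IsDiscreteValuationRing.RingEquivClass.isDiscreteValuationRing (rangeRingEquiv (K := K) R)

/-- The place of a discrete valuation ring `R` with fraction field `K` and given residue field. The
hypothesis `hk` says that `R` contains the constants and that evaluation is the identity on them. -/
@[reducible] noncomputable def ofDVR (κ : Type u) [Field κ] [Algebra k κ] (ev : R →+* κ)
    (hev : Function.Surjective ev)
    (hk : ∀ c : k, ∃ r : R, algebraMap R K r = algebraMap k K c ∧ ev r = algebraMap k κ c) :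
    Place k K where
  ring := rangeRing R
  dvr := rangeRing_dvr R
  κ := κ
  ev := ev.comp (rangeRingEquiv (K := K) R).symm.toRingHom
  ev_surjective := hev.comp (rangeRingEquiv (K := K) R).symm.surjective
  algebraMap_mem c := by
    obtain ⟨r, h, -⟩ := hk c
    exact ⟨r, h⟩
  ev_algebraMap c := by
    obtain ⟨r, h, h1⟩ := hk c
    refine Eq.trans ?_ h1
    change ev _ = _
    congr 1
    rw [RingEquiv.toRingHom_eq_coe, RingEquiv.coe_toRingHom, RingEquiv.symm_apply_eq]
    exact Subtype.ext h.symm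

variable {κ : Type u} [Field κ] [Algebra k κ] {ev : R →+* κ}
    {hev : Function.Surjective ev}
    {hk : ∀ c : k, ∃ r : R, algebraMap R K r = algebraMap k K c ∧ ev r = algebraMap k κ c}

theorem ofDVR_eval (r : R) : (ofDVR (K := K) R κ ev hev hk).eval (algebraMap R K r) = ev r := by
  rw [eval_of_mem _ (show algebraMap R K r ∈ (ofDVR (K := K) R κ ev hev hk).ring from ⟨r, rfl⟩)]
  change ev _ = _
  congr 1
  rw [RingEquiv.toRingHom_eq_coe, RingEquiv.coe_toRingHom, RingEquiv.symm_apply_eq]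
  rfl

theorem ofDVR_ord (x : K) :
    (ofDVR (K := K) R κ ev hev hk).ord x = WithZero.log (Ring.ordFrac R x) := by
  set P := ofDVR (K := K) R κ ev hev hk
  by_cases hx : x = 0
  · simp [hx]
  obtain ⟨ϖ, hϖ⟩ := IsDiscreteValuationRing.exists_irreducible R
  have h1 : Irreducible (rangeRingEquiv (K := K) R ϖ) :=
    (MulEquiv.irreducible_iff (rangeRingEquiv (K := K) R)).2 hϖ
  have h2 : P.ord (algebraMap R K ϖ) = 1 := by
    have := Ring.ordFrac_irreducible (K := K) h1
    change Ring.ordFrac P.ring (algebraMap R K ϖ) = _ at this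
    rw [ord, this, WithZero.log_exp]
  have h3 := Ring.ordFrac_irreducible (K := K) hϖ
  have hϖ0 : algebraMap R K ϖ ≠ 0 := by simpa using hϖ.ne_zero
  set n := WithZero.log (Ring.ordFrac R x)
  have h4 : Ring.ordFrac R (algebraMap R K ϖ ^ n) = Ring.ordFrac R x := by
    rw [map_zpow₀, h3, ← WithZero.exp_zsmul, smul_eq_mul, mul_one, WithZero.exp_log]
    simpa using hx
  obtain ⟨u, hu⟩ := Ring.associated_of_ordFrac_eq _ _ h4
  have h5 : P.ord (algebraMap R K u) = 0 :=
    ((P.isUnit_iff_ord (rangeRingEquiv (K := K) R u)).1 (u.isUnit.map (rangeRingEquiv R))).2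
  have h6 : algebraMap R K u ≠ 0 := by simp
  rw [Units.smul_def, Algebra.smul_def] at hu
  rw [← hu, P.ord_mul h6 (zpow_ne_zero _ hϖ0), h5, ord_zpow, h2]
  ring

end OfDVR

section WeakApproximation

variable {k K : Type u} [Field k] [Field K] [Algebra k K]

open Classical in
/-- The absolute value `x ↦ 2 ^ (- ord x)` of a place. -/
noncomputable def abv (P : Place k K) : AbsoluteValue K ℝ where
  toFun x := if x = 0 then 0 else (2 : ℝ) ^ (-P.ord x)
  map_mul' x y := by
    by_cases hx : x = 0
    · simp [hx]
    by_cases hy : y = 0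
    · simp [hy]
    simp only [mul_eq_zero, hx, hy, or_self, if_false]
    rw [P.ord_mul hx hy, neg_add, zpow_add₀ two_ne_zero]
  nonneg' x := by split_ifs <;> positivity
  eq_zero' x := by
    constructor
    · intro h
      by_contra hx
      simp only [hx, if_false] at h
      exact (zpow_ne_zero _ two_ne_zero) h
    · rintro rfl; simp
  add_le' x y := by
    by_cases hx : x = 0
    · simp [hx]
    by_cases hy : y = 0
    · simp [hy]
    by_cases hxy : x + y = 0
    · simp only [hxy, hx, hy, if_true, if_false]; positivity
    simp only [hxy, hx, hy, if_false]
    rcases le_total (P.ord x) (P.ord y) with h | h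
    · have := P.ord_add hxy _ (fun _ => le_rfl) (fun _ => h)
      exact (zpow_le_zpow_right₀ one_le_two (neg_le_neg this)).trans
        (le_add_of_nonneg_right (by positivity))
    · have := P.ord_add hxy _ (fun _ => h) (fun _ => le_rfl)
      exact (zpow_le_zpow_right₀ one_le_two (neg_le_neg this)).trans
        (le_add_of_nonneg_left (by positivity))

theorem abv_apply (P : Place k K) {x : K} (hx : x ≠ 0) : P.abv x = (2 : ℝ) ^ (-P.ord x) :=
  if_neg hx

theorem abv_lt_one (P : Place k K) {x : K} (hx : x ≠ 0) : P.abv x < 1 ↔ 0 < P.ord x := by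
  rw [abv_apply P hx, zpow_lt_one_iff_right₀ one_lt_two]
  omega

theorem one_lt_abv (P : Place k K) {x : K} (hx : x ≠ 0) : 1 < P.abv x ↔ P.ord x < 0 := by
  rw [abv_apply P hx, one_lt_zpow_iff_right₀ one_lt_two]
  omega

variable {ι : Type*} [Finite ι] (P : ι → Place k K)

/-- Weak approximation for finitely many distinct discrete places. -/
theorem weak_approximation (hP : Function.Injective fun i => (P i).ring) (x : ι → K) (n : ℤ) :
    ∃ b : K, ∀ i, b - x i ≠ 0 → n ≤ (P i).ord (b - x i) := by
  classical
  have := Fintype.ofFinite ι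
  have hsep := AbsoluteValue.exists_one_lt_lt_one_pi_of_not_isEquiv (v := fun i => (P i).abv)
    (fun i => by
      obtain ⟨ϖ, h0, h1⟩ := (P i).exists_ord_eq_one
      exact ⟨ϖ, h0, ((abv_lt_one _ h0).2 (by omega)).ne⟩)
    (fun i j hij h => hij (hP ((P i).ring_eq_of_ord_nonneg fun x hx => by
      by_cases hx0 : x = 0
      · simp [hx0]
      have := h.one_lt_iff (x := x)
      rw [one_lt_abv _ hx0, one_lt_abv _ hx0] at this
      omega)))
  choose a ha ha' using hsep
  have ha0 : ∀ i, a i ≠ 0 := fun i h => by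
    have := ha i
    rw [h, map_zero] at this
    linarith
  have hai : ∀ i, (P i).ord (a i) < 0 := fun i => (one_lt_abv _ (ha0 i)).1 (ha i)
  have haj : ∀ i j, j ≠ i → 0 < (P j).ord (a i) := fun i j h =>
    (abv_lt_one _ (ha0 i)).1 (ha' i j h)
  -- an exponent which dominates the poles of all `x i`
  obtain ⟨m, hm0, hm⟩ : ∃ m : ℕ, 0 < m ∧ ∀ i j, n ≤ m + (P j).ord (x i) := by
    let N := ∑ i, ∑ j, (n - (P j).ord (x i)).natAbs
    refine ⟨N + 1, by omega, fun i j => ?_⟩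
    have h1 : (n - (P j).ord (x i)).natAbs ≤ N :=
      (Finset.single_le_sum (f := fun j => (n - (P j).ord (x i)).natAbs)
        (fun _ _ => Nat.zero_le _) (Finset.mem_univ j)).trans
      (Finset.single_le_sum (f := fun i => ∑ j, (n - (P j).ord (x i)).natAbs)
        (fun _ _ => Nat.zero_le _) (Finset.mem_univ i))
    push_cast
    omega
  have hd0 : ∀ i, 1 + a i ^ m ≠ 0 := fun i h => by
    have h1 : (P i).ord (a i ^ m) = 0 := by
      rw [← neg_eq_iff_add_eq_zero.2 h, ord_neg, ord_one]
    rw [ord_pow] at h1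
    have := hai i
    have : (m : ℤ) * (P i).ord (a i) < 0 := mul_neg_of_pos_of_neg (by omega) this
    omega
  have hdi : ∀ i, (P i).ord (1 + a i ^ m) ≤ -m := fun i => by
    by_contra hcon
    have h1 : -(m : ℤ) + 1 ≤ (P i).ord ((1 + a i ^ m) + -1) := (P i).ord_add
      (by simpa using ha0 i |> pow_ne_zero m) _ (fun _ => by omega)
      (fun _ => by rw [ord_neg, ord_one]; omega)
    rw [add_neg_cancel_comm, ord_pow] at h1
    have := hai i
    nlinarith
  have hdj : ∀ i j, j ≠ i → (P j).ord (1 + a i ^ m) ≤ 0 := fun i j hij => by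
    by_contra hcon
    have h2 := haj i j hij
    have h1 : 1 ≤ (P j).ord ((1 + a i ^ m) + -(a i ^ m)) := (P j).ord_add
      (by simp) _ (fun _ => by omega)
      (fun _ => by rw [ord_neg, ord_pow]; nlinarith)
    rw [add_neg_cancel_right, ord_one] at h1
    omega
  -- `a i ^ m / (1 + a i ^ m)` is close to `1` at `i` and close to `0` at all other places
  refine ⟨∑ i, x i * (a i ^ m / (1 + a i ^ m)), fun i => ?_⟩
  have hsum : ∑ j, x j * (a j ^ m / (1 + a j ^ m)) - x i =
      ∑ j, if j = i then x i * (-(1 + a i ^ m)⁻¹) else x j * (a j ^ m / (1 + a j ^ m)) := by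
    rw [← Finset.add_sum_erase _ _ (Finset.mem_univ i), ← Finset.add_sum_erase _ _
      (Finset.mem_univ i), if_pos rfl, Finset.sum_congr rfl fun j hj =>
      (if_neg (Finset.ne_of_mem_erase hj) : (if j = i then x i * (-(1 + a i ^ m)⁻¹) else _) = _)]
    have := hd0 i
    field_simp
    ring
  rw [hsum]
  refine (P i).le_ord_sum _ _ _ fun j _ hne => ?_
  split_ifs at hne ⊢ with hji
  · subst hji
    have hx0 : x j ≠ 0 := left_ne_zero_of_mul hne
    rw [(P j).ord_mul hx0 (right_ne_zero_of_mul hne), ord_neg, ord_inv]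
    have := hm j j
    have := hdi j
    omega
  · have hx0 : x j ≠ 0 := left_ne_zero_of_mul hne
    rw [(P i).ord_mul hx0 (right_ne_zero_of_mul hne), (P i).ord_div (pow_ne_zero _ (ha0 j))
      (hd0 j), ord_pow]
    have h1 := hm j i
    have h2 := hdj j i (Ne.symm hji)
    have h3 := haj j i (Ne.symm hji)
    nlinarith

/-- There are functions with prescribed orders at finitely many distinct discrete places. -/
theorem exists_ord_eq (hP : Function.Injective fun i => (P i).ring) (n : ι → ℤ) :
    ∃ b : K, b ≠ 0 ∧ ∀ i, (P i).ord b = n i := by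
  classical
  have := Fintype.ofFinite ι
  choose ϖ h0 h1 using fun i => (P i).exists_ord_eq_one
  obtain ⟨N, hN⟩ : ∃ N : ℤ, ∀ i, n i < N := by
    refine ⟨∑ i, |n i| + 1, fun i => ?_⟩
    have := Finset.single_le_sum (f := fun i => |n i|) (fun _ _ => abs_nonneg _)
      (Finset.mem_univ i)
    have := le_abs_self (n i)
    omega
  rcases isEmpty_or_nonempty ι with hι | ⟨⟨i₀⟩⟩
  · exact ⟨1, one_ne_zero, fun i => hι.elim i⟩
  obtain ⟨b, hb⟩ := weak_approximation P hP (fun i => ϖ i ^ n i) N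
  have hx0 : ∀ i, ϖ i ^ n i ≠ 0 := fun i => zpow_ne_zero _ (h0 i)
  have hx1 : ∀ i, (P i).ord (ϖ i ^ n i) = n i := fun i => by rw [ord_zpow, h1, mul_one]
  have key : ∀ i, b ≠ 0 ∧ (P i).ord b = n i := fun i => by
    have := (P i).ord_add_eq_right (hx0 i) (x := b - ϖ i ^ n i)
      (fun h => by rw [hx1]; exact (hN i).trans_le (hb i h))
    rwa [sub_add_cancel, hx1] at this
  exact ⟨b, (key i₀).1, fun i => (key i).2⟩

end WeakApproximation

end Place

/-! ### Norms and quotients -/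

/-- The order of vanishing of a norm is the length of the cokernel of multiplication. -/
theorem ord_norm_eq_length {A B : Type*} [CommRing A] [IsDomain A] [IsPrincipalIdealRing A]
    [CommRing B] [IsDomain B] [Algebra A B] [Module.Free A B] [Module.Finite A B] {b : B}
    (hb : b ≠ 0) : Ring.ord A (Algebra.norm A b) = Module.length A (B ⧸ Ideal.span {b}) := by
  classical
  have hI : Ideal.span {b} ≠ ⊥ := by simpa
  let β := Module.Free.chooseBasis A B
  rw [((Ideal.span {b}).quotientEquivPiSpan β hI).length_eq, Module.length_pi_of_fintype]
  obtain ⟨v, hv⟩ := associated_norm_prod_smith β hb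
  have h1 : Ring.ord A (Algebra.norm A b) =
      Ring.ord A (∏ i, Ideal.smithCoeffs β _ hI i) := by
    rw [← hv, Ring.ord_mul _ (by simp), Ring.ord_of_isUnit v.isUnit, add_zero]
  rw [h1]
  have h2 : ∀ s : Finset (Module.Free.ChooseBasisIndex A B),
      Ring.ord A (∏ i ∈ s, Ideal.smithCoeffs β _ hI i) =
        ∑ i ∈ s, Ring.ord A (Ideal.smithCoeffs β _ hI i) := by
    intro s
    induction s using Finset.induction_on with
    | empty => simp
    | insert a s ha ih =>
      rw [Finset.prod_insert ha, Finset.sum_insert ha, mul_comm, Ring.ord_mul, ih, add_comm]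
      exact mem_nonZeroDivisors_of_ne_zero <| Ideal.smithCoeffs_ne_zero β _ hI a
  exact h2 Finset.univ

/-- Determinants of compatible endomorphisms are multiplicative in short exact sequences. -/
theorem det_eq_of_exact {κ M' M M'' : Type*} [Field κ] [AddCommGroup M'] [AddCommGroup M]
    [AddCommGroup M''] [Module κ M'] [Module κ M] [Module κ M''] [Module.Finite κ M]
    (f : M' →ₗ[κ] M) (g : M →ₗ[κ] M'') (hf : Function.Injective f) (hg : Function.Surjective g)
    (hfg : Function.Exact f g) (e' : M' →ₗ[κ] M') (e : M →ₗ[κ] M) (e'' : M'' →ₗ[κ] M'')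
    (h' : ∀ x, f (e' x) = e (f x)) (h'' : ∀ x, g (e x) = e'' (g x)) :
    LinearMap.det e = LinearMap.det e' * LinearMap.det e'' := by
  have he : LinearMap.range f ≤ (LinearMap.range f).comap e := by
    rintro _ ⟨x, rfl⟩
    exact ⟨e' x, h' x⟩
  rw [LinearMap.det_eq_det_mul_det (LinearMap.range f) e he]
  let ε := LinearEquiv.ofInjective f hf
  have hker : LinearMap.range f = LinearMap.ker g := (LinearMap.exact_iff.1 hfg).symm
  let δ : (M ⧸ LinearMap.range f) ≃ₗ[κ] M'' :=
    (Submodule.quotEquivOfEq _ _ hker).trans (g.quotKerEquivOfSurjective hg)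
  congr 1
  · rw [← LinearMap.det_conj e' ε]
    congr 1
    ext ⟨_, x, rfl⟩
    have hx : (⟨f x, ⟨x, rfl⟩⟩ : LinearMap.range f) = ε x := rfl
    rw [hx]
    simp only [LinearMap.comp_apply, LinearEquiv.coe_coe, LinearEquiv.symm_apply_apply]
    exact (h' x).symm
  · rw [← LinearMap.det_conj _ δ]
    congr 1
    ext y
    obtain ⟨x, rfl⟩ := hg y
    have hx : δ.symm (g x) = Submodule.Quotient.mk x := by
      rw [LinearEquiv.symm_apply_eq]; rfl
    simp only [LinearMap.comp_apply, LinearEquiv.coe_coe, hx]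
    exact (h'' x)

/-- Multiplicativity of norms in the exact sequence `0 → S/(c) → S/(bc) → S/(b) → 0`. -/
theorem norm_quotient_span_mul {κ S : Type*} [Field κ] [CommRing S] [Algebra κ S]
    [Module.Finite κ S] (b c u : S) (h : ∀ s, b * s ∈ Ideal.span {b * c} → s ∈ Ideal.span {c}) :
    Algebra.norm κ (Ideal.Quotient.mk (Ideal.span {b * c}) u) =
      Algebra.norm κ (Ideal.Quotient.mk (Ideal.span {c}) u) *
        Algebra.norm κ (Ideal.Quotient.mk (Ideal.span {b}) u) := by
  have hle : Ideal.span {b * c} ≤ Ideal.span {b} :=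
    Ideal.span_singleton_le_span_singleton.2 (dvd_mul_right b c)
  let f : (S ⧸ Ideal.span {c}) →ₗ[κ] S ⧸ Ideal.span {b * c} :=
    (Submodule.mapQ (Ideal.span {c}) (Ideal.span {b * c}) (LinearMap.mulLeft S b) (by
      intro x hx
      obtain ⟨y, rfl⟩ := Ideal.mem_span_singleton.1 hx
      exact Ideal.mem_span_singleton.2 ⟨y, by simp [mul_assoc]⟩)).restrictScalars κ
  have hf : ∀ x, f (Ideal.Quotient.mk _ x) = Ideal.Quotient.mk _ (b * x) := fun x => rfl
  let g : (S ⧸ Ideal.span {b * c}) →ₗ[κ] S ⧸ Ideal.span {b} :=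
    (Ideal.Quotient.factorₐ κ hle).toLinearMap
  have hg : ∀ x, g (Ideal.Quotient.mk _ x) = Ideal.Quotient.mk _ x := fun x => rfl
  refine det_eq_of_exact f g ?_ ?_ ?_ _ _ _ ?_ ?_
  · rw [injective_iff_map_eq_zero]
    intro x hx
    obtain ⟨x, rfl⟩ := Ideal.Quotient.mk_surjective x
    rw [hf, Ideal.Quotient.eq_zero_iff_mem] at hx
    exact Ideal.Quotient.eq_zero_iff_mem.2 (h x hx)
  · intro x
    obtain ⟨x, rfl⟩ := Ideal.Quotient.mk_surjective x
    exact ⟨_, hg x⟩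
  · intro x
    obtain ⟨x, rfl⟩ := Ideal.Quotient.mk_surjective x
    rw [hg, Ideal.Quotient.eq_zero_iff_mem]
    constructor
    · intro hx
      obtain ⟨y, rfl⟩ := Ideal.mem_span_singleton.1 hx
      exact ⟨Ideal.Quotient.mk _ y, hf y⟩
    · rintro ⟨y, hy⟩
      obtain ⟨y, rfl⟩ := Ideal.Quotient.mk_surjective y
      rw [hf, Ideal.Quotient.eq] at hy
      have := Ideal.sub_mem _ (Ideal.mem_span_singleton.2 (dvd_mul_right b y)) (hle hy)
      rwa [sub_sub_cancel] at this
  · intro x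
    obtain ⟨x, rfl⟩ := Ideal.Quotient.mk_surjective x
    change f (Ideal.Quotient.mk _ (u * x)) = Ideal.Quotient.mk _ u * f (Ideal.Quotient.mk _ x)
    rw [hf, hf, ← map_mul]
    congr 1; ring
  · intro x
    obtain ⟨x, rfl⟩ := Ideal.Quotient.mk_surjective x
    rfl

section BaseChange

variable {A κ B : Type*} [CommRing A] [Field κ] [Algebra A κ] [CommRing B] [Algebra A B]

theorem one_tmul_surjective (hA : Function.Surjective (algebraMap A κ)) (x : κ ⊗[A] B) :
    ∃ b : B, (1 : κ) ⊗ₜ[A] b = x := by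
  induction x with
  | zero => exact ⟨0, by simp⟩
  | add x y hx hy =>
    obtain ⟨a, rfl⟩ := hx
    obtain ⟨b, rfl⟩ := hy
    exact ⟨a + b, TensorProduct.tmul_add _ _ _⟩
  | tmul c b =>
    obtain ⟨a, rfl⟩ := hA c
    refine ⟨a • b, ?_⟩
    rw [TensorProduct.tmul_smul, TensorProduct.smul_tmul', Algebra.smul_def, mul_one]

/-- Norms commute with base change. -/
theorem norm_one_tmul [Module.Free A B] [Module.Finite A B] (b : B) :
    Algebra.norm κ ((1 : κ) ⊗ₜ[A] b) = algebraMap A κ (Algebra.norm A b) := by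
  have h : Algebra.lmul κ (κ ⊗[A] B) ((1 : κ) ⊗ₜ[A] b) =
      (Algebra.lmul A B b).baseChange κ := by
    refine TensorProduct.AlgebraTensorModule.ext fun x y => ?_
    simp
  rw [Algebra.norm_apply, Algebra.norm_apply, ← LinearMap.det_baseChange, h]

/-- If `κ` is a quotient of `A`, then `κ ⊗ B` is the quotient of `B` by the ideal generated by the
kernel. -/
theorem mem_map_ker_of_one_tmul_eq_zero (hA : Function.Surjective (algebraMap A κ)) {b : B}
    (hb : (1 : κ) ⊗ₜ[A] b = 0) : b ∈ (RingHom.ker (algebraMap A κ)).map (algebraMap A B) := by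
  have h := Algebra.TensorProduct.rTensor_ker (R := A) (C := B) (Algebra.ofId A κ) hA
  have h1 : (1 : A) ⊗ₜ[A] b ∈
      RingHom.ker (Algebra.TensorProduct.map (Algebra.ofId A κ) (AlgHom.id A B)) := by
    rw [RingHom.mem_ker, Algebra.TensorProduct.map_tmul, map_one]
    exact hb
  rw [h] at h1
  have h2 : (RingHom.ker (Algebra.ofId A κ)).map
      (Algebra.TensorProduct.includeLeft : A →ₐ[A] A ⊗[A] B) ≤
      ((RingHom.ker (algebraMap A κ)).map (algebraMap A B)).comap
        (Algebra.TensorProduct.lid A B) := by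
    rw [Ideal.map_le_iff_le_comap]
    intro a ha
    have := Ideal.mem_map_of_mem (algebraMap A B) (show a ∈ RingHom.ker (algebraMap A κ) from ha)
    simpa [Ideal.mem_comap, Algebra.algebraMap_eq_smul_one] using this
  simpa using h2 h1

end BaseChange

/-! ### Places in a finite extension -/

namespace Place

section Over

variable {k F K : Type u} [Field k] [Field F] [Field K] [Algebra k F] [Algebra k K] [Algebra F K]

/-- A place `P` of `K` lies over a place `A` of `F`. -/
def Over (P : Place k K) (A : Place k F) : Prop := P.ring.comap (algebraMap F K) = A.ring

variable {P : Place k K} {A : Place k F}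

theorem Over.mem_iff (h : P.Over A) {x : F} : algebraMap F K x ∈ P.ring ↔ x ∈ A.ring := by
  rw [← h, ValuationSubring.mem_comap]

theorem Over.ord_eq_zero_iff (h : P.Over A) {x : F} :
    P.ord (algebraMap F K x) = 0 ↔ A.ord x = 0 := by
  have h1 := h.mem_iff (x := x)
  have h2 := h.mem_iff (x := x⁻¹)
  rw [map_inv₀] at h2
  simp only [mem_ring_iff, ord_inv] at h1 h2
  omega

variable (A) in
/-- A uniformizer of a place. -/
noncomputable def unif : F := A.exists_ord_eq_one.choose

theorem unif_ne_zero : A.unif ≠ 0 := A.exists_ord_eq_one.choose_spec.1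

theorem ord_unif : A.ord A.unif = 1 := A.exists_ord_eq_one.choose_spec.2

variable (P A) in
/-- The ramification index of `P` over `A`: the order at `P` of a uniformizer at `A`. -/
noncomputable def ramIdx : ℕ := (P.ord (algebraMap F K A.unif)).toNat

/-- In particular, the natural number `ramIdx` is not a truncation of a negative order. -/
theorem Over.ramIdx_pos (h : P.Over A) : 0 < P.ramIdx A := by
  have h1 : ¬ A.unif⁻¹ ∈ A.ring := by
    rw [mem_ring_iff, ord_inv, ord_unif]; norm_num
  rw [← h.mem_iff, map_inv₀, mem_ring_iff, ord_inv] at h1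
  rw [ramIdx]
  omega

theorem Over.ord_algebraMap (h : P.Over A) (x : F) :
    P.ord (algebraMap F K x) = P.ramIdx A * A.ord x := by
  by_cases hx : x = 0
  · simp [hx]
  have h0 : A.unif ^ A.ord x ≠ 0 := zpow_ne_zero _ unif_ne_zero
  have h1 : A.ord (x / A.unif ^ A.ord x) = 0 := by
    rw [A.ord_div hx h0, ord_zpow, ord_unif]; ring
  rw [← h.ord_eq_zero_iff, map_div₀, map_zpow₀, P.ord_div (by simpa)
    (by rw [← map_zpow₀]; exact (map_ne_zero _).2 h0), ord_zpow] at h1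
  have h2 := h.ramIdx_pos
  rw [ramIdx] at h2 ⊢
  rw [Int.toNat_of_nonneg (by omega)]
  linarith

theorem Over.ev_eq_zero (h : P.Over A) (x : A.ring) (hx : A.ev x = 0) :
    P.ev ⟨algebraMap F K x, h.mem_iff.2 x.2⟩ = 0 := by
  rw [ev_eq_zero_iff] at hx ⊢
  rcases hx with hx | hx
  · left; simpa using hx
  · right
    rw [h.ord_algebraMap]
    exact mul_pos (by exact_mod_cast h.ramIdx_pos) hx

/-- The inclusion of valuation rings. -/
def Over.ringMap (h : P.Over A) : A.ring →+* P.ring :=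
  ((algebraMap F K).comp A.ring.subtype).codRestrict P.ring.toSubring
    fun x => h.mem_iff.2 x.2

/-- The inclusion of residue fields. -/
noncomputable def Over.resMap (h : P.Over A) : A.κ →+* P.κ :=
  RingHom.liftOfSurjective A.ev A.ev_surjective ⟨P.ev.comp h.ringMap, fun x hx =>
    h.ev_eq_zero x hx⟩

theorem Over.resMap_ev (h : P.Over A) (x : A.ring) :
    h.resMap (A.ev x) = P.eval (algebraMap F K x) := by
  rw [P.eval_of_mem (h.mem_iff.2 x.2)]
  exact RingHom.liftOfRightInverse_comp_apply _ _ _ ⟨P.ev.comp h.ringMap, _⟩ _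

theorem Over.resMap_eval (h : P.Over A) {x : F} (hx : x ∈ A.ring) :
    h.resMap (A.eval x) = P.eval (algebraMap F K x) := by
  rw [A.eval_of_mem hx, h.resMap_ev]

/-- The residue degree. -/
noncomputable def Over.inertiaDeg (h : P.Over A) : ℕ :=
  letI := h.resMap.toAlgebra
  Module.finrank A.κ P.κ

/-- The norm of the extension of residue fields. -/
noncomputable def Over.resNorm (h : P.Over A) : P.κ →* A.κ :=
  letI := h.resMap.toAlgebra
  Algebra.norm A.κ

theorem Over.resMap_algebraMap [IsScalarTower k F K] (h : P.Over A) (c : k) :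
    h.resMap (algebraMap k A.κ c) = algebraMap k P.κ c := by
  rw [← A.eval_algebraMap, h.resMap_eval (A.algebraMap_mem c), ← IsScalarTower.algebraMap_apply,
    P.eval_algebraMap]

theorem Over.norm_resNorm [IsScalarTower k F K] (h : P.Over A)
    [FiniteDimensional k P.κ] (x : P.κ) :
    Algebra.norm k (h.resNorm x) = Algebra.norm k x := by
  let _ := h.resMap.toAlgebra
  have : IsScalarTower k A.κ P.κ := .of_algebraMap_eq fun c => (h.resMap_algebraMap c).symm
  have : FiniteDimensional A.κ P.κ := .right k _ _
  have : FiniteDimensional k A.κ := .left k _ P.κ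
  exact Algebra.norm_norm

theorem Over.finrank_mul_inertiaDeg [IsScalarTower k F K] (h : P.Over A) :
    Module.finrank k A.κ * h.inertiaDeg = Module.finrank k P.κ := by
  let _ := h.resMap.toAlgebra
  have : IsScalarTower k A.κ P.κ := .of_algebraMap_eq fun c => (h.resMap_algebraMap c).symm
  exact Module.finrank_mul_finrank _ _ _

theorem Over.norm_algebraMap_resMap [IsScalarTower k F K] (h : P.Over A)
    [FiniteDimensional k P.κ] (x : A.κ) :
    Algebra.norm k (h.resMap x) = Algebra.norm k x ^ h.inertiaDeg := by
  let _ := h.resMap.toAlgebra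
  have h1 := h.norm_resNorm (h.resMap x)
  have : IsScalarTower k A.κ P.κ := .of_algebraMap_eq fun c => (h.resMap_algebraMap c).symm
  have : FiniteDimensional A.κ P.κ := .right k _ _
  rw [← h1, ← map_pow]
  congr 1
  exact Algebra.norm_algebraMap (S := P.κ) x

end Over

/-- The places `P i` are all the places of `K` over the place `A` of `F`, without repetition, and
the integral closure in `K` of the valuation ring of `A` is a finite module. -/
structure IsFibre {k F K : Type u} {ι : Type*} [Field k] [Field F] [Field K] [Algebra k F]
    [Algebra k K] [Algebra F K] (A : Place k F) (P : ι → Place k K) : Prop where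
  lies_over : ∀ i, (P i).Over A
  inj : Function.Injective fun i => (P i).ring
  complete : ∀ V : ValuationSubring K, V.comap (algebraMap F K) = A.ring → ∃ i, (P i).ring = V
  finite : Module.Finite A.ring (integralClosure A.ring K)

namespace IsFibre

variable {k F K : Type u} {ι : Type*} [Field k] [Field F] [Field K] [Algebra k F] [Algebra k K]
  [Algebra F K] {A : Place k F} {P : ι → Place k K}

/-- The integral closure of the valuation ring of `A` is the intersection of the valuation rings
over it, as every valuation ring of `K` containing the integral closure but not `F` lies over `A`.
-/
theorem mem_integralClosure (h : IsFibre A P) [Algebra.IsIntegral F K] {x : K} :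
    x ∈ integralClosure A.ring K ↔ ∀ i, x ∈ (P i).ring := by
  constructor
  · rintro ⟨p, hp, hx⟩ i
    have hint : IsIntegral (P i).ring x := by
      refine ⟨p.map (h.lies_over i).ringMap, hp.map _, ?_⟩
      rw [Polynomial.eval₂_map]
      exact hx
    obtain ⟨y, rfl⟩ := IsIntegrallyClosed.isIntegral_iff.1 hint
    exact y.2
  · intro hx
    by_contra hcon
    have : IsIntegrallyClosedIn (integralClosure A.ring K).toSubring K :=
      inferInstanceAs (IsIntegrallyClosedIn (integralClosure A.ring K) K)
    obtain ⟨V, hV, hxV⟩ := Subring.exists_le_valuationSubring_of_isIntegrallyClosedIn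
      (R := (integralClosure A.ring K).toSubring) hcon
    have hle : A.ring ≤ V.comap (algebraMap F K) := fun a ha =>
      hV ((integralClosure A.ring K).algebraMap_mem ⟨a, ha⟩)
    have hne : V.comap (algebraMap F K) ≠ ⊤ := by
      intro htop
      -- otherwise `V` contains `F`, hence the integral extension `K`
      apply hxV
      obtain ⟨p, hp, hpx⟩ := Algebra.IsIntegral.isIntegral (R := F) x
      let φ : F →+* V := (algebraMap F K).codRestrict V.toSubring fun y =>
        (show y ∈ V.comap (algebraMap F K) from htop ▸ ValuationSubring.mem_top y)
      have hint : IsIntegral V x := by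
        refine ⟨p.map φ, hp.map _, ?_⟩
        rw [Polynomial.eval₂_map]
        exact hpx
      obtain ⟨y, rfl⟩ := IsIntegrallyClosed.isIntegral_iff.1 hint
      exact y.2
    obtain ⟨i, hi⟩ := h.complete V (A.eq_of_ring_le hle hne).symm
    exact hxV (hi ▸ hx i)

end IsFibre

end Place

/-! ### Norms in a finite extension -/

namespace Place.IsFibre

variable {k F K : Type u} {ι : Type*} [Field k] [Field F] [Field K] [Algebra k F] [Algebra k K]
  [Algebra F K] {A : Place k F} {P : ι → Place k K}

theorem free (h : IsFibre A P) : Module.Free A.ring (integralClosure A.ring K) :=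
  have := h.finite
  Module.free_of_finite_type_torsion_free'

theorem coe_norm [FiniteDimensional F K] (h : IsFibre A P) (b : integralClosure A.ring K) :
    Algebra.norm F (b : K) = (Algebra.norm A.ring b : F) := by
  have := h.finite
  have := h.free
  have := IsIntegralClosure.isLocalization A.ring F K (integralClosure A.ring K)
  exact Algebra.norm_localization A.ring (nonZeroDivisors A.ring) b

/-- Divisibility in the integral closure is decided by the orders at the places of the fibre. -/
theorem dvd_of_ord_le [FiniteDimensional F K] (h : IsFibre A P) {b c : integralClosure A.ring K}
    (hb : b ≠ 0) (hbc : c ≠ 0 → ∀ i, (P i).ord b ≤ (P i).ord c) : b ∣ c := by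
  by_cases hc : c = 0
  · simp [hc]
  have hb' : (b : K) ≠ 0 := by simpa using hb
  have hc' : (c : K) ≠ 0 := by simpa using hc
  have hmem : (c : K) / b ∈ integralClosure A.ring K := h.mem_integralClosure.2 fun i => by
    rw [mem_ring_iff, (P i).ord_div hc' hb']
    have := hbc hc i
    omega
  exact ⟨⟨_, hmem⟩, Subtype.ext (by simp only [MulMemClass.coe_mul]; field_simp)⟩

theorem ord_nonneg [FiniteDimensional F K] (h : IsFibre A P) (b : integralClosure A.ring K)
    (i : ι) : 0 ≤ (P i).ord (b : K) :=
  (P i).ord_nonneg_of_mem (h.mem_integralClosure.1 b.2 i)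

/-- The maximal ideals of the integral closure are principal: by weak approximation, there are
functions with one simple zero in the fibre. -/
theorem exists_generator [Finite ι] [FiniteDimensional F K] (h : IsFibre A P) (i : ι) :
    ∃ c : integralClosure A.ring K, c ≠ 0 ∧ (P i).ord (c : K) = 1 ∧
      ∀ j ≠ i, (P j).ord (c : K) = 0 := by
  classical
  obtain ⟨c, hc0, hc⟩ := exists_ord_eq P h.inj (Pi.single i 1)
  have hmem : c ∈ integralClosure A.ring K := h.mem_integralClosure.2 fun j => by
    rw [mem_ring_iff, hc, Pi.single_apply]
    split_ifs <;> norm_num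
  refine ⟨⟨c, hmem⟩, by simpa [Subtype.ext_iff] using hc0, by simpa using hc i, fun j hj => ?_⟩
  simpa [hj] using hc j

/-- Evaluation at `P i` on the integral closure. -/
noncomputable def evB [FiniteDimensional F K] (h : IsFibre A P) (i : ι) :
    integralClosure A.ring K →+* (P i).κ :=
  (P i).ev.comp ((integralClosure A.ring K).val.toRingHom.codRestrict (P i).ring.toSubring
    fun b => h.mem_integralClosure.1 b.2 i)

theorem evB_eq_eval [FiniteDimensional F K] (h : IsFibre A P) (i : ι)
    (b : integralClosure A.ring K) : h.evB i b = (P i).eval (b : K) :=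
  ((P i).eval_of_mem (h.mem_integralClosure.1 b.2 i)).symm

/-- By weak approximation, the integral closure has the same residue fields as the valuation rings
of the fibre. -/
theorem evB_surjective [Finite ι] [FiniteDimensional F K] (h : IsFibre A P) (i : ι) :
    Function.Surjective (h.evB i) := by
  classical
  intro y
  obtain ⟨r, rfl⟩ := (P i).ev_surjective y
  obtain ⟨b, hb⟩ := weak_approximation P h.inj (Pi.single i (r : K)) 1
  have hr : ∀ j, Pi.single (M := fun _ => K) i (r : K) j ∈ (P j).ring := by
    intro j
    by_cases hj : j = i
    · subst hj; simp
    · simp [hj]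
  have hsub : ∀ j, b - Pi.single (M := fun _ => K) i (r : K) j ∈ (P j).ring := by
    intro j
    by_cases h0 : b - Pi.single (M := fun _ => K) i (r : K) j = 0
    · rw [h0]; exact zero_mem _
    · rw [mem_ring_iff]; have := hb j h0; omega
  have hmem : b ∈ integralClosure A.ring K := h.mem_integralClosure.2 fun j => by
    simpa using add_mem (hsub j) (hr j)
  refine ⟨⟨b, hmem⟩, ?_⟩
  rw [evB_eq_eval]
  have h1 := (P i).eval_add (hsub i) (hr i)
  rw [sub_add_cancel] at h1
  have h2 : (P i).eval (b - Pi.single (M := fun _ => K) i (r : K) i) = 0 := by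
    rw [(P i).eval_of_mem (hsub i), ev_eq_zero_iff]
    by_cases h0 : b - Pi.single (M := fun _ => K) i (r : K) i = 0
    · exact Or.inl h0
    · exact Or.inr (by have := hb i h0; simp only; omega)
  change (P i).eval b = _
  rw [h1, h2, zero_add, Pi.single_eq_same, eval_coe]

/-- A function `c` with a simple zero at `P i` as its only zero in the fibre generates the ideal of
`P i`. -/
theorem ker_evB [Finite ι] [FiniteDimensional F K] (h : IsFibre A P) (i : ι)
    {c : integralClosure A.ring K} (hc0 : c ≠ 0) (hci : (P i).ord (c : K) = 1)
    (hcj : ∀ j ≠ i, (P j).ord (c : K) = 0) : RingHom.ker (h.evB i) = Ideal.span {c} := by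
  ext b
  rw [RingHom.mem_ker, Ideal.mem_span_singleton]
  have h1 : h.evB i b = 0 ↔ (b : K) = 0 ∨ 0 < (P i).ord (b : K) := (P i).ev_eq_zero_iff _
  rw [h1]
  constructor
  · intro hb
    refine h.dvd_of_ord_le hc0 fun hb0 j => ?_
    by_cases hj : j = i
    · subst hj
      rcases hb with hb | hb
      · exact absurd (by simpa using hb) hb0
      · omega
    · rw [hcj j hj]; exact h.ord_nonneg b j
  · rintro ⟨d, rfl⟩
    by_cases hd : (d : K) = 0
    · left; simp [hd]
    · right
      have := h.ord_nonneg d i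
      have hc0' : (c : K) ≠ 0 := by simpa using hc0
      rw [MulMemClass.coe_mul, (P i).ord_mul hc0' hd]
      omega

theorem evB_algebraMap [FiniteDimensional F K] (h : IsFibre A P) (i : ι) (a : A.ring) :
    h.evB i (algebraMap A.ring (integralClosure A.ring K) a) =
      (h.lies_over i).resMap (A.ev a) := by
  rw [evB_eq_eval, Over.resMap_ev]; rfl

/-- The residue fields of the fibre are finite extensions. -/
theorem finite_resMap [Finite ι] [FiniteDimensional F K] (h : IsFibre A P) (i : ι) :
    (h.lies_over i).resMap.Finite := by
  have := h.finite
  have h1 : (algebraMap A.ring (integralClosure A.ring K)).Finite :=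
    RingHom.finite_algebraMap.2 this
  have h2 := (RingHom.Finite.of_surjective _ (h.evB_surjective i)).comp h1
  refine RingHom.Finite.of_comp_finite (f := A.ev) ?_
  convert h2
  ext a
  exact (h.evB_algebraMap i a).symm

/-- The quotient by the ideal of `P i` is the residue field at `P i`. -/
theorem length_quotient_generator [Finite ι] [FiniteDimensional F K] (h : IsFibre A P) (i : ι)
    {c : integralClosure A.ring K} (hc0 : c ≠ 0) (hci : (P i).ord (c : K) = 1)
    (hcj : ∀ j ≠ i, (P j).ord (c : K) = 0) :
    Module.length A.ring (integralClosure A.ring K ⧸ Ideal.span {c}) =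
      (h.lies_over i).inertiaDeg := by
  let _ : Algebra A.ring A.κ := A.ev.toAlgebra
  let _ : Algebra A.κ (P i).κ := (h.lies_over i).resMap.toAlgebra
  let _ : Algebra A.ring (P i).κ := ((h.lies_over i).resMap.comp A.ev).toAlgebra
  have : IsScalarTower A.ring A.κ (P i).κ := .of_algebraMap_eq fun _ => rfl
  have hfin : Module.Finite A.κ (P i).κ := h.finite_resMap i
  let φ : integralClosure A.ring K →ₐ[A.ring] (P i).κ :=
    { h.evB i with commutes' := h.evB_algebraMap i }
  have hφ : Function.Surjective φ := h.evB_surjective i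
  have hker : RingHom.ker φ = Ideal.span {c} := h.ker_evB i hc0 hci hcj
  let e : (integralClosure A.ring K ⧸ Ideal.span {c}) ≃ₐ[A.ring] (P i).κ :=
    (Ideal.quotientEquivAlgOfEq A.ring hker.symm).trans
      (Ideal.quotientKerAlgEquivOfSurjective hφ)
  rw [e.toLinearEquiv.length_eq, Module.length_eq_of_surjective (R := A.κ) A.ev_surjective,
    Module.length_eq_finrank]
  rfl

end Place.IsFibre

/-! ### Orders and values of norms -/

namespace Place

/-- Comparison with the length of `A.ring` modulo `a`. -/
theorem ord_eq_of_ringOrd {k F : Type u} [Field k] [Field F] [Algebra k F] (A : Place k F)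
    {a : A.ring} (ha : a ≠ 0) {n : ℕ} (h : Ring.ord A.ring a = n) : A.ord (a : F) = n := by
  have h1 := Ring.ordFrac_eq_ord (R := A.ring) (K := F) ha
  rw [Ring.ordMonoidWithZeroHom_eq_coe _ (mem_nonZeroDivisors_of_ne_zero ha) h] at h1
  change Ring.ordFrac A.ring (a : F) = _ at h1
  rw [ord, h1]
  rfl

namespace IsFibre

variable {k F K : Type u} {ι : Type*} [Field k] [Field F] [Field K] [Algebra k F] [Algebra k K]
  [Algebra F K] {A : Place k F} {P : ι → Place k K}

theorem isUnit_of_ord_eq_zero [FiniteDimensional F K] (h : IsFibre A P)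
    {b : integralClosure A.ring K} (hb : b ≠ 0) (hb' : ∀ i, (P i).ord (b : K) = 0) : IsUnit b :=
  isUnit_iff_dvd_one.2 (h.dvd_of_ord_le hb fun _ i => by
    rw [hb' i]; exact h.ord_nonneg 1 i)

theorem ord_eq_zero_of_isUnit [FiniteDimensional F K] (h : IsFibre A P)
    {b : integralClosure A.ring K} (hb : IsUnit b) (i : ι) : (P i).ord (b : K) = 0 := by
  obtain ⟨u, rfl⟩ := hb
  have h1 := h.ord_nonneg (u : integralClosure A.ring K) i
  have h2 := h.ord_nonneg (↑(u⁻¹) : integralClosure A.ring K) i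
  have h3 : ((↑(u⁻¹) : integralClosure A.ring K) : K) =
      ((u : integralClosure A.ring K) : K)⁻¹ := by
    refine eq_inv_of_mul_eq_one_left ?_
    rw [← MulMemClass.coe_mul, Units.inv_mul]; rfl
  rw [h3, ord_inv] at h2
  omega

/-- The nonzero elements of the integral closure are products of units and of functions with a
single simple zero in the fibre. -/
theorem induction_on [Finite ι] [FiniteDimensional F K] (h : IsFibre A P)
    {C : integralClosure A.ring K → Prop} (unit : ∀ b, IsUnit b → C b)
    (mul : ∀ i (c b : integralClosure A.ring K), c ≠ 0 → (P i).ord (c : K) = 1 →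
      (∀ j ≠ i, (P j).ord (c : K) = 0) → b ≠ 0 → C b → C (b * c))
    {b : integralClosure A.ring K} (hb : b ≠ 0) : C b := by
  have := Fintype.ofFinite ι
  obtain ⟨n, hn⟩ : ∃ n : ℕ, ∑ i, (P i).ord (b : K) = n :=
    ⟨_, (Int.toNat_of_nonneg (Finset.sum_nonneg fun i _ => h.ord_nonneg b i)).symm⟩
  induction n generalizing b with
  | zero =>
    refine unit b (h.isUnit_of_ord_eq_zero hb fun i => ?_)
    exact (Finset.sum_eq_zero_iff_of_nonneg fun i _ => h.ord_nonneg b i).1 hn i (Finset.mem_univ i)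
  | succ n ih =>
    obtain ⟨i, hi⟩ : ∃ i, 0 < (P i).ord (b : K) := by
      by_contra! hcon
      have := Finset.sum_nonpos fun i (_ : i ∈ Finset.univ) => hcon i
      rw [hn] at this
      omega
    obtain ⟨c, hc0, hci, hcj⟩ := h.exists_generator i
    obtain ⟨d, rfl⟩ := h.dvd_of_ord_le (c := b) hc0 fun _ j => by
      by_cases hj : j = i
      · subst hj; omega
      · rw [hcj j hj]; exact h.ord_nonneg b j
    have hd : d ≠ 0 := right_ne_zero_of_mul hb
    rw [mul_comm]
    refine mul i c d hc0 hci hcj hd (ih hd ?_)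
    have h1 : ∀ j, (P j).ord ((c * d : integralClosure A.ring K) : K) =
        (P j).ord (c : K) + (P j).ord (d : K) := fun j =>
      (P j).ord_mul (by simpa using hc0) (by simpa using hd)
    simp only [h1, Finset.sum_add_distrib] at hn
    rw [Finset.sum_eq_single i (fun j _ hj => hcj j hj) (by simp), hci] at hn
    push_cast at hn
    omega

/-- For a generator `c` of the ideal of `P i`, the order of the norm of `c` is the length of the
residue field at `P i`; the general case follows by multiplicativity. -/
theorem ord_norm_integral [Fintype ι] [FiniteDimensional F K] (h : IsFibre A P)
    {b : integralClosure A.ring K} (hb : b ≠ 0) :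
    A.ord (Algebra.norm F (b : K)) =
      ∑ i, ((h.lies_over i).inertiaDeg : ℤ) * (P i).ord (b : K) := by
  have := h.finite
  have := h.free
  refine h.induction_on (C := fun b => A.ord (Algebra.norm F (b : K)) =
      ∑ i, ((h.lies_over i).inertiaDeg : ℤ) * (P i).ord (b : K)) ?_ ?_ hb
  · intro b hb
    have h1 := h.ord_eq_zero_of_isUnit hb
    simp only [h1, mul_zero, Finset.sum_const_zero]
    rw [h.coe_norm]
    exact ((A.isUnit_iff_ord _).1 (hb.map (Algebra.norm A.ring))).2
  · intro i c b hc0 hci hcj hb ih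
    have hc0' : (c : K) ≠ 0 := by simpa using hc0
    have hb0' : (b : K) ≠ 0 := by simpa using hb
    have h1 : A.ord (Algebra.norm F (c : K)) = (h.lies_over i).inertiaDeg := by
      rw [h.coe_norm]
      refine A.ord_eq_of_ringOrd (Algebra.norm_ne_zero_iff.2 hc0) ?_
      rw [ord_norm_eq_length hc0, h.length_quotient_generator i hc0 hci hcj]
    rw [MulMemClass.coe_mul, map_mul, A.ord_mul (Algebra.norm_ne_zero_iff.2 hb0')
      (Algebra.norm_ne_zero_iff.2 hc0'), ih, h1]
    have h2 : ∀ j, (P j).ord ((b : K) * c) = (P j).ord (b : K) + (P j).ord (c : K) := fun j =>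
      (P j).ord_mul hb0' hc0'
    simp only [h2, mul_add, Finset.sum_add_distrib]
    congr 1
    rw [Finset.sum_eq_single i (fun j _ hj => by rw [hcj j hj, mul_zero]) (by simp), hci, mul_one]

/-- The order of a norm: `φ_* div g = div (N g)`, locally on the base. -/
theorem ord_norm [Fintype ι] [FiniteDimensional F K] (h : IsFibre A P) {g : K} (hg : g ≠ 0) :
    A.ord (Algebra.norm F g) = ∑ i, ((h.lies_over i).inertiaDeg : ℤ) * (P i).ord g := by
  have := integralClosure.isFractionRing_of_finite_extension (A := A.ring) F K
  obtain ⟨b, d, hd, rfl⟩ := IsFractionRing.div_surjective (A := integralClosure A.ring K) g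
  change (b : K) / (d : K) ≠ 0 at hg
  change A.ord (Algebra.norm F ((b : K) / (d : K))) = ∑ i, _ * (P i).ord ((b : K) / (d : K))
  have hb0 : (b : K) ≠ 0 := fun h0 => hg (by rw [h0, zero_div])
  have hd0 : (d : K) ≠ 0 := fun h0 => hg (by rw [h0, div_zero])
  have hdiv : Algebra.norm F ((b : K) / (d : K)) =
      Algebra.norm F (b : K) / Algebra.norm F (d : K) := by
    rw [div_eq_mul_inv, map_mul, Algebra.norm_inv, div_eq_mul_inv]
  rw [hdiv, A.ord_div (Algebra.norm_ne_zero_iff.2 hb0) (Algebra.norm_ne_zero_iff.2 hd0),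
    h.ord_norm_integral (by simpa using hb0), h.ord_norm_integral (by simpa using hd0),
    ← Finset.sum_sub_distrib]
  exact Finset.sum_congr rfl fun i _ => by rw [(P i).ord_div hb0 hd0, mul_sub]

/-- The fundamental identity `∑ eᵢ fᵢ = n`. -/
theorem sum_ramIdx_mul_inertiaDeg [Fintype ι] [FiniteDimensional F K] (h : IsFibre A P) :
    ∑ i, (P i).ramIdx A * (h.lies_over i).inertiaDeg = Module.finrank F K := by
  have h1 := h.ord_norm (g := algebraMap F K A.unif) (by simpa using unif_ne_zero)
  rw [Algebra.norm_algebraMap, ord_pow, ord_unif, mul_one] at h1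
  have h2 : (Module.finrank F K : ℤ) =
      ∑ i, (((P i).ramIdx A * (h.lies_over i).inertiaDeg : ℕ) : ℤ) := by
    rw [h1]
    refine Finset.sum_congr rfl fun i _ => ?_
    rw [(h.lies_over i).ord_algebraMap, ord_unif]
    push_cast; ring
  exact_mod_cast h2.symm

/-- Let `B` be the integral closure and `S = B/ϖB`, where `ϖ` is a uniformizer at `A`. The value
at `A` of the norm of `u` is the norm of `u` on the `A.κ`-algebra `S`. As `ϖ` is a product in `B`
of functions with one simple zero, `S` is filtered with the residue fields of the fibre as
successive quotients, each occurring as often as the ramification index says. -/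
theorem eval_norm_integral [Fintype ι] [FiniteDimensional F K] (h : IsFibre A P)
    (u : integralClosure A.ring K) :
    A.eval (Algebra.norm F (u : K)) =
      ∏ i, (h.lies_over i).resNorm ((P i).eval (u : K)) ^ (P i).ramIdx A := by
  classical
  have := h.finite
  have := h.free
  let B := integralClosure A.ring K
  let _ : Algebra A.ring A.κ := A.ev.toAlgebra
  have hsurj : Function.Surjective (algebraMap A.ring A.κ) := A.ev_surjective
  let S := A.κ ⊗[A.ring] B
  let τ : B →ₐ[A.ring] S := Algebra.TensorProduct.includeRight
  have hτ : Function.Surjective τ := fun x => one_tmul_surjective hsurj x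
  have hS : A.eval (Algebra.norm F (u : K)) = Algebra.norm A.κ (τ u) := by
    rw [h.coe_norm, eval_coe]
    exact (norm_one_tmul u).symm
  -- the uniformizer of `A` as an element of `B`, which vanishes in `S`
  have hu1 : A.unif ∈ A.ring := A.mem_ring_iff.2 (by rw [ord_unif]; norm_num)
  let ϖ : A.ring := ⟨A.unif, hu1⟩
  have hϖker : RingHom.ker (algebraMap A.ring A.κ) ≤ Ideal.span {ϖ} := by
    intro x hx
    rw [Ideal.mem_span_singleton]
    have hx' : A.ev x = 0 := hx
    rw [ev_eq_zero_iff] at hx'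
    rcases hx' with hx' | hx'
    · have : x = 0 := Subtype.ext hx'
      simp [this]
    · by_cases hx0 : (x : F) = 0
      · have : x = 0 := Subtype.ext hx0
        simp [this]
      have : (x : F) / A.unif ∈ A.ring := A.mem_ring_iff.2 (by
        rw [A.ord_div hx0 unif_ne_zero, ord_unif]; omega)
      refine ⟨⟨_, this⟩, Subtype.ext ?_⟩
      have := A.unif_ne_zero
      change (x : F) = A.unif * (x / A.unif)
      field_simp
  let b₀ : B := algebraMap A.ring B ϖ
  have hb₀K : (b₀ : K) = algebraMap F K A.unif := rfl
  have hb₀ : b₀ ≠ 0 := by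
    intro h0
    have : (b₀ : K) = 0 := by rw [h0]; rfl
    rw [hb₀K] at this
    exact unif_ne_zero ((map_eq_zero _).1 this)
  have hτ0 : ∀ b : B, τ b = 0 → b₀ ∣ b := by
    intro b hb
    have h1 := mem_map_ker_of_one_tmul_eq_zero hsurj hb
    have h2 := Ideal.map_mono (f := algebraMap A.ring B) hϖker h1
    rwa [Ideal.map_span, Set.image_singleton, Ideal.mem_span_singleton] at h2
  have hτb₀ : τ b₀ = 0 := by
    have h1 : A.ev ϖ = 0 := (A.ev_eq_zero_iff _).2 (Or.inr (by
      change 0 < A.ord A.unif; rw [ord_unif]; norm_num))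
    change τ (algebraMap A.ring B ϖ) = 0
    rw [τ.commutes]
    change algebraMap A.κ S (A.ev ϖ) = 0
    rw [h1, map_zero]
  -- the norm on `S / (c)` for a function `c` with a single simple zero
  have hgen : ∀ i (c : B), c ≠ 0 → (P i).ord (c : K) = 1 → (∀ j ≠ i, (P j).ord (c : K) = 0) →
      Algebra.norm A.κ (Ideal.Quotient.mk (Ideal.span {τ c}) (τ u)) =
        (h.lies_over i).resNorm ((P i).eval (u : K)) := by
    intro i c hc0 hci hcj
    let _ : Algebra A.κ (P i).κ := (h.lies_over i).resMap.toAlgebra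
    let _ : Algebra A.ring (P i).κ := ((h.lies_over i).resMap.comp A.ev).toAlgebra
    have : IsScalarTower A.ring A.κ (P i).κ := .of_algebraMap_eq fun _ => rfl
    let φ : B →ₐ[A.ring] (P i).κ := { h.evB i with commutes' := h.evB_algebraMap i }
    let ψ : S →ₐ[A.κ] (P i).κ :=
      Algebra.TensorProduct.productLeftAlgHom (Algebra.ofId A.κ (P i).κ) φ
    have hψ : ∀ b, ψ (τ b) = h.evB i b := fun b => by
      refine (Algebra.TensorProduct.lift_tmul _ _ _ (1 : A.κ) b).trans ?_
      rw [map_one, one_mul]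
      rfl
    have hψs : Function.Surjective ψ := fun y => by
      obtain ⟨b, rfl⟩ := h.evB_surjective i y
      exact ⟨τ b, hψ b⟩
    have hker : RingHom.ker ψ = Ideal.span {τ c} := by
      ext x
      obtain ⟨b, rfl⟩ := hτ x
      rw [RingHom.mem_ker, hψ, ← RingHom.mem_ker, h.ker_evB i hc0 hci hcj,
        Ideal.mem_span_singleton]
      constructor
      · intro hcb
        exact Ideal.mem_span_singleton.2 (map_dvd τ hcb)
      · intro hb
        rw [← Ideal.mem_span_singleton, ← h.ker_evB i hc0 hci hcj, RingHom.mem_ker, ← hψ]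
        obtain ⟨y, hy⟩ := Ideal.mem_span_singleton.1 hb
        rw [hy, map_mul, hψ, (RingHom.mem_ker (f := h.evB i)).1, zero_mul]
        rw [h.ker_evB i hc0 hci hcj]
        exact Ideal.mem_span_singleton_self c
    let e : (S ⧸ Ideal.span {τ c}) ≃ₐ[A.κ] (P i).κ :=
      (Ideal.quotientEquivAlgOfEq A.κ hker.symm).trans
        (Ideal.quotientKerAlgEquivOfSurjective hψs)
    rw [← Algebra.norm_eq_of_algEquiv e, ← h.evB_eq_eval i, ← hψ]
    rfl
  -- the norm on `S / (b)` for a divisor `b` of the uniformizer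
  have key : ∀ b : B, b ≠ 0 → b ∣ b₀ →
      Algebra.norm A.κ (Ideal.Quotient.mk (Ideal.span {τ b}) (τ u)) =
        ∏ i, (h.lies_over i).resNorm ((P i).eval (u : K)) ^ ((P i).ord (b : K)).toNat := by
    intro b hb
    refine h.induction_on (C := fun b => b ∣ b₀ →
      Algebra.norm A.κ (Ideal.Quotient.mk (Ideal.span {τ b}) (τ u)) =
        ∏ i, (h.lies_over i).resNorm ((P i).eval (u : K)) ^ ((P i).ord (b : K)).toNat) ?_ ?_ hb
    · intro b hb _
      have h1 : Ideal.span {τ b} = ⊤ := Ideal.span_singleton_eq_top.2 (hb.map τ)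
      have : Subsingleton (S ⧸ Ideal.span {τ b}) := Ideal.Quotient.subsingleton_iff.2 h1
      rw [Algebra.norm_apply, LinearMap.det_eq_one_of_subsingleton]
      symm
      refine Finset.prod_eq_one fun i _ => ?_
      rw [h.ord_eq_zero_of_isUnit hb, Int.toNat_zero, pow_zero]
    · intro i c b hc0 hci hcj hb ih hdvd
      have hc0' : (c : K) ≠ 0 := by simpa using hc0
      have hb0' : (b : K) ≠ 0 := by simpa using hb
      rw [map_mul, norm_quotient_span_mul, hgen i c hc0 hci hcj,
        ih ((dvd_mul_right b c).trans hdvd)]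
      · rw [← Finset.mul_prod_erase _ _ (Finset.mem_univ i),
          ← Finset.mul_prod_erase (Finset.univ) (fun j => _ ^ ((P j).ord _).toNat)
          (Finset.mem_univ i), ← mul_assoc]
        congr 1
        · rw [MulMemClass.coe_mul, (P i).ord_mul hb0' hc0', hci, ← pow_succ']
          congr 1
          have := h.ord_nonneg b i
          omega
        · refine Finset.prod_congr rfl fun j hj => ?_
          rw [MulMemClass.coe_mul, (P j).ord_mul hb0' hc0', hcj j (Finset.ne_of_mem_erase hj),
            add_zero]
      · intro s hs
        obtain ⟨x, rfl⟩ := hτ s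
        obtain ⟨z, hz⟩ := Ideal.mem_span_singleton.1 hs
        obtain ⟨y, rfl⟩ := hτ z
        have h1 : τ (b * x - b * c * y) = 0 := by
          rw [map_sub, map_mul, map_mul, map_mul, hz, sub_self]
        have h2 : b * c ∣ b * x := by
          have := dvd_add (hdvd.trans (hτ0 _ h1)) (dvd_mul_right (b * c) y)
          rwa [sub_add_cancel] at this
        have h3 : c ∣ x := (mul_dvd_mul_iff_left hb).1 h2
        exact Ideal.mem_span_singleton.2 (map_dvd τ h3)
  have hbot : Ideal.span {τ b₀} = (⊥ : Ideal S) := by rw [hτb₀, Ideal.span_singleton_eq_bot]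
  have hfinal := key b₀ hb₀ dvd_rfl
  let e : (S ⧸ Ideal.span {τ b₀}) ≃ₐ[A.κ] S :=
    (Ideal.quotientEquivAlgOfEq A.κ hbot).trans (AlgEquiv.quotientBot A.κ S)
  rw [← Algebra.norm_eq_of_algEquiv e] at hfinal
  rw [hS]
  refine Eq.trans ?_ (hfinal.trans ?_)
  · rfl
  · refine Finset.prod_congr rfl fun i _ => ?_
    rw [hb₀K]
    rfl

/-- The value of a norm: for a function which is a unit along the fibre, the value of its norm is
the product of the norms of its values, with the ramification indices as exponents. -/
theorem eval_norm [Fintype ι] [FiniteDimensional F K] (h : IsFibre A P) {u : K}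
    (hu : ∀ i, (P i).ord u = 0) :
    A.eval (Algebra.norm F u) =
      ∏ i, (h.lies_over i).resNorm ((P i).eval u) ^ (P i).ramIdx A :=
  h.eval_norm_integral ⟨u, h.mem_integralClosure.2 fun i => (P i).mem_of_ord_eq_zero (hu i)⟩

end IsFibre

end Place

/-! ### Places of a rational function field -/

namespace Place

section Rational

variable {k F : Type u} [Field k] [Field F] [Algebra k F] {t : F}

variable (t) in
/-- `A` is the place of `k(t)` at the zeros of the monic irreducible polynomial `p`. -/
structure IsZeroOf (A : Place k F) (p : k[X]) : Prop where
  mem : t ∈ A.ring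
  ord_aeval : A.ord (Polynomial.aeval t p) = 1
  eval_eq_zero_iff : ∀ q : k[X], A.eval (Polynomial.aeval t q) = 0 ↔ p ∣ q
  finrank_eq : Module.finrank k A.κ = p.natDegree
  norm_eval : Algebra.norm k (A.eval t) = (-1) ^ p.natDegree * p.coeff 0

/-- Every monic irreducible polynomial defines a place of `k(t)`. -/
theorem exists_isZeroOf (ht : Transcendental k t) (htop : IntermediateField.adjoin k {t} = ⊤)
    {p : k[X]} (hp : Irreducible p) (hpm : p.Monic) : ∃ A : Place k F, A.IsZeroOf t p := by
  have hfact : Fact (Irreducible p) := ⟨hp⟩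
  let _ : Algebra k[X] F := (Polynomial.aeval t).toRingHom.toAlgebra
  have halg : ∀ q : k[X], algebraMap k[X] F q = Polynomial.aeval t q := fun _ => rfl
  have hinj : Function.Injective (algebraMap k[X] F) := transcendental_iff_injective.1 ht
  have : FaithfulSMul k[X] F := (faithfulSMul_iff_algebraMap_injective _ _).2 hinj
  have hfrac : IsFractionRing k[X] F := IsFractionRing.of_field _ _ fun x => by
    obtain ⟨a, b, hab⟩ := (IntermediateField.mem_adjoin_simple_iff k _).1
      (htop ▸ IntermediateField.mem_top : x ∈ IntermediateField.adjoin k {t})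
    exact ⟨a, b, hab⟩
  have hpp : (Ideal.span {p}).IsPrime := (Ideal.span_singleton_prime hp.ne_zero).2 hp.prime
  let R := Localization.AtPrime (Ideal.span {p})
  have hp0 : Ideal.span {p} ≠ ⊥ := by simpa using hp.ne_zero
  have hdvr : IsDiscreteValuationRing R :=
    IsLocalization.AtPrime.isDiscreteValuationRing_of_dedekind_domain _ hp0 R
  have hunit : ∀ y : (Ideal.span {p}).primeCompl, IsUnit (algebraMap k[X] F y) := fun y => by
    rw [isUnit_iff_ne_zero, Ne, map_eq_zero_iff _ hinj]
    intro h0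
    exact y.2 (h0 ▸ zero_mem _)
  let _ : Algebra R F := (IsLocalization.lift (S := R) hunit).toAlgebra
  have htow : IsScalarTower k[X] R F := .of_algebraMap_eq fun q =>
    (IsLocalization.lift_eq hunit q).symm
  have hfracR : IsFractionRing R F :=
    .isFractionRing_of_isDomain_of_isLocalization (Ideal.span {p}).primeCompl R F
  have hunit' : ∀ y : (Ideal.span {p}).primeCompl, IsUnit (AdjoinRoot.mk p y) := fun y => by
    rw [isUnit_iff_ne_zero, Ne, AdjoinRoot.mk_eq_zero, ← Ideal.mem_span_singleton]
    exact y.2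
  let ev : R →+* AdjoinRoot p := IsLocalization.lift (S := R) hunit'
  have hev : ∀ q : k[X], ev (algebraMap k[X] R q) = AdjoinRoot.mk p q := fun q =>
    IsLocalization.lift_eq hunit' q
  have hevs : Function.Surjective ev := fun y => by
    obtain ⟨q, rfl⟩ := AdjoinRoot.mk_surjective y
    exact ⟨_, hev q⟩
  have hk : ∀ c : k, ∃ r : R, algebraMap R F r = algebraMap k F c ∧
      ev r = algebraMap k (AdjoinRoot p) c := fun c =>
    ⟨algebraMap k[X] R (Polynomial.C c), by
      rw [← IsScalarTower.algebraMap_apply, halg, Polynomial.aeval_C], by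
      rw [hev]; rfl⟩
  let A : Place k F := ofDVR R (AdjoinRoot p) ev hevs hk
  have hA : ∀ q : k[X], Polynomial.aeval t q = algebraMap R F (algebraMap k[X] R q) := fun q => by
    rw [← IsScalarTower.algebraMap_apply, halg]
  have hAev : ∀ q : k[X], A.eval (Polynomial.aeval t q) = AdjoinRoot.mk p q := fun q => by
    rw [hA, ← hev]; exact ofDVR_eval R _
  have hroot : A.eval t = AdjoinRoot.root p := by
    have := hAev Polynomial.X
    rwa [Polynomial.aeval_X] at this
  refine ⟨A, ⟨algebraMap k[X] R Polynomial.X, by rw [← hA, Polynomial.aeval_X]⟩, ?_, fun q => ?_,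
    ?_, ?_⟩
  · have hirr : Irreducible (algebraMap k[X] R p) := by
      rw [IsDiscreteValuationRing.irreducible_iff_uniformizer,
        ← IsLocalization.AtPrime.map_eq_maximalIdeal (Ideal.span {p}) R, Ideal.map_span,
        Set.image_singleton]
    rw [ofDVR_ord, hA, Ring.ordFrac_irreducible hirr, WithZero.log_exp]
  · rw [hAev, AdjoinRoot.mk_eq_zero]
  · exact (AdjoinRoot.powerBasis hp.ne_zero).finrank
  · rw [hroot, ← AdjoinRoot.powerBasis_gen hp.ne_zero,
      Algebra.PowerBasis.norm_gen_eq_coeff_zero_minpoly,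
      AdjoinRoot.minpoly_powerBasis_gen_of_monic hpm]
    rfl

theorem aeval_mem {A : Place k F} (h : t ∈ A.ring) (q : k[X]) : Polynomial.aeval t q ∈ A.ring := by
  induction q using Polynomial.induction_on' with
  | add p q hp hq => rw [map_add]; exact add_mem hp hq
  | monomial n a =>
    rw [Polynomial.aeval_monomial]
    exact mul_mem (A.algebraMap_mem a) (pow_mem h n)

theorem eval_aeval {A : Place k F} (h : t ∈ A.ring) (q : k[X]) :
    A.eval (Polynomial.aeval t q) = Polynomial.aeval (A.eval t) q := by
  induction q using Polynomial.induction_on' with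
  | add p q hp hq => rw [map_add, map_add, A.eval_add (aeval_mem h p) (aeval_mem h q), hp, hq]
  | monomial n a =>
    have hpow : ∀ n : ℕ, A.eval (t ^ n) = A.eval t ^ n := by
      intro n
      induction n with
      | zero => simp
      | succ n ih => rw [pow_succ, A.eval_mul (pow_mem h n) h, ih, pow_succ]
    rw [Polynomial.aeval_monomial, Polynomial.aeval_monomial,
      A.eval_mul (A.algebraMap_mem a) (pow_mem h n), eval_algebraMap, hpow]

theorem IsZeroOf.ord_eq_zero {A : Place k F} {p q : k[X]} (h : A.IsZeroOf t p) (hq : ¬ p ∣ q) :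
    A.ord (Polynomial.aeval t q) = 0 := by
  have h1 := A.ord_nonneg_of_mem (aeval_mem h.mem q)
  have h2 := mt (h.eval_eq_zero_iff q).1 hq
  rw [A.eval_of_mem (aeval_mem h.mem q), ev_eq_zero_iff] at h2
  simp only [not_or, not_lt] at h2
  omega

theorem IsZeroOf.ord_pos {A : Place k F} {p q : k[X]} (ht : Transcendental k t)
    (h : A.IsZeroOf t p) (hq0 : q ≠ 0) (hq : p ∣ q) : 0 < A.ord (Polynomial.aeval t q) := by
  have h2 := (h.eval_eq_zero_iff q).2 hq
  rw [A.eval_of_mem (aeval_mem h.mem q), ev_eq_zero_iff] at h2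
  exact h2.resolve_left fun h0 => hq0 ((transcendental_iff.1 ht) q h0)

theorem exists_monic_irreducible_dvd {q : k[X]} (hq : ¬ IsUnit q) (hq0 : q ≠ 0) :
    ∃ p : k[X], Irreducible p ∧ p.Monic ∧ p ∣ q := by
  classical
  obtain ⟨p, hp, hpq⟩ := WfDvdMonoid.exists_irreducible_factor hq hq0
  exact ⟨normalize p, (associated_normalize p).irreducible hp,
    Polynomial.monic_normalize hp.ne_zero, (associated_normalize p).symm.dvd.trans hpq⟩

theorem exists_isCoprime_factor (a : k[X]) {b : k[X]} (hb : b ≠ 0) :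
    ∃ d a' b' : k[X], a = d * a' ∧ b = d * b' ∧ IsCoprime a' b' := by
  obtain ⟨d, hd⟩ := (IsPrincipalIdealRing.principal (Ideal.span {a, b})).principal
  rw [Ideal.submodule_span_eq] at hd
  have ha1 : a ∈ Ideal.span {d} := hd ▸ Ideal.subset_span (by simp)
  have hb1 : b ∈ Ideal.span {d} := hd ▸ Ideal.subset_span (by simp)
  obtain ⟨a', ha'⟩ := Ideal.mem_span_singleton.1 ha1
  obtain ⟨b', hb'⟩ := Ideal.mem_span_singleton.1 hb1
  have hd1 : d ∈ Ideal.span {a, b} := hd ▸ Ideal.mem_span_singleton_self d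
  obtain ⟨u, v, huv⟩ := Ideal.mem_span_pair.1 hd1
  have hd0 : d ≠ 0 := by rintro rfl; exact hb (by rw [hb', zero_mul])
  refine ⟨d, a', b', ha', hb', u, v, mul_left_cancel₀ hd0 ?_⟩
  calc d * (u * a' + v * b') = u * (d * a') + v * (d * b') := by ring
    _ = d * 1 := by rw [← ha', ← hb', huv, mul_one]

/-- The factorization of a rational function, in terms of its orders. -/
theorem exists_eq_prod_zpow (ht : Transcendental k t)
    (htop : IntermediateField.adjoin k {t} = ⊤) (A : k[X] → Place k F)
    (hA : ∀ p : k[X], Irreducible p → p.Monic → (A p).IsZeroOf t p) {G : F} (hG : G ≠ 0)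
    (T : Finset k[X]) (hT : ∀ p ∈ T, Irreducible p ∧ p.Monic)
    (hGT : ∀ p, Irreducible p → p.Monic → p ∉ T → (A p).ord G = 0) :
    ∃ c : k, c ≠ 0 ∧ G = algebraMap k F c * ∏ p ∈ T, Polynomial.aeval t p ^ (A p).ord G := by
  classical
  have haev : ∀ q : k[X], q ≠ 0 → Polynomial.aeval t q ≠ 0 := fun q hq h0 =>
    hq ((transcendental_iff.1 ht) q h0)
  set H := ∏ p ∈ T, Polynomial.aeval t p ^ (A p).ord G with hH
  have hterm : ∀ p ∈ T, Polynomial.aeval t p ^ (A p).ord G ≠ 0 := fun p hp =>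
    zpow_ne_zero _ (haev p (hT p hp).1.ne_zero)
  have hH0 : H ≠ 0 := Finset.prod_ne_zero_iff.2 hterm
  -- the quotient has neither zeros nor poles
  have hord : ∀ q, Irreducible q → q.Monic → (A q).ord (G / H) = 0 := by
    intro q hq hqm
    rw [(A q).ord_div hG hH0, hH, (A q).ord_prod _ _ hterm]
    have h1 : ∀ p ∈ T, (A q).ord (Polynomial.aeval t p ^ (A p).ord G) =
        if p = q then (A q).ord G else 0 := by
      intro p hp
      rw [ord_zpow]
      split_ifs with hpq
      · subst hpq; rw [(hA p hq hqm).ord_aeval, mul_one]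
      · rw [(hA q hq hqm).ord_eq_zero, mul_zero]
        intro hdvd
        exact hpq (Polynomial.eq_of_monic_of_associated (hT p hp).2 hqm
          (hq.associated_of_dvd (hT p hp).1 hdvd).symm)
    rw [Finset.sum_congr rfl h1, Finset.sum_ite_eq']
    split_ifs with hqT
    · ring
    · rw [hGT q hq hqm hqT]; ring
  obtain ⟨a, b, hb, hcop, hab⟩ : ∃ a b : k[X], b ≠ 0 ∧ IsCoprime a b ∧
      G / H = Polynomial.aeval t a / Polynomial.aeval t b := by
    obtain ⟨a, b, hab⟩ := (IntermediateField.mem_adjoin_simple_iff k _).1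
      (htop ▸ IntermediateField.mem_top : G / H ∈ IntermediateField.adjoin k {t})
    have hb : b ≠ 0 := by
      rintro rfl
      rw [map_zero, div_zero] at hab
      exact (div_ne_zero hG hH0) hab
    obtain ⟨d, a', b', rfl, rfl, hcop⟩ := exists_isCoprime_factor a hb
    have hd := haev d (left_ne_zero_of_mul hb)
    refine ⟨a', b', right_ne_zero_of_mul hb, hcop, ?_⟩
    rw [hab, map_mul, map_mul, mul_div_mul_left _ _ hd]
  have ha : a ≠ 0 := by
    rintro rfl
    rw [map_zero, zero_div] at hab
    exact (div_ne_zero hG hH0) hab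
  have hua : IsUnit a := by
    by_contra hna
    obtain ⟨p, hp, hpm, hpa⟩ := exists_monic_irreducible_dvd hna ha
    have hpb : ¬ p ∣ b := fun hpb => hp.not_isUnit (hcop.isUnit_of_dvd' hpa hpb)
    have h1 := hord p hp hpm
    rw [hab, (A p).ord_div (haev a ha) (haev b hb), (hA p hp hpm).ord_eq_zero hpb] at h1
    have := (hA p hp hpm).ord_pos ht ha hpa
    omega
  have hub : IsUnit b := by
    by_contra hnb
    obtain ⟨p, hp, hpm, hpb⟩ := exists_monic_irreducible_dvd hnb hb
    have hpa : ¬ p ∣ a := fun hpa => hp.not_isUnit (hcop.isUnit_of_dvd' hpa hpb)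
    have h1 := hord p hp hpm
    rw [hab, (A p).ord_div (haev a ha) (haev b hb), (hA p hp hpm).ord_eq_zero hpa] at h1
    have := (hA p hp hpm).ord_pos ht hb hpb
    omega
  obtain ⟨α, hα, rfl⟩ := Polynomial.isUnit_iff.1 hua
  obtain ⟨β, hβ, rfl⟩ := Polynomial.isUnit_iff.1 hub
  refine ⟨α / β, div_ne_zero hα.ne_zero hβ.ne_zero, ?_⟩
  rw [Polynomial.aeval_C, Polynomial.aeval_C] at hab
  rw [map_div₀, ← hab, div_mul_cancel₀ _ hH0]

end Rational

end Place

/-! ### Weil reciprocity -/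

namespace Place

/-- The integral closure of a place in a finite separable extension is a finite module. -/
theorem finite_integralClosure_of_isSeparable {k F K : Type u} [Field k] [Field F] [Field K]
    [Algebra k F] [Algebra F K] (A : Place k F) [FiniteDimensional F K] [Algebra.IsSeparable F K] :
    Module.Finite A.ring (integralClosure A.ring K) :=
  IsIntegralClosure.finite A.ring F K (integralClosure A.ring K)

/-- The places `P i` are, without repetition, all the nontrivial valuations of `K` over `k`; the
residue fields are finite over `k`, and a nonzero function has only finitely many zeros and
poles. -/
structure IsComplete {k K : Type u} {ι : Type*} [Field k] [Field K] [Algebra k K]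
    (P : ι → Place k K) : Prop where
  inj : Function.Injective fun i => (P i).ring
  complete : ∀ V : ValuationSubring K, (∀ c : k, algebraMap k K c ∈ V) → V ≠ ⊤ →
    ∃ i, (P i).ring = V
  finite_residue : ∀ i, FiniteDimensional k (P i).κ
  finite_support : ∀ f : K, {i | (P i).ord f ≠ 0}.Finite

namespace IsComplete

variable {k F K : Type u} {ι : Type*} [Field k] [Field F] [Field K] [Algebra k F] [Algebra k K]
  [Algebra F K] {P : ι → Place k K}

theorem finite_over (hP : IsComplete P) (A : Place k F) : Finite {i // (P i).Over A} := by
  refine Set.Finite.to_subtype ((hP.finite_support (algebraMap F K A.unif)).subset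
    fun i (hi : (P i).Over A) => ?_)
  have := hi.ramIdx_pos
  simp only [Set.mem_ofPred_eq, hi.ord_algebraMap, ord_unif, mul_one, ne_eq]
  exact_mod_cast this.ne'

open Classical in
theorem prod_over_eq (A : Place k F) {M : Type*} [CommMonoid M]
    [Fintype {i // (P i).Over A}]
    (S : Finset ι) (f : ι → M) (hf : ∀ i, (P i).Over A → i ∉ S → f i = 1) :
    ∏ i ∈ S with (P i).Over A, f i = ∏ i : {i // (P i).Over A}, f i := by
  refine Eq.trans ?_
    (Finset.prod_map Finset.univ (Function.Embedding.subtype fun i => (P i).Over A) f)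
  refine Finset.prod_subset (fun i hi => ?_) fun i hi hiS => ?_
  · exact Finset.mem_map.2 ⟨⟨i, (Finset.mem_filter.1 hi).2⟩, Finset.mem_univ _, rfl⟩
  · obtain ⟨⟨j, hj⟩, -, rfl⟩ := Finset.mem_map.1 hi
    exact hf j hj fun hjS => hiS (Finset.mem_filter.2 ⟨hjS, hj⟩)

variable [IsScalarTower k F K]

/-- The places over a given place form a fibre. -/
theorem isFibre (hP : IsComplete P) (A : Place k F)
    (hfin : Module.Finite A.ring (integralClosure A.ring K)) :
    IsFibre A (fun i : {i // (P i).Over A} => P i) where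
  lies_over i := i.2
  inj _ _ h := Subtype.ext (hP.inj h)
  complete V hV := by
    obtain ⟨i, hi⟩ := hP.complete V (fun c => by
      rw [IsScalarTower.algebraMap_apply k F K, ← ValuationSubring.mem_comap, hV]
      exact A.algebraMap_mem c) (by
      rintro rfl
      exact A.ring_ne_top (hV ▸ rfl))
    exact ⟨⟨i, by rw [Over, hi, hV]⟩, hi⟩
  finite := hfin

variable [FiniteDimensional F K]

open Classical in
/-- The contribution of the zeros of `v`, where `v` is a uniformizer at a rational place `A`. -/
theorem prod_norm_eval_zpow (hP : IsComplete P) (A : Place k F)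
    (hfin : Module.Finite A.ring (integralClosure A.ring K)) (hA : Module.finrank k A.κ = 1)
    {v : F} (hv : A.ord v = 1) {g : K} (hg : ∀ i, (P i).Over A → (P i).ord g = 0) (S : Finset ι)
    (hS : ∀ i, (P i).Over A → i ∈ S) {c : k}
    (hc : A.eval (Algebra.norm F g) = algebraMap k A.κ c) :
    ∏ i ∈ S with (P i).Over A,
      Algebra.norm k ((P i).eval g) ^ (P i).ord (algebraMap F K v) = c := by
  have hfib := hP.isFibre A hfin
  have := hP.finite_over A
  have := Fintype.ofFinite {i // (P i).Over A}
  rw [prod_over_eq A S _ fun i hi hiS => absurd (hS i hi) hiS]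
  have h1 := congrArg (Algebra.norm k) (hfib.eval_norm (u := g) fun i => hg i i.2)
  rw [hc, Algebra.norm_algebraMap, hA, pow_one, map_prod] at h1
  rw [h1]
  refine Finset.prod_congr rfl fun i _ => ?_
  have := hP.finite_residue i
  rw [map_pow, (hfib.lies_over i).norm_resNorm, i.2.ord_algebraMap, hv, mul_one, zpow_natCast]

open Classical in
/-- The contribution of the zeros and poles of `g` over a place `A` at which `t` is a unit. -/
theorem prod_norm_eval_algebraMap_zpow (hP : IsComplete P) (A : Place k F)
    (hfin : Module.Finite A.ring (integralClosure A.ring K))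
    {t : F} (ht : t ∈ A.ring) {g : K} (hg : g ≠ 0) (S : Finset ι)
    (hS : ∀ i, (P i).ord g ≠ 0 → i ∈ S) (ht0 : Algebra.norm k (A.eval t) ≠ 0) :
    ∏ i ∈ S with (P i).Over A,
      Algebra.norm k ((P i).eval (algebraMap F K t)) ^ (P i).ord g =
        Algebra.norm k (A.eval t) ^ A.ord (Algebra.norm F g) := by
  have hfib := hP.isFibre A hfin
  have := hP.finite_over A
  have := Fintype.ofFinite {i // (P i).Over A}
  rw [prod_over_eq A S _ fun i hi hiS => by
    rw [not_imp_comm.1 (hS i) hiS, zpow_zero], hfib.ord_norm hg]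
  rw [← Finset.prod_zpow_eq_zpow_sum₀ ht0]
  refine Finset.prod_congr rfl fun i _ => ?_
  have := hP.finite_residue i
  rw [← i.2.resMap_eval ht, i.2.norm_algebraMap_resMap, zpow_mul, zpow_natCast]

open Classical in
/-- The degree of the fibre over a rational place with uniformizer `v`. -/
theorem sum_ord_mul_finrank (hP : IsComplete P) (A : Place k F)
    (hfin : Module.Finite A.ring (integralClosure A.ring K)) (hA : Module.finrank k A.κ = 1)
    {v : F} (hv : A.ord v = 1) (S : Finset ι) (hS : ∀ i, (P i).Over A → i ∈ S) :
    ∑ i ∈ S with (P i).Over A, (P i).ord (algebraMap F K v) * Module.finrank k (P i).κ =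
      Module.finrank F K := by
  have hfib := hP.isFibre A hfin
  have := hP.finite_over A
  have := Fintype.ofFinite {i // (P i).Over A}
  have h1 := prod_over_eq A (M := Multiplicative ℤ) S (fun i => Multiplicative.ofAdd
    ((P i).ord (algebraMap F K v) * Module.finrank k (P i).κ))
    fun i hi hiS => absurd (hS i hi) hiS
  rw [← ofAdd_sum, ← ofAdd_sum] at h1
  rw [Multiplicative.ofAdd.injective h1, ← hfib.sum_ramIdx_mul_inertiaDeg]
  push_cast
  refine Finset.sum_congr rfl fun i _ => ?_
  rw [i.2.ord_algebraMap, hv, mul_one, ← i.2.finrank_mul_inertiaDeg, hA, one_mul]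

/-- A place of `K` lies over the place of `k(t)` at the zeros of `p` as soon as `p(t)` vanishes
there. -/
theorem _root_.Place.IsZeroOf.over {k F K : Type u} [Field k] [Field F] [Field K] [Algebra k F]
    [Algebra k K] [Algebra F K] [IsScalarTower k F K] {P : Place k K} {t : F} {A : Place k F}
    {p : k[X]} (ht : Transcendental k t) (htop : IntermediateField.adjoin k {t} = ⊤)
    (hp : Irreducible p) (hA : A.IsZeroOf t p) (hmem : algebraMap F K t ∈ P.ring)
    (h0 : P.eval (Polynomial.aeval (algebraMap F K t) p) = 0) : P.Over A := by
  have haev : ∀ q : k[X], q ≠ 0 → Polynomial.aeval t q ≠ 0 := fun q hq h0 =>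
    hq ((transcendental_iff.1 ht) q h0)
  have hmap : ∀ q : k[X], algebraMap F K (Polynomial.aeval t q) =
      Polynomial.aeval (algebraMap F K t) q := fun q =>
    (Polynomial.aeval_algebraMap_apply K t q).symm
  -- a polynomial prime to `p` is a unit at `P`
  have hunit : ∀ q : k[X], ¬ p ∣ q → P.ord (Polynomial.aeval (algebraMap F K t) q) = 0 := by
    intro q hq
    obtain ⟨u, v, huv⟩ := (hp.coprime_iff_not_dvd).2 hq
    have h1 := congrArg (fun r => P.eval (Polynomial.aeval (algebraMap F K t) r)) huv
    simp only [map_add, map_mul, map_one, eval_one] at h1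
    have hm := fun q => aeval_mem (A := P) hmem q
    rw [P.eval_add (mul_mem (hm _) (hm _)) (mul_mem (hm _) (hm _)), P.eval_mul (hm _) (hm _),
      P.eval_mul (hm _) (hm _), h0, mul_zero, zero_add] at h1
    have h2 : P.eval (Polynomial.aeval (algebraMap F K t) q) ≠ 0 := right_ne_zero_of_mul_eq_one h1
    rw [P.eval_of_mem (hm q), Ne, ev_eq_zero_iff, not_or] at h2
    have := P.ord_nonneg_of_mem (hm q)
    have := h2.2
    simp only at this
    omega
  refine (A.eq_of_ring_le (V := P.ring.comap (algebraMap F K)) (fun x hx => ?_) fun htop => ?_).symm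
  · rw [ValuationSubring.mem_comap]
    by_cases hx0 : x = 0
    · simp [hx0]
    obtain ⟨a, b, hab⟩ := (IntermediateField.mem_adjoin_simple_iff k _).1
      (htop ▸ IntermediateField.mem_top : x ∈ IntermediateField.adjoin k {t})
    have hb : b ≠ 0 := by
      rintro rfl
      rw [map_zero, div_zero] at hab
      exact hx0 hab
    obtain ⟨d, a', b', rfl, rfl, hcop⟩ := exists_isCoprime_factor a hb
    have hd := haev d (left_ne_zero_of_mul hb)
    have hb' := right_ne_zero_of_mul hb
    rw [map_mul, map_mul, mul_div_mul_left _ _ hd] at hab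
    have ha' : a' ≠ 0 := by
      rintro rfl
      rw [map_zero, zero_div] at hab
      exact hx0 hab
    have hpb : ¬ p ∣ b' := by
      intro hpb
      have hpa : ¬ p ∣ a' := fun hpa => hp.not_isUnit (hcop.isUnit_of_dvd' hpa hpb)
      have h1 := A.ord_nonneg_of_mem hx
      rw [hab, A.ord_div (haev _ ha') (haev _ hb'), hA.ord_eq_zero hpa] at h1
      have := hA.ord_pos ht hb' hpb
      omega
    have hne : ∀ q : k[X], q ≠ 0 → Polynomial.aeval (algebraMap F K t) q ≠ 0 := fun q hq => by
      rw [← hmap, Ne, map_eq_zero]; exact haev q hq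
    rw [hab, map_div₀, hmap, hmap, P.mem_ring_iff, P.ord_div (hne _ ha') (hne _ hb'),
      hunit b' hpb, sub_zero]
    exact P.ord_nonneg_of_mem (aeval_mem hmem _)
  · have h1 : (Polynomial.aeval t p)⁻¹ ∈ P.ring.comap (algebraMap F K) :=
      htop ▸ ValuationSubring.mem_top _
    rw [ValuationSubring.mem_comap, map_inv₀, hmap, P.mem_ring_iff, P.ord_inv] at h1
    rw [P.eval_of_mem (aeval_mem hmem _), ev_eq_zero_iff] at h0
    rcases h0 with h0 | h0
    · exact haev p hp.ne_zero ((map_eq_zero (algebraMap F K)).1 ((hmap p).trans h0))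
    · simp only at h0
      omega

theorem _root_.Place.IsZeroOf.eval_aeval_eq {A : Place k F} {t : F} (hA : A.IsZeroOf t Polynomial.X)
    (q : k[X]) : A.eval (Polynomial.aeval t q) = algebraMap k A.κ (q.coeff 0) := by
  have h0 : A.eval t = 0 := by
    have := (hA.eval_eq_zero_iff Polynomial.X).2 dvd_rfl
    rwa [Polynomial.aeval_X] at this
  rw [eval_aeval hA.mem, h0, Polynomial.coeff_zero_eq_aeval_zero']

/-- The values at `t = 0` and at `t = ∞` of a product of powers of monic polynomials in `t` that is
a unit at both places. -/
theorem _root_.Place.eval_prod_zpow {A₀ A₁ : Place k F} {t : F} (ht : Transcendental k t)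
    (h₀ : A₀.IsZeroOf t Polynomial.X) (h₁ : A₁.IsZeroOf t⁻¹ Polynomial.X) (T : Finset k[X])
    (hT : ∀ p ∈ T, p.Monic ∧ p.coeff 0 ≠ 0) (n : k[X] → ℤ) (c : k) (hc : c ≠ 0)
    (h : A₁.ord (algebraMap k F c * ∏ p ∈ T, Polynomial.aeval t p ^ n p) = 0) :
    ∑ p ∈ T, n p * p.natDegree = 0 ∧
    A₀.eval (algebraMap k F c * ∏ p ∈ T, Polynomial.aeval t p ^ n p) =
      algebraMap k A₀.κ (c * ∏ p ∈ T, p.coeff 0 ^ n p) ∧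
    A₁.eval (algebraMap k F c * ∏ p ∈ T, Polynomial.aeval t p ^ n p) = algebraMap k A₁.κ c := by
  have ht0 : t ≠ 0 := by
    rintro rfl
    exact ht isAlgebraic_zero
  have hts : A₁.ord t = -1 := by
    have := h₁.ord_aeval
    rw [Polynomial.aeval_X, ord_inv] at this
    omega
  have hpoly : ∀ p : k[X], p ≠ 0 → Polynomial.aeval t p ≠ 0 := fun q hq h0 =>
    hq ((transcendental_iff.1 ht) q h0)
  have hrev : ∀ p : k[X], Polynomial.aeval t p =
      Polynomial.aeval t⁻¹ p.reverse * t ^ p.natDegree := fun p => by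
    let _ := invertibleOfNonzero ht0
    have := Polynomial.eval₂_reverse_mul_pow (algebraMap k F) t p
    rw [invOf_eq_inv] at this
    exact this.symm
  have hrev1 : ∀ p ∈ T, Polynomial.aeval t⁻¹ p.reverse ≠ 0 ∧
      A₁.ord (Polynomial.aeval t⁻¹ p.reverse) = 0 ∧
      A₁.eval (Polynomial.aeval t⁻¹ p.reverse) = 1 := fun p hp => by
    have h1 : A₁.eval (Polynomial.aeval t⁻¹ p.reverse) = 1 := by
      rw [h₁.eval_aeval_eq, Polynomial.coeff_zero_reverse, (hT p hp).1.leadingCoeff, map_one]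
    refine ⟨fun h0 => ?_, h₁.ord_eq_zero fun hdvd => ?_, h1⟩
    · exact hpoly p (hT p hp).1.ne_zero (by rw [hrev, h0, zero_mul])
    · rw [(h₁.eval_eq_zero_iff _).2 hdvd] at h1
      exact zero_ne_one h1
  have hc' : algebraMap k F c ≠ 0 := (map_ne_zero _).2 hc
  have hprod : ∏ p ∈ T, Polynomial.aeval t p ^ n p =
      (∏ p ∈ T, Polynomial.aeval t⁻¹ p.reverse ^ n p) * t ^ ∑ p ∈ T, n p * p.natDegree := by
    rw [← Finset.prod_zpow_eq_zpow_sum₀ ht0, ← Finset.prod_mul_distrib]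
    refine Finset.prod_congr rfl fun p _ => ?_
    rw [hrev, mul_zpow, mul_comm (n p), zpow_mul, zpow_natCast]
  have hne : ∏ p ∈ T, Polynomial.aeval t⁻¹ p.reverse ^ n p ≠ 0 :=
    Finset.prod_ne_zero_iff.2 fun p hp => zpow_ne_zero _ (hrev1 p hp).1
  have hord : A₁.ord (∏ p ∈ T, Polynomial.aeval t⁻¹ p.reverse ^ n p) = 0 := by
    rw [ord_prod _ _ _ fun p hp => zpow_ne_zero _ (hrev1 p hp).1]
    exact Finset.sum_eq_zero fun p hp => by rw [ord_zpow, (hrev1 p hp).2.1, mul_zero]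
  have hsum : ∑ p ∈ T, n p * p.natDegree = 0 := by
    rw [hprod, A₁.ord_mul hc' (mul_ne_zero hne (zpow_ne_zero _ ht0)), A₁.ord_mul hne
      (zpow_ne_zero _ ht0), hord, ord_zpow, hts, ord_algebraMap] at h
    omega
  refine ⟨hsum, ?_, ?_⟩
  · have hord0 : ∀ p ∈ T, A₀.ord (Polynomial.aeval t p) = 0 := fun p hp =>
      h₀.ord_eq_zero fun hdvd => by
        have := (h₀.eval_eq_zero_iff _).2 hdvd
        rw [h₀.eval_aeval_eq, map_eq_zero] at this
        exact (hT p hp).2 this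
    have hmem : ∀ p ∈ T, Polynomial.aeval t p ^ n p ∈ A₀.ring := fun p hp =>
      A₀.mem_of_ord_eq_zero (by rw [ord_zpow, hord0 p hp, mul_zero])
    rw [A₀.eval_mul (A₀.algebraMap_mem c) (prod_mem hmem), eval_prod _ _ _ hmem, eval_algebraMap,
      map_mul, map_prod]
    congr 1
    refine Finset.prod_congr rfl fun p hp => ?_
    rw [A₀.eval_zpow (hpoly p (hT p hp).1.ne_zero) (hord0 p hp), h₀.eval_aeval_eq, map_zpow₀]
  · have hmem : ∀ p ∈ T, Polynomial.aeval t⁻¹ p.reverse ^ n p ∈ A₁.ring := fun p hp =>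
      A₁.mem_of_ord_eq_zero (by rw [ord_zpow, (hrev1 p hp).2.1, mul_zero])
    rw [hprod, hsum, zpow_zero, mul_one, A₁.eval_mul (A₁.algebraMap_mem c) (prod_mem hmem),
      eval_prod _ _ _ hmem, eval_algebraMap, Finset.prod_eq_one fun p hp => ?_, mul_one]
    rw [A₁.eval_zpow (hrev1 p hp).1 (hrev1 p hp).2.1, (hrev1 p hp).2.2, one_zpow]

theorem _root_.Transcendental.inv {k F : Type u} [Field k] [Field F] [Algebra k F] {t : F}
    (ht : Transcendental k t) : Transcendental k t⁻¹ := fun h => ht (by simpa using h.inv)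

theorem _root_.IntermediateField.adjoin_inv_eq_top {k F : Type u} [Field k] [Field F] [Algebra k F]
    {t : F} (htop : IntermediateField.adjoin k {t} = ⊤) :
    IntermediateField.adjoin k {t⁻¹} = ⊤ := by
  rw [eq_top_iff, ← htop, IntermediateField.adjoin_le_iff, Set.singleton_subset_iff]
  simpa using inv_mem (IntermediateField.mem_adjoin_simple_self k t⁻¹)

/-- The zeros of `t` are the places over the place `t = 0` of `k(t)`. -/
theorem over_zero_iff {k F K : Type u} [Field k] [Field F] [Field K] [Algebra k F]
    [Algebra k K] [Algebra F K] [IsScalarTower k F K] {P : Place k K} {t : F} {A : Place k F}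
    (ht : Transcendental k t) (htop : IntermediateField.adjoin k {t} = ⊤)
    (hA : A.IsZeroOf t Polynomial.X) : P.Over A ↔ 0 < P.ord (algebraMap F K t) := by
  refine ⟨fun h => ?_, fun h => ?_⟩
  · have h1 := hA.ord_aeval
    rw [Polynomial.aeval_X] at h1
    rw [h.ord_algebraMap, h1, mul_one]
    exact_mod_cast h.ramIdx_pos
  · have hm : algebraMap F K t ∈ P.ring := P.mem_ring_iff.2 h.le
    refine hA.over ht htop Polynomial.irreducible_X hm ?_
    rw [Polynomial.aeval_X, P.eval_of_mem hm, ev_eq_zero_iff]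
    exact Or.inr h

open Classical in
/-- The degree of the divisor of a separating function is zero. -/
theorem sum_ord_algebraMap [Algebra.IsSeparable F K] (hP : IsComplete P) {t : F}
    (ht : Transcendental k t) (htop : IntermediateField.adjoin k {t} = ⊤) (S : Finset ι)
    (hSt : ∀ i, (P i).ord (algebraMap F K t) ≠ 0 → i ∈ S) :
    ∑ i ∈ S, (P i).ord (algebraMap F K t) * Module.finrank k (P i).κ = 0 := by
  have ht' := ht.inv
  have htop' := IntermediateField.adjoin_inv_eq_top htop
  obtain ⟨A₀, h₀⟩ := exists_isZeroOf ht htop Polynomial.irreducible_X Polynomial.monic_X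
  obtain ⟨A₁, h₁⟩ := exists_isZeroOf ht' htop' Polynomial.irreducible_X Polynomial.monic_X
  have ho₀ := fun i => over_zero_iff (P := P i) ht htop h₀
  have ho₁ := fun i => over_zero_iff (P := P i) ht' htop' h₁
  simp only [map_inv₀, ord_inv] at ho₁
  have e₀ := hP.sum_ord_mul_finrank A₀ (finite_integralClosure_of_isSeparable A₀)
    (by rw [h₀.finrank_eq, Polynomial.natDegree_X]) (v := t)
    (by simpa using h₀.ord_aeval) S fun i hi => hSt i ((ho₀ i).1 hi).ne'
  have e₁ := hP.sum_ord_mul_finrank A₁ (finite_integralClosure_of_isSeparable A₁)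
    (by rw [h₁.finrank_eq, Polynomial.natDegree_X]) (v := t⁻¹)
    (by simpa using h₁.ord_aeval) S fun i hi => hSt i (by have := (ho₁ i).1 hi; omega)
  have hsplit : ∀ i, (P i).ord (algebraMap F K t) * (Module.finrank k (P i).κ : ℤ) =
      (if (P i).Over A₀ then (P i).ord (algebraMap F K t) * (Module.finrank k (P i).κ : ℤ) else 0) -
      (if (P i).Over A₁ then
        (P i).ord (algebraMap F K t⁻¹) * (Module.finrank k (P i).κ : ℤ) else 0) := by
    intro i
    rw [map_inv₀, ord_inv]
    rcases lt_trichotomy ((P i).ord (algebraMap F K t)) 0 with h | h | h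
    · rw [if_neg (by rw [ho₀]; omega), if_pos (by rw [ho₁]; omega)]; ring
    · simp [h]
    · rw [if_pos (by rw [ho₀]; omega), if_neg (by rw [ho₁]; omega)]; ring
  rw [Finset.sum_congr rfl fun i _ => hsplit i, Finset.sum_sub_distrib, ← Finset.sum_filter,
    ← Finset.sum_filter, e₀, e₁, sub_self]

open Classical in
/-- Weil reciprocity for a separating function `t` and a function `g` with disjoint divisors. -/
theorem weil_reciprocity_of_adjoin [Algebra.IsSeparable F K] (hP : IsComplete P) {t : F}
    (ht : Transcendental k t) (htop : IntermediateField.adjoin k {t} = ⊤) {g : K} (hg : g ≠ 0)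
    (hdisj : ∀ i, (P i).ord (algebraMap F K t) ≠ 0 → (P i).ord g = 0) (S : Finset ι)
    (hSt : ∀ i, (P i).ord (algebraMap F K t) ≠ 0 → i ∈ S)
    (hSg : ∀ i, (P i).ord g ≠ 0 → i ∈ S) :
    ∏ i ∈ S, Algebra.norm k ((P i).eval (algebraMap F K t)) ^ (P i).ord g =
      ∏ i ∈ S, Algebra.norm k ((P i).eval g) ^ (P i).ord (algebraMap F K t) := by
  have ht0 : t ≠ 0 := by
    rintro rfl
    exact ht isAlgebraic_zero
  have htK : algebraMap F K t ≠ 0 := (map_ne_zero _).2 ht0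
  have ht' := ht.inv
  have htop' := IntermediateField.adjoin_inv_eq_top htop
  have hres := hP.finite_residue
  have hex : ∀ p : k[X], ∃ A : Place k F, Irreducible p → p.Monic → A.IsZeroOf t p := by
    intro p
    by_cases h : Irreducible p ∧ p.Monic
    · obtain ⟨A, hA⟩ := exists_isZeroOf ht htop h.1 h.2
      exact ⟨A, fun _ _ => hA⟩
    · obtain ⟨A, -⟩ := exists_isZeroOf ht htop Polynomial.irreducible_X Polynomial.monic_X
      exact ⟨A, fun h1 h2 => absurd ⟨h1, h2⟩ h⟩
  choose A hA using hex
  obtain ⟨A₁, h₁⟩ := exists_isZeroOf ht' htop' Polynomial.irreducible_X Polynomial.monic_X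
  have h₀ := hA Polynomial.X Polynomial.irreducible_X Polynomial.monic_X
  have ho₀ := fun i => over_zero_iff (P := P i) ht htop h₀
  have ho₁ := fun i => over_zero_iff (P := P i) ht' htop' h₁
  simp only [map_inv₀, ord_inv] at ho₁
  have hfin := fun B : Place k F => finite_integralClosure_of_isSeparable (K := K) B
  -- the closed point of the line below a place at which `t` is a unit
  let p : ι → k[X] := fun i => minpoly k ((P i).eval (algebraMap F K t))
  have hint : ∀ i, IsIntegral k ((P i).eval (algebraMap F K t)) := fun i =>
    Algebra.IsIntegral.isIntegral _
  have hpirr : ∀ i, Irreducible (p i) := fun i => minpoly.irreducible (hint i)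
  have hpm : ∀ i, (p i).Monic := fun i => minpoly.monic (hint i)
  have hp0 : ∀ i, (P i).ord (algebraMap F K t) = 0 → (p i).coeff 0 ≠ 0 := fun i hi =>
    minpoly.coeff_zero_ne_zero (hint i) ((P i).eval_ne_zero htK hi)
  have hover : ∀ i, (P i).ord (algebraMap F K t) = 0 → (P i).Over (A (p i)) := fun i hi => by
    have hm := (P i).mem_of_ord_eq_zero hi
    refine (hA _ (hpirr i) (hpm i)).over ht htop (hpirr i) hm ?_
    rw [eval_aeval hm, minpoly.aeval]
  have huniq : ∀ i q, Irreducible q → q.Monic → q.coeff 0 ≠ 0 → (P i).Over (A q) →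
      (P i).ord (algebraMap F K t) = 0 ∧ p i = q := fun i q hq hqm hq0 hi => by
    have hAq := hA q hq hqm
    have h1 : (A q).ord t = 0 := by
      have := hAq.ord_eq_zero (q := Polynomial.X) fun hdvd => hq0 (by
        rw [Polynomial.eq_of_monic_of_associated hqm Polynomial.monic_X
          (hq.associated_of_dvd Polynomial.irreducible_X hdvd), Polynomial.coeff_X_zero])
      rwa [Polynomial.aeval_X] at this
    have h2 : (P i).ord (algebraMap F K t) = 0 := by rw [hi.ord_algebraMap, h1, mul_zero]
    refine ⟨h2, ?_⟩
    have h3 : (P i).eval (Polynomial.aeval (algebraMap F K t) q) = 0 := by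
      rw [Polynomial.aeval_algebraMap_apply, ← hi.resMap_eval (aeval_mem hAq.mem q),
        (hAq.eval_eq_zero_iff q).2 dvd_rfl, map_zero]
    rw [eval_aeval ((P i).mem_of_ord_eq_zero h2)] at h3
    exact Polynomial.eq_of_monic_of_associated (hpm i) hqm
      ((hpirr i).associated_of_dvd hq (minpoly.dvd k _ h3))
  set S' := S.filter fun i => (P i).ord (algebraMap F K t) = 0 with hS'
  set T := S'.image p with hT
  have hTp : ∀ q ∈ T, Irreducible q ∧ q.Monic ∧ q.coeff 0 ≠ 0 := fun q hq => by
    obtain ⟨i, hi, rfl⟩ := Finset.mem_image.1 hq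
    exact ⟨hpirr i, hpm i, hp0 i (Finset.mem_filter.1 hi).2⟩
  set G := Algebra.norm F g with hGdef
  have hG : G ≠ 0 := Algebra.norm_ne_zero_iff.2 hg
  have hordG : ∀ B : Place k F, (∀ i, (P i).Over B → (P i).ord g = 0) → B.ord G = 0 := by
    intro B hB
    have := hP.finite_over B
    have := Fintype.ofFinite {i // (P i).Over B}
    rw [(hP.isFibre B (hfin B)).ord_norm hg]
    exact Finset.sum_eq_zero fun i _ => by rw [hB i i.2, mul_zero]
  have hG0 : (A Polynomial.X).ord G = 0 := hordG _ fun i hi => hdisj i ((ho₀ i).1 hi).ne'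
  have hG1 : A₁.ord G = 0 := hordG _ fun i hi => hdisj i (by have := (ho₁ i).1 hi; omega)
  obtain ⟨c, hc, hGc⟩ := exists_eq_prod_zpow ht htop A (fun p hp hpm => hA p hp hpm) hG T
    (fun q hq => ⟨(hTp q hq).1, (hTp q hq).2.1⟩) fun q hq hqm hqT => by
      by_cases hq0 : q.coeff 0 = 0
      · have : Polynomial.X = q := Polynomial.eq_of_monic_of_associated Polynomial.monic_X hqm
          (Polynomial.irreducible_X.associated_of_dvd hq (Polynomial.X_dvd_iff.2 hq0))
        rwa [← this]
      refine hordG _ fun i hi => ?_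
      obtain ⟨h2, rfl⟩ := huniq i q hq hqm hq0 hi
      by_contra hne
      exact hqT (Finset.mem_image.2 ⟨i, Finset.mem_filter.2 ⟨hSg i hne, h2⟩, rfl⟩)
  have hvals := eval_prod_zpow ht h₀ h₁ T (fun q hq => (hTp q hq).2)
    (fun q => (A q).ord G) c hc (by rw [← hGc]; exact hG1)
  rw [← hGc] at hvals
  obtain ⟨hdeg, hv0, hv1⟩ := hvals
  -- the left hand side, grouped over the closed points of the line
  have hL : ∏ i ∈ S, Algebra.norm k ((P i).eval (algebraMap F K t)) ^ (P i).ord g =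
      ∏ q ∈ T, q.coeff 0 ^ (A q).ord G := by
    have e1 : ∏ i ∈ S, Algebra.norm k ((P i).eval (algebraMap F K t)) ^ (P i).ord g =
        ∏ i ∈ S', Algebra.norm k ((P i).eval (algebraMap F K t)) ^ (P i).ord g := by
      refine (Finset.prod_subset (Finset.filter_subset _ _) fun i hi hi' => ?_).symm
      rw [hdisj i fun h => hi' (Finset.mem_filter.2 ⟨hi, h⟩), zpow_zero]
    have e2 : ∀ q ∈ T, ∏ i ∈ S' with p i = q,
        Algebra.norm k ((P i).eval (algebraMap F K t)) ^ (P i).ord g =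
        (-1) ^ ((A q).ord G * q.natDegree) * q.coeff 0 ^ (A q).ord G := by
      intro q hq
      obtain ⟨hqi, hqm, hq0⟩ := hTp q hq
      have hAq := hA q hqi hqm
      have hne : (-1 : k) ^ q.natDegree * q.coeff 0 ≠ 0 :=
        mul_ne_zero (pow_ne_zero _ (neg_ne_zero.2 one_ne_zero)) hq0
      have h3 := hP.prod_norm_eval_algebraMap_zpow (A q) (hfin _) hAq.mem hg S hSg
        (by rw [hAq.norm_eval]; exact hne)
      rw [hAq.norm_eval, mul_zpow, ← zpow_natCast, ← zpow_mul, mul_comm (q.natDegree : ℤ)] at h3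
      rw [← h3, hS', Finset.filter_filter]
      refine Finset.prod_congr (Finset.filter_congr fun i _ => ⟨?_, huniq i q hqi hqm hq0⟩)
        fun _ _ => rfl
      rintro ⟨h4, rfl⟩
      exact hover i h4
    rw [e1, ← Finset.prod_fiberwise_of_maps_to (t := T) (g := p)
      (fun i hi => Finset.mem_image_of_mem p hi), Finset.prod_congr rfl e2,
      Finset.prod_mul_distrib,
      Finset.prod_zpow_eq_zpow_sum₀ (neg_ne_zero.2 one_ne_zero), hdeg, zpow_zero, one_mul]
  -- the right hand side is the quotient of the values of the norm at zero and at infinity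
  have r0 := hP.prod_norm_eval_zpow (A Polynomial.X) (hfin _)
    (by rw [h₀.finrank_eq, Polynomial.natDegree_X]) (v := t) (by simpa using h₀.ord_aeval)
    (g := g) (fun i hi => hdisj i ((ho₀ i).1 hi).ne') S (fun i hi => hSt i ((ho₀ i).1 hi).ne') hv0
  have r1 := hP.prod_norm_eval_zpow A₁ (hfin _)
    (by rw [h₁.finrank_eq, Polynomial.natDegree_X]) (v := t⁻¹) (by simpa using h₁.ord_aeval)
    (g := g) (fun i hi => hdisj i (by have := (ho₁ i).1 hi; omega)) S
    (fun i hi => hSt i (by have := (ho₁ i).1 hi; omega)) hv1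
  have hsplit : ∀ i, Algebra.norm k ((P i).eval g) ^ (P i).ord (algebraMap F K t) =
      (if (P i).Over (A Polynomial.X) then
        Algebra.norm k ((P i).eval g) ^ (P i).ord (algebraMap F K t) else 1) *
      (if (P i).Over A₁ then
        Algebra.norm k ((P i).eval g) ^ (P i).ord (algebraMap F K t⁻¹) else 1)⁻¹ := by
    intro i
    rw [map_inv₀, ord_inv]
    rcases lt_trichotomy ((P i).ord (algebraMap F K t)) 0 with h | h | h
    · rw [if_neg (by rw [ho₀]; omega), if_pos (by rw [ho₁]; omega), zpow_neg, inv_inv, one_mul]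
    · simp [h]
    · rw [if_pos (by rw [ho₀]; omega), if_neg (by rw [ho₁]; omega), inv_one, mul_one]
  rw [hL, Finset.prod_congr rfl fun i _ => hsplit i, Finset.prod_mul_distrib,
    Finset.prod_inv_distrib, ← Finset.prod_filter, ← Finset.prod_filter, r0, r1,
    mul_comm c, mul_inv_cancel_right₀ hc]

end IsComplete

end Place

namespace Place

/-! ### Separating functions -/

section Separating

variable {k K : Type u} [Field k] [Field K] [Algebra k K]

/-- If the differentials have rank one, a nonzero `dt` spans them, so there are no differentials
over `k(t)`. -/
theorem formallyUnramified_adjoin (hΩ : Module.finrank K Ω[K⁄k] = 1) {t : K}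
    (ht : KaehlerDifferential.D k K t ≠ 0) :
    Algebra.FormallyUnramified (IntermediateField.adjoin k {t}) K := by
  set F := IntermediateField.adjoin k {t}
  refine ⟨?_⟩
  have h0 : ∀ x : K, KaehlerDifferential.D F K x = 0 := by
    intro x
    obtain ⟨c, hc⟩ := (finrank_eq_one_iff_of_nonzero' _ ht).1 hΩ (KaehlerDifferential.D k K x)
    have h1 := congrArg (KaehlerDifferential.map k F K K) hc
    rw [map_smul, KaehlerDifferential.map_D, KaehlerDifferential.map_D] at h1
    have h2 : KaehlerDifferential.D F K t = 0 :=
      (KaehlerDifferential.D F K).map_algebraMap (IntermediateField.AdjoinSimple.gen k t)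
    rw [Algebra.algebraMap_self_apply, Algebra.algebraMap_self_apply, h2, smul_zero] at h1
    exact h1.symm
  have htop := KaehlerDifferential.span_range_derivation F K
  have hr : Set.range (KaehlerDifferential.D F K) ⊆ {0} := by
    rintro _ ⟨x, rfl⟩
    exact h0 x
  refine (Submodule.subsingleton_iff K).1 (subsingleton_of_bot_eq_top ?_)
  rw [← htop, eq_comm, Submodule.span_eq_bot]
  exact fun x hx => hr hx

/-- A function with nonzero differential is a separating element. -/
theorem separable_adjoin [Algebra.EssFiniteType k K] (hΩ : Module.finrank K Ω[K⁄k] = 1) {t : K}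
    (ht : KaehlerDifferential.D k K t ≠ 0) :
    FiniteDimensional (IntermediateField.adjoin k {t}) K ∧
      Algebra.IsSeparable (IntermediateField.adjoin k {t}) K := by
  have := formallyUnramified_adjoin hΩ ht
  have := Algebra.EssFiniteType.of_comp k (IntermediateField.adjoin k {t}) K
  exact ⟨Algebra.FormallyUnramified.finite_of_free _ _,
    Algebra.FormallyUnramified.isSeparable _ _⟩

/-- A valuation ring containing `k` contains everything algebraic over `k`. -/
theorem not_isAlgebraic (P : Place k K) : ¬ Algebra.IsAlgebraic k K := by
  intro h
  refine P.ring_ne_top (eq_top_iff.2 fun x _ => ?_)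
  have h1 : IsIntegral k x := (h.isAlgebraic x).isIntegral
  let _ : Algebra k P.ring := (((algebraMap k K).codRestrict P.ring.toSubring
    P.algebraMap_mem : k →+* P.ring)).toAlgebra
  have : IsScalarTower k P.ring K := .of_algebraMap_eq fun _ => rfl
  obtain ⟨y, rfl⟩ := IsIntegrallyClosed.isIntegral_iff.1 (h1.tower_top (A := P.ring))
  exact y.2

theorem transcendental_of_separable (P : Place k K) {t : K}
    (h : FiniteDimensional (IntermediateField.adjoin k {t}) K) : Transcendental k t := by
  intro ht
  have := IntermediateField.isAlgebraic_adjoin_simple ht.isIntegral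
  exact P.not_isAlgebraic (Algebra.IsAlgebraic.trans k (IntermediateField.adjoin k {t}) K)

theorem exists_D_ne_zero (hΩ : Module.finrank K Ω[K⁄k] = 1) :
    ∃ s : K, KaehlerDifferential.D k K s ≠ 0 := by
  by_contra! h
  have htop := KaehlerDifferential.span_range_derivation k K
  have : (⊤ : Submodule K Ω[K⁄k]) = ⊥ := by
    rw [← htop, Submodule.span_eq_bot]
    rintro _ ⟨x, rfl⟩
    exact h x
  have h1 : Module.finrank K (⊤ : Submodule K Ω[K⁄k]) = 0 := by rw [this, finrank_bot]
  rw [finrank_top, hΩ] at h1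
  exact one_ne_zero h1

theorem adjoinSimple_gen_adjoin (t : K) : IntermediateField.adjoin k
    {(IntermediateField.AdjoinSimple.gen k t : IntermediateField.adjoin k {t})} = ⊤ := by
  refine IntermediateField.lift_injective _ ?_
  rw [IntermediateField.lift_adjoin_simple, IntermediateField.lift_top,
    IntermediateField.AdjoinSimple.coe_gen]

theorem transcendental_gen {t : K} (ht : Transcendental k t) :
    Transcendental k (IntermediateField.AdjoinSimple.gen k t) := fun h =>
  ht (by simpa using h.algebraMap (A := K))

end Separating

namespace IsComplete

variable {k K : Type u} {ι : Type*} [Field k] [Field K] [Algebra k K] {P : ι → Place k K}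

/-- There are separating functions without zeros and poles in a given finite set of places. -/
theorem exists_separating_unit (hP : IsComplete P) (hΩ : Module.finrank K Ω[K⁄k] = 1)
    (S : Finset ι) : ∃ t : K, KaehlerDifferential.D k K t ≠ 0 ∧ ∀ i ∈ S, (P i).ord t = 0 := by
  obtain ⟨s, hs⟩ := exists_D_ne_zero hΩ
  have hs0 : s ≠ 0 := by
    rintro rfl
    exact hs (map_zero _)
  obtain ⟨b, hb0, hb⟩ := exists_ord_eq (fun i : S => P i)
    (fun i j h => Subtype.ext (hP.inj h)) fun i => max 1 (1 - (P i).ord s)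
  have hunit : ∀ x : K, x ≠ 0 → (∀ i ∈ S, 0 < (P i).ord x) →
      ∀ i ∈ S, (P i).ord (x + 1) = 0 := fun x hx h i hi => by
    have := ((P i).ord_add_eq_right (x := x) (y := 1) one_ne_zero fun _ => by
      rw [ord_one]; exact h i hi).2
    rwa [ord_one] at this
  -- `b` vanishes on `S` so much that `b * s` vanishes there too; one of them is separating
  by_cases h : KaehlerDifferential.D k K b = 0
  · refine ⟨b * s + 1, ?_, hunit _ (mul_ne_zero hb0 hs0) fun i hi => ?_⟩
    · rw [map_add, Derivation.map_one_eq_zero, add_zero, Derivation.leibniz, h, smul_zero, add_zero]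
      exact smul_ne_zero hb0 hs
    · have := hb ⟨i, hi⟩
      simp only at this
      rw [(P i).ord_mul hb0 hs0, this]
      have := le_max_right 1 (1 - (P i).ord s)
      omega
  · refine ⟨b + 1, ?_, hunit _ hb0 fun i hi => ?_⟩
    · rwa [map_add, Derivation.map_one_eq_zero, add_zero]
    · have := hb ⟨i, hi⟩
      simp only at this
      rw [this]
      have := le_max_left 1 (1 - (P i).ord s)
      omega

/-- Every function is a quotient of separating functions, the denominator being a unit at finitely
many given places. -/
theorem separating_induction (hP : IsComplete P) (hΩ : Module.finrank K Ω[K⁄k] = 1)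
    (S : Finset ι) {p : K → Prop} (h : ∀ f, KaehlerDifferential.D k K f ≠ 0 → p f ∨
      ∃ i ∈ S, (P i).ord f ≠ 0)
    (hdiv : ∀ f t, f ≠ 0 → t ≠ 0 → (∀ i ∈ S, (P i).ord f = 0) → (∀ i ∈ S, (P i).ord t = 0) →
      p t → p (f * t) → p f)
    {f : K} (hf : f ≠ 0) (hS : ∀ i ∈ S, (P i).ord f = 0) : p f := by
  have hsep : ∀ f, KaehlerDifferential.D k K f ≠ 0 → (∀ i ∈ S, (P i).ord f = 0) → p f :=
    fun f hf hS => (h f hf).resolve_right fun ⟨i, hi, hne⟩ => hne (hS i hi)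
  by_cases hD : KaehlerDifferential.D k K f = 0
  · obtain ⟨t, ht, htS⟩ := hP.exists_separating_unit hΩ S
    have ht0 : t ≠ 0 := by
      rintro rfl
      exact ht (map_zero _)
    refine hdiv f t hf ht0 hS htS (hsep t ht htS) (hsep _ ?_ fun i hi => ?_)
    · rw [Derivation.leibniz, hD, smul_zero, add_zero]
      exact smul_ne_zero hf ht
    · rw [(P i).ord_mul hf ht0, hS i hi, htS i hi, add_zero]
  · exact hsep f hD hS

/-- Weil reciprocity when `f` is separating. -/
theorem weil_reciprocity_of_D_ne_zero (hP : IsComplete P) [Algebra.EssFiniteType k K]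
    (hΩ : Module.finrank K Ω[K⁄k] = 1) {f g : K} (hf : KaehlerDifferential.D k K f ≠ 0) (hg : g ≠ 0)
    (hdisj : ∀ i, (P i).ord f ≠ 0 → (P i).ord g = 0) (S : Finset ι)
    (hSf : ∀ i, (P i).ord f ≠ 0 → i ∈ S) (hSg : ∀ i, (P i).ord g ≠ 0 → i ∈ S) :
    ∏ i ∈ S, Algebra.norm k ((P i).eval f) ^ (P i).ord g =
      ∏ i ∈ S, Algebra.norm k ((P i).eval g) ^ (P i).ord f := by
  rcases isEmpty_or_nonempty ι with hι | ⟨⟨i₀⟩⟩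
  · rw [Finset.eq_empty_of_isEmpty S, Finset.prod_empty, Finset.prod_empty]
  obtain ⟨h1, h2⟩ := separable_adjoin hΩ hf
  have hweil := weil_reciprocity_of_adjoin (F := IntermediateField.adjoin k {f}) hP
    (transcendental_gen ((P i₀).transcendental_of_separable h1)) (adjoinSimple_gen_adjoin f) hg
  rw [IntermediateField.AdjoinSimple.algebraMap_gen] at hweil
  exact hweil hdisj S hSf hSg

/-- Weil reciprocity for functions with disjoint divisors. -/
theorem weil_reciprocity (hP : IsComplete P) [Algebra.EssFiniteType k K]
    (hΩ : Module.finrank K Ω[K⁄k] = 1) {f g : K} (hf : f ≠ 0) (hg : g ≠ 0)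
    (hdisj : ∀ i, (P i).ord f ≠ 0 → (P i).ord g = 0) (S : Finset ι)
    (hSf : ∀ i, (P i).ord f ≠ 0 → i ∈ S) (hSg : ∀ i, (P i).ord g ≠ 0 → i ∈ S) :
    ∏ i ∈ S, Algebra.norm k ((P i).eval f) ^ (P i).ord g =
      ∏ i ∈ S, Algebra.norm k ((P i).eval g) ^ (P i).ord f := by
  classical
  have hres := hP.finite_residue
  -- the products over any two sets containing the supports agree
  let p : K → Prop := fun f => ∀ S : Finset ι, (∀ i, (P i).ord f ≠ 0 → i ∈ S) →
    (∀ i, (P i).ord g ≠ 0 → i ∈ S) →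
    ∏ i ∈ S, Algebra.norm k ((P i).eval f) ^ (P i).ord g =
      ∏ i ∈ S, Algebra.norm k ((P i).eval g) ^ (P i).ord f
  refine separating_induction (p := p) hP hΩ (hP.finite_support g).toFinset (fun f hD => ?_) ?_ hf
    (fun i hi => ?_) S hSf hSg
  · by_cases hdisj : ∃ i ∈ (hP.finite_support g).toFinset, (P i).ord f ≠ 0
    · exact Or.inr hdisj
    refine Or.inl fun S hSf hSg => ?_
    exact hP.weil_reciprocity_of_D_ne_zero hΩ hD hg (fun i hi => by
      by_contra hne
      exact hdisj ⟨i, by simpa using hne, hi⟩) S hSf hSg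
  · intro f t hf ht hfS htS hpt hpft S hSf hSg
    have htS' : ∀ i, (P i).ord g ≠ 0 → (P i).ord t = 0 := fun i hi => htS i (by simpa using hi)
    set S' := S ∪ (hP.finite_support t).toFinset with hS'
    have hSS' : S ⊆ S' := Finset.subset_union_left
    have htS'' : ∀ i, (P i).ord t ≠ 0 → i ∈ S' := fun i hi =>
      Finset.mem_union_right _ (by simpa using hi)
    have e1 := hpt S' htS'' fun i hi => hSS' (hSg i hi)
    have e2 := hpft S' (fun i hi => by
      by_contra hiS
      refine hi ?_
      rw [(P i).ord_mul hf ht, not_imp_comm.1 (htS'' i) hiS,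
        not_imp_comm.1 (hSf i) (fun h => hiS (hSS' h)), add_zero]) fun i hi => hSS' (hSg i hi)
    have e3 : ∀ i, Algebra.norm k ((P i).eval (f * t)) ^ (P i).ord g =
        Algebra.norm k ((P i).eval f) ^ (P i).ord g *
          Algebra.norm k ((P i).eval t) ^ (P i).ord g := by
      intro i
      by_cases hi : (P i).ord g = 0
      · simp [hi]
      have hi' : i ∈ (hP.finite_support g).toFinset := by simpa using hi
      rw [(P i).eval_mul ((P i).mem_of_ord_eq_zero (hfS i hi'))
        ((P i).mem_of_ord_eq_zero (htS i hi')), map_mul, mul_zpow]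
    have e4 : ∀ i, Algebra.norm k ((P i).eval g) ^ (P i).ord (f * t) =
        Algebra.norm k ((P i).eval g) ^ (P i).ord f *
          Algebra.norm k ((P i).eval g) ^ (P i).ord t := by
      intro i
      rw [(P i).ord_mul hf ht]
      by_cases hi : (P i).ord g = 0
      · exact zpow_add₀ (Algebra.norm_ne_zero_iff.2 ((P i).eval_ne_zero hg hi)) _ _
      have hi' : i ∈ (hP.finite_support g).toFinset := by simpa using hi
      rw [htS i hi', hfS i hi', add_zero, zpow_zero, one_mul]
    have e5 : ∏ i ∈ S', Algebra.norm k ((P i).eval t) ^ (P i).ord g ≠ 0 := by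
      refine Finset.prod_ne_zero_iff.2 fun i _ => ?_
      by_cases hi : (P i).ord g = 0
      · simp [hi]
      · exact zpow_ne_zero _ (Algebra.norm_ne_zero_iff.2 ((P i).eval_ne_zero ht (htS' i hi)))
    simp only [e3, e4, Finset.prod_mul_distrib] at e2
    rw [← e1] at e2
    have e6 := mul_right_cancel₀ e5 e2
    rw [Finset.prod_subset hSS' fun i _ hi => ?_, Finset.prod_subset hSS' fun i _ hi => ?_]
    · exact e6
    · rw [not_imp_comm.1 (hSf i) hi, zpow_zero]
    · rw [not_imp_comm.1 (hSg i) hi, zpow_zero]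
  · by_contra h
    exact (by simpa using hi : (P i).ord g ≠ 0) (hdisj i h)

/-- The divisor of a function has degree zero. -/
theorem sum_ord_mul_finrank_eq_zero (hP : IsComplete P) [Algebra.EssFiniteType k K]
    (hΩ : Module.finrank K Ω[K⁄k] = 1) {f : K} (hf : f ≠ 0) (S : Finset ι)
    (hSf : ∀ i, (P i).ord f ≠ 0 → i ∈ S) :
    ∑ i ∈ S, (P i).ord f * Module.finrank k (P i).κ = 0 := by
  classical
  let p : K → Prop := fun f => ∀ S : Finset ι, (∀ i, (P i).ord f ≠ 0 → i ∈ S) →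
    ∑ i ∈ S, (P i).ord f * Module.finrank k (P i).κ = 0
  refine separating_induction (p := p) hP hΩ ∅ (fun f hD => ?_) ?_ hf (by simp) S hSf
  · refine Or.inl fun S hSf => ?_
    rcases isEmpty_or_nonempty ι with hι | ⟨⟨i₀⟩⟩
    · rw [Finset.eq_empty_of_isEmpty S]; rfl
    obtain ⟨h1, h2⟩ := separable_adjoin hΩ hD
    exact sum_ord_algebraMap (F := IntermediateField.adjoin k {f}) hP
      (transcendental_gen ((P i₀).transcendental_of_separable h1)) (adjoinSimple_gen_adjoin f) S hSf
  · intro f t hf ht _ _ hpt hpft S hSf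
    have hSS' : S ⊆ S ∪ (hP.finite_support t).toFinset := Finset.subset_union_left
    have htS' : ∀ i, (P i).ord t ≠ 0 → i ∈ S ∪ (hP.finite_support t).toFinset := fun i hi =>
      Finset.mem_union_right _ (by simpa using hi)
    have e1 := hpt _ htS'
    have e2 := hpft _ (fun i hi => by
      by_contra hiS
      refine hi ?_
      rw [(P i).ord_mul hf ht, not_imp_comm.1 (htS' i) hiS,
        not_imp_comm.1 (hSf i) (fun h => hiS (hSS' h)), add_zero])
    rw [Finset.sum_congr rfl fun i _ => by rw [(P i).ord_mul hf ht, add_mul],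
      Finset.sum_add_distrib, e1, add_zero] at e2
    rw [← e2]
    refine Finset.sum_subset hSS' fun i _ hi => ?_
    rw [not_imp_comm.1 (hSf i) hi, zero_mul]

/-- A function without zeros and poles is algebraic over the constants. -/
theorem isIntegral_of_ord_eq_zero (hP : IsComplete P) {f : K} (hf : ∀ i, (P i).ord f = 0) :
    IsIntegral k f := by
  by_contra h
  obtain ⟨V, hV, hfV⟩ := Subring.exists_le_valuationSubring_of_isIntegrallyClosedIn
    (R := (integralClosure k K).toSubring) (x := f) h
  obtain ⟨i, rfl⟩ := hP.complete V (fun c => hV ((integralClosure k K).algebraMap_mem c)) (by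
    rintro rfl
    exact hfV (ValuationSubring.mem_top _))
  exact hfV ((P i).mem_of_ord_eq_zero (hf i))

theorem _root_.Place.mem_ring_of_isIntegral (P : Place k K) {c : K} (hc : IsIntegral k c) :
    c ∈ P.ring := by
  let _ : Algebra k P.ring := (((algebraMap k K).codRestrict P.ring.toSubring
    P.algebraMap_mem : k →+* P.ring)).toAlgebra
  have : IsScalarTower k P.ring K := .of_algebraMap_eq fun _ => rfl
  obtain ⟨y, rfl⟩ := IsIntegrallyClosed.isIntegral_iff.1 (hc.tower_top (A := P.ring))
  exact y.2

/-- The norm of a constant `c`, algebraic over `k` but not necessarily in `k`, at a place: the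
residue field is an extension of `k(c)`, of degree `m` say, and the norm is the `m`-th power of
that of `c`. -/
theorem _root_.Place.exists_norm_eval_of_isIntegral {c : K} (hc : IsIntegral k c) (hc0 : c ≠ 0) :
    ∃ (a : k) (d : ℕ), a ≠ 0 ∧ d ≠ 0 ∧ ∀ P : Place k K, FiniteDimensional k P.κ →
      ∃ m : ℕ, Module.finrank k P.κ = d * m ∧ Algebra.norm k (P.eval c) = a ^ m := by
  set L := IntermediateField.adjoin k {c}
  have hL : FiniteDimensional k L := IntermediateField.adjoin.finiteDimensional hc
  let γ : L := IntermediateField.AdjoinSimple.gen k c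
  have hγ : γ ≠ 0 := fun h => hc0 (congrArg Subtype.val h)
  refine ⟨Algebra.norm k γ, Module.finrank k L, Algebra.norm_ne_zero_iff.2 hγ,
    Module.finrank_pos.ne', fun P hP => ?_⟩
  have hmem : ∀ x : L, (x : K) ∈ P.ring := fun x => P.mem_ring_of_isIntegral
    ((Algebra.IsIntegral.isIntegral (R := k) x).map (IntermediateField.val L))
  let _ : Algebra L P.κ := (P.ev.comp ((algebraMap L K).codRestrict P.ring.toSubring hmem :
    L →+* P.ring)).toAlgebra
  have : IsScalarTower k L P.κ := .of_algebraMap_eq fun x => (P.ev_algebraMap x).symm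
  have := FiniteDimensional.right k L P.κ
  refine ⟨Module.finrank L P.κ, (Module.finrank_mul_finrank k L P.κ).symm, ?_⟩
  have h1 : P.eval c = algebraMap L P.κ γ := P.eval_of_mem (hmem γ)
  rw [h1, ← Algebra.norm_norm (S := L), Algebra.norm_algebraMap, map_pow]

/-- The product of the values of a constant along a divisor of degree zero is one. -/
theorem prod_norm_eval_of_isIntegral (hP : IsComplete P) {c : K} (hc : IsIntegral k c)
    (hc0 : c ≠ 0) (E : ι →₀ ℤ) (hE : (E.sum fun i e => e * Module.finrank k (P i).κ) = 0) :
    (E.prod fun i e => Algebra.norm k ((P i).eval c) ^ e) = 1 := by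
  obtain ⟨a, d, ha, hd, h⟩ := exists_norm_eval_of_isIntegral hc hc0
  choose m hm hn using fun i => h (P i) (hP.finite_residue i)
  have h0 : ∑ i ∈ E.support, (m i : ℤ) * E i = 0 := by
    have h1 : (d : ℤ) * ∑ i ∈ E.support, (m i : ℤ) * E i = 0 := by
      rw [← hE, Finsupp.sum, Finset.mul_sum]
      refine Finset.sum_congr rfl fun i _ => ?_
      rw [hm]
      push_cast
      ring
    exact (mul_eq_zero.1 h1).resolve_left (by exact_mod_cast hd)
  rw [Finsupp.prod, Finset.prod_congr rfl fun i _ => by rw [hn, ← zpow_natCast, ← zpow_mul],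
    Finset.prod_zpow_eq_zpow_sum₀ ha, h0, zpow_zero]

end IsComplete

end Place

/-! ### Smooth algebras of relative dimension one over a field -/

namespace SmoothCurve

/-- A smooth domain of relative dimension one over a field is not a field. -/
theorem not_isField (k A : Type u) [Field k] [CommRing A] [IsDomain A] [Algebra k A]
    [Algebra.IsStandardSmoothOfRelativeDimension 1 k A] : ¬ IsField A := by
  intro hA
  obtain ⟨g, hg⟩ := Algebra.IsStandardSmoothOfRelativeDimension.exists_etale_mvPolynomial 1 k A
  let _ := hA.toField
  let _ : Algebra (MvPolynomial (Fin 1) k) A := g.toAlgebra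
  have : IsScalarTower k (MvPolynomial (Fin 1) k) A := .of_algebraMap_eq fun c =>
    (g.commutes c).symm
  have : Algebra.Etale (MvPolynomial (Fin 1) k) A := hg
  have : Algebra.IsStandardSmooth k A :=
    Algebra.IsStandardSmoothOfRelativeDimension.isStandardSmooth 1
  have := finite_of_finite_type_of_isJacobsonRing k A
  -- `A` is flat over the polynomial ring, so the coordinate is transcendental
  have hinj : Function.Injective (algebraMap (MvPolynomial (Fin 1) k) A) :=
    FaithfulSMul.algebraMap_injective _ _
  have hX : Transcendental k (MvPolynomial.X (0 : Fin 1) : MvPolynomial (Fin 1) k) :=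
    MvPolynomial.transcendental_X k 0
  exact ((transcendental_algebraMap_iff (A := A) hinj).2 hX) (Algebra.IsAlgebraic.isAlgebraic _)

/-- The local rings of a smooth domain of relative dimension one over a field, at nonzero primes,
are discrete valuation rings: the ring is étale over `k[T]`, so that a generator of the prime of
`k[T]` below generates the maximal ideal. -/
theorem isDiscreteValuationRing_localization (k A : Type u) [Field k] [CommRing A]
    [IsDomain A] [Algebra k A]
    [Algebra.IsStandardSmoothOfRelativeDimension 1 k A] (Q : Ideal A) [Q.IsPrime] (hQ : Q ≠ ⊥) :
    IsDiscreteValuationRing (Localization.AtPrime Q) := by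
  obtain ⟨g, hg⟩ := Algebra.IsStandardSmoothOfRelativeDimension.exists_etale_mvPolynomial 1 k A
  let _ : Algebra (MvPolynomial (Fin 1) k) A := g.toAlgebra
  have : Algebra.Etale (MvPolynomial (Fin 1) k) A := hg
  have : IsPrincipalIdealRing (MvPolynomial (Fin 1) k) :=
    IsPrincipalIdealRing.of_surjective (MvPolynomial.uniqueAlgEquiv k (Fin 1)).symm.toRingHom
      (MvPolynomial.uniqueAlgEquiv k (Fin 1)).symm.surjective
  have : IsNoetherianRing A := Algebra.FiniteType.isNoetherianRing (MvPolynomial (Fin 1) k) A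
  let p := Q.under (MvPolynomial (Fin 1) k)
  let _ := Localization.AtPrime.algebraOfLiesOver p Q
  have : Algebra.IsUnramifiedAt (MvPolynomial (Fin 1) k) Q := inferInstance
  have hmax := ((Algebra.isUnramifiedAt_iff_map_eq _ p Q).1 this).2
  have hprin : (IsLocalRing.maximalIdeal (Localization.AtPrime Q)).IsPrincipal := by
    rw [← hmax]
    obtain ⟨a, ha⟩ := (IsPrincipalIdealRing.principal p).principal
    rw [Ideal.submodule_span_eq] at ha
    rw [ha, Ideal.map_span, Set.image_singleton]
    exact ⟨_, rfl⟩
  refine ((IsDiscreteValuationRing.TFAE (Localization.AtPrime Q) fun hF => hQ ?_).out 0 4).2 hprin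
  rw [IsLocalRing.isField_iff_maximalIdeal_eq] at hF
  rw [← IsLocalization.AtPrime.under_maximalIdeal (Localization.AtPrime Q) Q, hF]
  exact (RingHom.injective_iff_ker_eq_bot _).1
    (IsLocalization.injective _ Q.primeCompl_le_nonZeroDivisors)

theorem isDiscreteValuationRing_of_isLocalization (k A : Type u) [Field k] [CommRing A]
    [IsDomain A] [Algebra k A]
    [Algebra.IsStandardSmoothOfRelativeDimension 1 k A] (Q : Ideal A) [Q.IsPrime] (hQ : Q ≠ ⊥)
    (B : Type u) [CommRing B] [IsDomain B] [Algebra A B] [IsLocalization.AtPrime B Q] :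
    IsDiscreteValuationRing B :=
  have := isDiscreteValuationRing_localization k A Q hQ
  IsDiscreteValuationRing.RingEquivClass.isDiscreteValuationRing
    (IsLocalization.algEquiv Q.primeCompl (Localization.AtPrime Q) B)

theorem finrank_kaehlerDifferential (k A : Type u) [Field k] [CommRing A] [IsDomain A] [Algebra k A]
    [Algebra.IsStandardSmoothOfRelativeDimension 1 k A] (K : Type u) [Field K] [Algebra A K]
    [IsFractionRing A K] [Algebra k K] [IsScalarTower k A K] : Module.finrank K Ω[K⁄k] = 1 := by
  have h1 :=
    Algebra.IsStandardSmoothOfRelativeDimension.rank_kaehlerDifferential (R := k) (S := A) 1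
  have : Algebra.FormallyEtale A K := .of_isLocalization (nonZeroDivisors A)
  have : Algebra.IsStandardSmooth k A :=
    Algebra.IsStandardSmoothOfRelativeDimension.isStandardSmooth 1
  rw [← (KaehlerDifferential.tensorKaehlerEquivOfFormallyEtale k A K).finrank_eq,
    Module.finrank_baseChange]
  exact Module.finrank_eq_of_rank_eq h1

theorem essFiniteType (k A : Type u) [Field k] [CommRing A] [Algebra k A]
    [Algebra.IsStandardSmoothOfRelativeDimension 1 k A] (K : Type u) [Field K] [Algebra A K]
    [IsFractionRing A K] [Algebra k K] [IsScalarTower k A K] : Algebra.EssFiniteType k K := by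
  have : Algebra.EssFiniteType A K := .of_isLocalization _ (nonZeroDivisors A)
  have : Algebra.IsStandardSmooth k A :=
    Algebra.IsStandardSmoothOfRelativeDimension.isStandardSmooth 1
  exact .comp k A K

end SmoothCurve

/-! ### The local rings of a curve -/

namespace CurvePairing.Curve

variable {k : Type u} [Field k] (X : Curve k)

/-- The structure morphism of a local ring of the curve. -/
noncomputable def stalkHom (x : X.toScheme) : k →+* X.toScheme.presheaf.stalk x :=
  (Spec.preimage (X.toScheme.fromSpecStalk x ≫ X.str)).hom

theorem spec_stalkHom (x : X.toScheme) :
    Spec.map (CommRingCat.ofHom (X.stalkHom x)) = X.toScheme.fromSpecStalk x ≫ X.str := by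
  rw [stalkHom, CommRingCat.ofHom_hom]
  exact Spec.map_preimage _

theorem stalkSpecializes_stalkHom {x y : X.toScheme} (h : x ⤳ y) (c : k) :
    (X.toScheme.presheaf.stalkSpecializes h).hom (X.stalkHom y c) = X.stalkHom x c := by
  have h1 : CommRingCat.ofHom (X.stalkHom y) ≫ X.toScheme.presheaf.stalkSpecializes h =
      CommRingCat.ofHom (X.stalkHom x) := by
    apply Spec.map_injective
    rw [Spec.map_comp, spec_stalkHom, spec_stalkHom,
      Scheme.SpecMap_stalkSpecializes_fromSpecStalk_assoc]
  exact congrArg (fun f => f.hom c) h1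

/-- The function field as an extension of `k`, via the structure morphism. -/
noncomputable instance algebraFunField : Algebra k X.FunField :=
  (X.stalkHom (genericPoint X.toScheme)).toAlgebra

theorem algebraMap_stalkHom (x : X.toScheme) (c : k) :
    algebraMap (X.toScheme.presheaf.stalk x) X.FunField (X.stalkHom x c) =
      algebraMap k X.FunField c := X.stalkSpecializes_stalkHom _ c

theorem residue_stalkHom (Q : X.Pt) (c : k) :
    (X.toScheme.residue Q.1).hom (X.stalkHom Q.1 c) = algebraMap k (X.resField Q) c := by
  have h1 : CommRingCat.ofHom (X.stalkHom Q.1) ≫ X.toScheme.residue Q.1 =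
      Spec.preimage (X.toScheme.fromSpecResidueField Q.1 ≫ X.str) := by
    apply Spec.map_injective
    rw [Spec.map_preimage, Spec.map_comp, spec_stalkHom, Scheme.fromSpecResidueField,
      Category.assoc]
  exact congrArg (fun f => f.hom c) h1

/-- Every point has an affine neighbourhood whose coordinate ring is standard smooth of relative
dimension one over `k`. -/
theorem exists_chart (x : X.toScheme) : ∃ V : X.toScheme.Opens, IsAffineOpen V ∧ x ∈ V ∧
    ∃ ψ : k →+* Γ(X.toScheme, V), ψ.IsStandardSmoothOfRelativeDimension 1 ∧
      ∀ (y : X.toScheme) (hy : y ∈ V) (c : k),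
        (X.toScheme.presheaf.germ V y hy).hom (ψ c) = X.stalkHom y c := by
  obtain ⟨U, hU, V, hV, hxV, e, hsm⟩ :=
    SmoothOfRelativeDimension.exists_isStandardSmoothOfRelativeDimension (n := 1) (f := X.str) x
  have hUtop : U = ⊤ := by
    rw [eq_top_iff]
    intro y _
    have : y = X.str x := Subsingleton.elim _ _
    rw [this]
    exact e hxV
  subst hUtop
  refine ⟨V, hV, hxV, (X.str.appLE ⊤ V e).hom.comp (Scheme.ΓSpecIso (CommRingCat.of k)).inv.hom,
    ?_, fun y hy c => ?_⟩
  · exact (RingHom.isStandardSmoothOfRelativeDimension_respectsIso (n := 1)).2 _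
      ((Scheme.ΓSpecIso (CommRingCat.of k)).symm.commRingCatIsoToRingEquiv) hsm
  · have h1 : (Scheme.ΓSpecIso (CommRingCat.of k)).inv ≫ X.str.appLE ⊤ V e ≫
        X.toScheme.presheaf.germ V y hy = CommRingCat.ofHom (X.stalkHom y) := by
      apply Spec.map_injective
      have h2 := IsAffineOpen.SpecMap_appLE_fromSpec X.str (isAffineOpen_top _) hV e
      rw [IsAffineOpen.fromSpec_top, Scheme.isoSpec_Spec_inv] at h2
      rw [Spec.map_comp, Spec.map_comp, Category.assoc, h2, spec_stalkHom,
        ← hV.fromSpecStalk_eq_fromSpecStalk hy, IsAffineOpen.fromSpecStalk, Category.assoc]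
    exact congrArg (fun f => f.hom c) h1

/-- The same as an algebra over `k`, compatibly with the function field. -/
theorem exists_chart_algebra (x : X.toScheme) : ∃ (V : X.toScheme.Opens) (_ : IsAffineOpen V)
    (hx : x ∈ V) (_ : Nonempty V) (_ : Algebra k Γ(X.toScheme, V)),
      Algebra.IsStandardSmoothOfRelativeDimension 1 k Γ(X.toScheme, V) ∧
      IsScalarTower k Γ(X.toScheme, V) X.FunField ∧
      ∀ c : k, (X.toScheme.presheaf.germ V x hx).hom (algebraMap k _ c) = X.stalkHom x c := by
  obtain ⟨V, hV, hx, ψ, hψ, h⟩ := X.exists_chart x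
  have : Nonempty V := ⟨⟨x, hx⟩⟩
  exact ⟨V, hV, hx, this, ψ.toAlgebra, hψ,
    @IsScalarTower.of_algebraMap_eq _ _ _ _ _ _ ψ.toAlgebra _ _ fun c => (h _ _ c).symm, h x hx⟩

theorem essFiniteType : Algebra.EssFiniteType k X.FunField := by
  obtain ⟨V, hV, hx, hne, _, hsm, htow, -⟩ := X.exists_chart_algebra (genericPoint X.toScheme)
  have := functionField_isFractionRing_of_isAffineOpen X.toScheme V hV
  exact SmoothCurve.essFiniteType k Γ(X.toScheme, V) X.FunField

theorem finrank_kaehlerDifferential : Module.finrank X.FunField Ω[X.FunField⁄k] = 1 := by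
  obtain ⟨V, hV, hx, hne, _, hsm, htow, -⟩ := X.exists_chart_algebra (genericPoint X.toScheme)
  have := functionField_isFractionRing_of_isAffineOpen X.toScheme V hV
  exact SmoothCurve.finrank_kaehlerDifferential k Γ(X.toScheme, V) X.FunField

/-- The local ring at a point that is not generic is a discrete valuation ring. -/
theorem isDiscreteValuationRing_stalk {x : X.toScheme} (hx : x ≠ genericPoint X.toScheme) :
    IsDiscreteValuationRing (X.toScheme.presheaf.stalk x) := by
  obtain ⟨V, hV, hxV, hne, _, hsm, htow, -⟩ := X.exists_chart_algebra x
  have hloc := hV.isLocalization_stalk ⟨x, hxV⟩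
  let _ := TopCat.Presheaf.algebra_section_stalk X.toScheme.presheaf (⟨x, hxV⟩ : V)
  refine SmoothCurve.isDiscreteValuationRing_of_isLocalization k Γ(X.toScheme, V)
    (hV.primeIdealOf ⟨x, hxV⟩).asIdeal (fun h0 => hx ?_) (X.toScheme.presheaf.stalk x)
  have h1 := hV.primeIdealOf_genericPoint
  rw [genericPoint_eq_bot_of_affine] at h1
  have h2 : hV.primeIdealOf ⟨x, hxV⟩ = hV.primeIdealOf ⟨genericPoint X.toScheme,
      ((genericPoint_spec X.toScheme).mem_open_set_iff V.isOpen).mpr (by simpa using hne)⟩ := by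
    rw [h1]
    exact PrimeSpectrum.ext h0
  have h3 := congrArg (fun z => hV.fromSpec z) h2
  simpa only [hV.fromSpec_primeIdealOf] using h3

/-- The generic point is not closed, as the coordinate ring of a chart is not a field. -/
theorem ne_genericPoint (Q : X.Pt) : Q.1 ≠ genericPoint X.toScheme := by
  intro h
  obtain ⟨V, hV, hxV, hne, _, hsm, htow, -⟩ := X.exists_chart_algebra Q.1
  refine SmoothCurve.not_isField k Γ(X.toScheme, V) ?_
  have hmax := hV.primeIdealOf_isMaximal_of_isClosed ⟨Q.1, hxV⟩ Q.2
  have h1 := hV.primeIdealOf_genericPoint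
  rw [genericPoint_eq_bot_of_affine] at h1
  have h2 : (hV.primeIdealOf ⟨Q.1, hxV⟩).asIdeal = ⊥ := by
    have : (⟨Q.1, hxV⟩ : V) = ⟨genericPoint X.toScheme,
      ((genericPoint_spec X.toScheme).mem_open_set_iff V.isOpen).mpr (by simpa using hne)⟩ :=
      Subtype.ext h
    rw [this, h1]
    rfl
  rw [h2] at hmax
  exact Ring.isField_iff_maximal_bot.2 hmax

instance (Q : X.Pt) : IsDiscreteValuationRing (X.localRing Q) :=
  X.isDiscreteValuationRing_stalk (X.ne_genericPoint Q)

theorem finite_resField (Q : X.Pt) : FiniteDimensional k (X.resField Q) := by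
  obtain ⟨V, hV, hxV, hne, _, hsm, htow, hc⟩ := X.exists_chart_algebra Q.1
  have hmax := hV.primeIdealOf_isMaximal_of_isClosed ⟨Q.1, hxV⟩ Q.2
  have hloc := hV.isLocalization_stalk ⟨Q.1, hxV⟩
  let _ := TopCat.Presheaf.algebra_section_stalk X.toScheme.presheaf (⟨Q.1, hxV⟩ : V)
  let m := (hV.primeIdealOf ⟨Q.1, hxV⟩).asIdeal
  let ev : Γ(X.toScheme, V) →ₐ[k] X.resField Q :=
    { toRingHom := (X.toScheme.residue Q.1).hom.comp (X.toScheme.presheaf.germ V Q.1 hxV).hom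
      commutes' := fun c => by
        rw [← X.residue_stalkHom Q c, ← hc]
        rfl }
  have hev : Function.Surjective ev := fun y => by
    obtain ⟨a, ha⟩ := (IsLocalization.AtPrime.equivQuotMaximalIdeal m (X.localRing Q)).surjective y
    obtain ⟨a, rfl⟩ := Ideal.Quotient.mk_surjective a
    exact ⟨a, ha⟩
  have : Algebra.IsStandardSmooth k Γ(X.toScheme, V) :=
    Algebra.IsStandardSmoothOfRelativeDimension.isStandardSmooth 1
  have hft : Algebra.FiniteType k (X.resField Q) := .of_surjective ev hev
  exact finite_of_finite_type_of_isJacobsonRing k (X.resField Q)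

theorem coheight_pt (Q : X.Pt) : Order.coheight Q.1 = 1 := by
  have h1 := ringKrullDim_stalk_eq_coheight Q.1
  rw [IsPrincipalIdealRing.ringKrullDim_eq_one (X.toScheme.presheaf.stalk Q.1)
    (IsDiscreteValuationRing.not_isField _)] at h1
  exact_mod_cast h1.symm

/-- Every point other than the generic point is closed. -/
theorem isClosed_singleton {x : X.toScheme} (hx : x ≠ genericPoint X.toScheme) :
    IsClosed {x} := by
  obtain ⟨y, hy, hyc⟩ := (isClosed_closure (s := {x})).exists_closed_singleton
    (Set.singleton_nonempty x).closure
  have hxy : x ⤳ y := specializes_iff_mem_closure.2 hy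
  suffices x = y by rwa [this]
  by_contra hne
  have h1 : (⟨y, hyc⟩ : X.Pt).1 < x := lt_of_le_not_ge hxy
    fun h => hne (Specializes.antisymm hxy (show y ⤳ x from h)).eq
  have h2 : x < ⊤ := lt_of_le_not_ge le_top fun h => hx
    (Specializes.antisymm (show x ⤳ genericPoint X.toScheme from h)
      ((genericPoint_spec X.toScheme).specializes trivial)).eq
  have h3 := Order.coheight_add_one_le h1
  have h4 := Order.coheight_add_one_le h2
  rw [coheight_pt] at h3
  have h5 : (1 : ℕ∞) ≤ Order.coheight x := le_trans le_add_self h4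
  have h6 : (1 + 1 : ℕ∞) ≤ 1 := le_trans (add_le_add_left h5 1) h3
  exact absurd h6 (by norm_num)

/-- The place of the function field at a closed point. -/
@[reducible] noncomputable def place (Q : X.Pt) : Place k X.FunField :=
  Place.ofDVR (X.localRing Q) (X.resField Q) (X.toScheme.residue Q.1).hom
    (X.toScheme.residue_surjective Q.1)
    fun c => ⟨X.stalkHom Q.1 c, X.algebraMap_stalkHom Q.1 c, X.residue_stalkHom Q c⟩

theorem place_eval_algebraMap (Q : X.Pt) (r : X.localRing Q) :
    (X.place Q).eval (algebraMap (X.localRing Q) X.FunField r) = (X.toScheme.residue Q.1).hom r :=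
  Place.ofDVR_eval _ _

theorem ordAt_eq_ord (f : X.FunField) (Q : X.Pt) : X.ordAt f Q = (X.place Q).ord f := by
  by_cases hf : f = 0
  · subst hf; simp [ordAt]
  rw [ordAt, Scheme.ord_eq_unzero_ordHom (X.coheight_pt Q) hf, Place.ofDVR_ord]
  refine (WithZero.toAdd_unzero_eq_iff _ _).2 ?_
  exact (WithZero.exp_log (show Ring.ordFrac (X.localRing Q) f ≠ 0 by simpa using hf)).symm

/-- The value of a function in the sense of the definition of the pairing is its value at the
place. -/
theorem coe_value {f : X.FunField} (hf0 : f ≠ 0) {Q : X.Pt} (hf : (X.place Q).ord f = 0) :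
    (X.value f Q : X.resField Q) = (X.place Q).eval f := by
  have hex : ∃ u : (X.localRing Q)ˣ, algebraMap (X.localRing Q) X.FunField u = f := by
    obtain ⟨r, hr⟩ := (X.place Q).mem_of_ord_eq_zero hf
    obtain ⟨s, hs⟩ := (X.place Q).mem_of_ord_eq_zero (x := f⁻¹)
      (by rw [Place.ord_inv, hf, neg_zero])
    refine ⟨⟨r, s, ?_, ?_⟩, hr⟩ <;> apply IsFractionRing.injective (X.localRing Q) X.FunField
    · rw [map_mul, map_one]; exact hr.symm ▸ hs.symm ▸ mul_inv_cancel₀ hf0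
    · rw [map_mul, map_one]; exact hr.symm ▸ hs.symm ▸ inv_mul_cancel₀ hf0
  rw [value, dif_pos hex]
  conv_rhs => rw [← hex.choose_spec]
  exact (X.place_eval_algebraMap Q _).symm

end CurvePairing.Curve

/-! ### The places of a curve -/

namespace CurvePairing.Curve

variable {k : Type u} [Field k] (X : Curve k)

/-- The inclusion of the generic point. -/
noncomputable def fromSpecFunField : Spec (CommRingCat.of X.FunField) ⟶ X.toScheme :=
  X.toScheme.fromSpecStalk (genericPoint X.toScheme)

theorem fromSpecFunField_str : X.fromSpecFunField ≫ X.str =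
    Spec.map (CommRingCat.ofHom (algebraMap k X.FunField)) := (X.spec_stalkHom _).symm

theorem spec_algebraMap_fromSpecStalk (x : X.toScheme) :
    Spec.map (CommRingCat.ofHom (algebraMap (X.toScheme.presheaf.stalk x) X.FunField)) ≫
      X.toScheme.fromSpecStalk x = X.fromSpecFunField :=
  Scheme.SpecMap_stalkSpecializes_fromSpecStalk
    ((genericPoint_spec X.toScheme).specializes trivial)

/-- The valuative square of a valuation ring of the function field. -/
noncomputable def valuativeSquare (V : ValuationSubring X.FunField) (ψ : k →+* V)
    (hψ : ∀ c, (ψ c : X.FunField) = algebraMap k X.FunField c) : ValuativeCommSq X.str where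
  R := V
  K := X.FunField
  i₁ := X.fromSpecFunField
  i₂ := Spec.map (CommRingCat.ofHom ψ)
  commSq := ⟨by
    rw [fromSpecFunField_str, ← Spec.map_comp]
    congr 1
    ext c
    exact (hψ c).symm⟩

theorem valuativeCriterion : ValuativeCriterion X.str := by
  have h : IsProper X.str := X.proper
  rw [IsProper.eq_valuativeCriterion] at h
  exact h.1.1.1

/-- The center on the curve of a valuation ring of the function field. -/
theorem exists_center (V : ValuationSubring X.FunField)
    (hV : ∀ c : k, algebraMap k X.FunField c ∈ V) : ∃ x : X.toScheme,
      ∀ r : X.toScheme.presheaf.stalk x,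
        algebraMap (X.toScheme.presheaf.stalk x) X.FunField r ∈ V := by
  let ψ : k →+* V := (algebraMap k X.FunField).codRestrict V.toSubring hV
  obtain ⟨⟨l, hl1, -⟩⟩ :=
    (X.valuativeCriterion.existence (X.valuativeSquare V ψ fun _ => rfl)).exists_lift
  let l' : Spec (CommRingCat.of V) ⟶ X.toScheme := l
  have hl : Spec.map (CommRingCat.ofHom (algebraMap V X.FunField)) ≫ l' = X.fromSpecFunField := hl1
  let x := l' (IsLocalRing.closedPoint V)
  refine ⟨x, fun r => ?_⟩
  have h1 : Spec.map (Scheme.stalkClosedPointTo l') ≫ X.toScheme.fromSpecStalk x = l' :=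
    Scheme.Spec_stalkClosedPointTo_fromSpecStalk l'
  have h2 : Scheme.stalkClosedPointTo l' ≫ CommRingCat.ofHom (algebraMap V X.FunField) =
      CommRingCat.ofHom (algebraMap (X.toScheme.presheaf.stalk x) X.FunField) := by
    apply Spec.map_injective
    rw [← cancel_mono (X.toScheme.fromSpecStalk x), Spec.map_comp, Category.assoc, h1, hl,
      spec_algebraMap_fromSpecStalk]
  have h3 : ((Scheme.stalkClosedPointTo l').hom r : X.FunField) =
      algebraMap (X.toScheme.presheaf.stalk x) X.FunField r := congrArg (fun f => f.hom r) h2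
  rw [← h3]
  exact Subtype.prop _

/-- Every nontrivial valuation ring of the function field over `k` is the local ring at its
center. -/
theorem exists_place_eq (V : ValuationSubring X.FunField)
    (hV : ∀ c : k, algebraMap k X.FunField c ∈ V) (hVtop : V ≠ ⊤) :
    ∃ Q : X.Pt, (X.place Q).ring = V := by
  obtain ⟨x, hx⟩ := X.exists_center V hV
  by_cases hxg : x = genericPoint X.toScheme
  · subst hxg
    refine absurd (eq_top_iff.2 fun f _ => ?_) hVtop
    have h1 := congrArg (fun g => g.hom f)
      (TopCat.Presheaf.stalkSpecializes_refl X.toScheme.presheaf (genericPoint X.toScheme))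
    exact (congrArg (· ∈ V) h1).mp (hx f)
  · refine ⟨⟨x, X.isClosed_singleton hxg⟩, (X.place _).eq_of_ring_le ?_ hVtop⟩
    rintro _ ⟨r, rfl⟩
    exact hx r

/-- A closed point solves the valuative lifting problem of its local ring. -/
theorem exists_lift_of_place_eq (Q : X.Pt) (V : ValuationSubring X.FunField)
    (hQ : (X.place Q).ring = V) (ψ : k →+* V)
    (hψ : ∀ c, (ψ c : X.FunField) = algebraMap k X.FunField c) :
    ∃ l : Spec (CommRingCat.of V) ⟶ X.toScheme,
      Spec.map (CommRingCat.ofHom (algebraMap V X.FunField)) ≫ l = X.fromSpecFunField ∧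
      l ≫ X.str = Spec.map (CommRingCat.ofHom ψ) ∧ l (IsLocalRing.closedPoint V) = Q.1 := by
  subst hQ
  let e := Place.rangeRingEquiv (K := X.FunField) (X.localRing Q)
  let φ : X.toScheme.presheaf.stalk Q.1 ⟶ CommRingCat.of (X.place Q).ring :=
    CommRingCat.ofHom e.toRingHom
  have hφ : IsLocalHom φ.hom := ⟨fun a ha =>
    (MulEquiv.isUnit_map e).1 ha⟩
  refine ⟨Spec.map φ ≫ X.toScheme.fromSpecStalk Q.1, ?_, ?_, ?_⟩
  · rw [← Category.assoc, ← Spec.map_comp, ← X.spec_algebraMap_fromSpecStalk Q.1]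
    rfl
  · rw [Category.assoc, ← spec_stalkHom, ← Spec.map_comp]
    congr 1
    ext c
    exact (X.algebraMap_stalkHom Q.1 c).trans (hψ c).symm
  · change (X.toScheme.fromSpecStalk Q.1) (Spec.map φ _) = _
    refine Eq.trans (congrArg _ ?_) Scheme.fromSpecStalk_closedPoint
    exact IsLocalRing.comap_closedPoint φ.hom

/-- The uniqueness part of the valuative criterion: a closed point is determined by its local
ring. -/
theorem place_injective : Function.Injective fun Q : X.Pt => (X.place Q).ring := by
  intro Q Q' h
  let ψ : k →+* (X.place Q).ring := (algebraMap k X.FunField).codRestrict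
    (X.place Q).ring.toSubring (X.place Q).algebraMap_mem
  obtain ⟨l, h1, h2, h3⟩ := X.exists_lift_of_place_eq Q _ rfl ψ fun _ => rfl
  obtain ⟨l', h1', h2', h3'⟩ := X.exists_lift_of_place_eq Q' _ h.symm ψ fun _ => rfl
  have huniq := X.valuativeCriterion.uniqueness (X.valuativeSquare (X.place Q).ring ψ fun _ => rfl)
  have h4 := congrArg CommSq.LiftStruct.l (huniq.elim ⟨l, h1, h2⟩ ⟨l', h1', h2'⟩)
  have h5 : l = l' := h4
  exact Subtype.ext (by rw [← h3, ← h3', h5])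

/-- The closed points of a curve are the places of its function field. -/
theorem isComplete_place : Place.IsComplete X.place where
  inj := X.place_injective
  complete := X.exists_place_eq
  finite_residue := X.finite_resField
  finite_support f := by
    refine (X.finite_ordAt f).subset fun Q hQ => ?_
    rw [Function.mem_support, ordAt_eq_ord]
    exact hQ

end CurvePairing.Curve

/-! ### The extension of function fields of a finite morphism -/

namespace CurvePairing

variable {k : Type u} [Field k] {X Y : Curve k} (φ : X.toScheme ⟶ Y.toScheme)

theorem Curve.exists_pt (X : Curve k) : Nonempty X.Pt := by
  obtain ⟨y, -, hy⟩ := (isClosed_univ (X := X.toScheme)).exists_closed_singleton Set.univ_nonempty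
  exact ⟨⟨y, hy⟩⟩

/-- A curve is normal. -/
theorem Curve.isIntegrallyClosed_stalk (X : Curve k) (x : X.toScheme) :
    IsIntegrallyClosed (X.toScheme.presheaf.stalk x) := by
  by_cases hx : x = genericPoint X.toScheme
  · subst hx
    exact inferInstanceAs (IsIntegrallyClosed X.FunField)
  · have := X.isDiscreteValuationRing_stalk hx
    infer_instance

/-- In a finite morphism, the generic point and a closed point have different images: a finite
algebra has no inclusions between different primes over the same prime. -/
theorem map_genericPoint_ne [IsFinite φ] (P : X.Pt) : φ (genericPoint X.toScheme) ≠ φ P.1 := by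
  intro h
  obtain ⟨_, ⟨V : Y.toScheme.Opens, hV, rfl⟩, hxV, -⟩ :=
    Y.toScheme.isBasis_affineOpens.exists_subset_of_mem_open (Set.mem_univ (φ P.1)) isOpen_univ
  have hW : IsAffineOpen (φ ⁻¹ᵁ V) := hV.preimage φ
  have hP : P.1 ∈ φ ⁻¹ᵁ V := hxV
  have hη : genericPoint X.toScheme ∈ φ ⁻¹ᵁ V := show φ _ ∈ V from h ▸ hxV
  have hne : Nonempty (φ ⁻¹ᵁ V) := ⟨⟨_, hP⟩⟩
  have hfin : (φ.appLE V (φ ⁻¹ᵁ V) le_rfl).hom.Finite := by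
    rw [← Scheme.Hom.app_eq_appLE]
    exact IsFinite.finite_app φ V hV
  let _ : Algebra Γ(Y.toScheme, V) Γ(X.toScheme, φ ⁻¹ᵁ V) :=
    (φ.appLE V (φ ⁻¹ᵁ V) le_rfl).hom.toAlgebra
  have hfin' : Module.Finite Γ(Y.toScheme, V) Γ(X.toScheme, φ ⁻¹ᵁ V) := hfin
  have h1 := IsAffineOpen.comap_primeIdealOf_appLE V hV (φ ⁻¹ᵁ V) hW le_rfl hP
  have h2 := IsAffineOpen.comap_primeIdealOf_appLE V hV (φ ⁻¹ᵁ V) hW le_rfl hη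
  have h3 : hV.primeIdealOf ⟨φ (genericPoint X.toScheme), hη⟩ = hV.primeIdealOf ⟨φ P.1, hP⟩ := by
    congr 1
    exact Subtype.ext h
  rw [h3, ← h1] at h2
  have hbot := hW.primeIdealOf_genericPoint
  rw [genericPoint_eq_bot_of_affine] at hbot
  have hne' : hW.primeIdealOf ⟨P.1, hP⟩ ≠ hW.primeIdealOf ⟨genericPoint X.toScheme, hη⟩ := by
    intro h4
    have h5 := congrArg (fun z => hW.fromSpec z) h4
    simp only [hW.fromSpec_primeIdealOf] at h5
    exact X.ne_genericPoint P h5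
  have hlt : (hW.primeIdealOf ⟨genericPoint X.toScheme, hη⟩).asIdeal <
      (hW.primeIdealOf ⟨P.1, hP⟩).asIdeal := by
    refine lt_of_le_of_ne ?_ fun h6 => hne' (PrimeSpectrum.ext h6).symm
    rw [hbot]
    exact bot_le
  have h7 := Ideal.IsIntegral.comap_lt_comap (R := Γ(Y.toScheme, V)) hlt
  exact h7.ne (congrArg PrimeSpectrum.asIdeal h2)

/-- Otherwise the image of the generic point would be a closed point, hence the only point of the
image. -/
theorem map_genericPoint [IsFinite φ] :
    φ (genericPoint X.toScheme) = genericPoint Y.toScheme := by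
  by_contra h
  have hcl := Y.isClosed_singleton h
  obtain ⟨P⟩ := X.exists_pt
  have h1 : φ (genericPoint X.toScheme) ⤳ φ P.1 :=
    ((genericPoint_spec X.toScheme).specializes trivial).map φ.continuous
  exact map_genericPoint_ne φ P (h1.mem_closed hcl rfl).symm

/-- An embedding of the function field of `Y` in that of `X` is the pull-back of functions along
`φ` if it is compatible with the maps of local rings. -/
class IsPullback [Algebra Y.FunField X.FunField] : Prop where
  compat : ∀ (x : X.toScheme) (r : Y.toScheme.presheaf.stalk (φ x)),
    algebraMap Y.FunField X.FunField (algebraMap (Y.toScheme.presheaf.stalk (φ x)) Y.FunField r) =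
      algebraMap (X.toScheme.presheaf.stalk x) X.FunField ((φ.stalkMap x).hom r)

theorem exists_isPullback [IsFinite φ] :
    ∃ _ : Algebra Y.FunField X.FunField, IsPullback φ := by
  have hs : φ (genericPoint X.toScheme) ⤳ genericPoint Y.toScheme :=
    (map_genericPoint φ) ▸ specializes_rfl
  let ι := Y.toScheme.presheaf.stalkSpecializes hs ≫ φ.stalkMap (genericPoint X.toScheme)
  refine ⟨ι.hom.toAlgebra, @IsPullback.mk _ _ _ _ _ (_) fun x r => ?_⟩
  have hx : genericPoint X.toScheme ⤳ x := (genericPoint_spec X.toScheme).specializes trivial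
  have hy : genericPoint Y.toScheme ⤳ φ x := (genericPoint_spec Y.toScheme).specializes trivial
  have h1 : Y.toScheme.presheaf.stalkSpecializes hy ≫ ι =
      φ.stalkMap x ≫ X.toScheme.presheaf.stalkSpecializes hx := by
    rw [← Scheme.Hom.stalkSpecializes_stalkMap, ← Category.assoc,
      TopCat.Presheaf.stalkSpecializes_comp]
  exact congrArg (fun f => f.hom r) h1

variable [Algebra Y.FunField X.FunField]

theorem isScalarTower (hφ : φ ≫ Y.str = X.str) [IsPullback φ] :
    IsScalarTower k Y.FunField X.FunField := by
  refine .of_algebraMap_eq fun c => ?_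
  let x := genericPoint X.toScheme
  have h1 : CommRingCat.ofHom (Y.stalkHom (φ x)) ≫ φ.stalkMap x =
      CommRingCat.ofHom (X.stalkHom x) := by
    apply Spec.map_injective
    rw [Spec.map_comp, Curve.spec_stalkHom, Curve.spec_stalkHom,
      Scheme.SpecMap_stalkMap_fromSpecStalk_assoc, hφ]
  have h2 : (φ.stalkMap x).hom (Y.stalkHom (φ x) c) = X.stalkHom x c :=
    congrArg (fun f => f.hom c) h1
  rw [← Y.algebraMap_stalkHom (φ x), IsPullback.compat, h2, X.algebraMap_stalkHom]

/-- The coordinate ring of the inverse image of an affine open subset, as a finite integrally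
closed algebra. -/
theorem exists_affine [IsFinite φ] [IsPullback φ] (y : Y.toScheme) :
    ∃ (V : Y.toScheme.Opens) (_ : IsAffineOpen V) (_ : y ∈ V) (_ : Nonempty V)
      (C : Type u) (_ : CommRing C) (_ : IsDomain C) (_ : Algebra Γ(Y.toScheme, V) C)
      (_ : Algebra C X.FunField) (_ : Algebra Γ(Y.toScheme, V) X.FunField),
      Module.Finite Γ(Y.toScheme, V) C ∧ IsScalarTower Γ(Y.toScheme, V) C X.FunField ∧
      IsScalarTower Γ(Y.toScheme, V) Y.FunField X.FunField ∧ IsFractionRing C X.FunField ∧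
      IsIntegrallyClosed C := by
  obtain ⟨_, ⟨V : Y.toScheme.Opens, hV, rfl⟩, hxV, -⟩ :=
    Y.toScheme.isBasis_affineOpens.exists_subset_of_mem_open (Set.mem_univ y) isOpen_univ
  have hW : IsAffineOpen (φ ⁻¹ᵁ V) := hV.preimage φ
  have hneV : Nonempty V := ⟨⟨_, hxV⟩⟩
  have hηY : genericPoint Y.toScheme ∈ V :=
    ((genericPoint_spec Y.toScheme).mem_open_set_iff V.isOpen).mpr (by simpa using hneV)
  have hη : genericPoint X.toScheme ∈ φ ⁻¹ᵁ V := show φ _ ∈ V from (map_genericPoint φ) ▸ hηY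
  have hne : Nonempty (φ ⁻¹ᵁ V) := ⟨⟨_, hη⟩⟩
  have hfin : (φ.app V).hom.Finite := IsFinite.finite_app φ V hV
  let _ : Algebra Γ(Y.toScheme, V) Γ(X.toScheme, φ ⁻¹ᵁ V) := (φ.app V).hom.toAlgebra
  let _ : Algebra Γ(Y.toScheme, V) X.FunField :=
    ((algebraMap Γ(X.toScheme, φ ⁻¹ᵁ V) X.FunField).comp (φ.app V).hom).toAlgebra
  have hfrac := functionField_isFractionRing_of_isAffineOpen X.toScheme _ hW
  refine ⟨V, hV, hxV, hneV, Γ(X.toScheme, φ ⁻¹ᵁ V), inferInstance, inferInstance, inferInstance,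
    inferInstance, inferInstance, hfin, .of_algebraMap_eq fun _ => rfl,
    .of_algebraMap_eq fun a => ?_, hfrac, ?_⟩
  · have h1 := IsPullback.compat (φ := φ) (genericPoint X.toScheme)
      (Y.toScheme.presheaf.germ V _ hη a)
    have h2 : (φ.stalkMap (genericPoint X.toScheme)).hom (Y.toScheme.presheaf.germ V _ hη a) =
        X.toScheme.presheaf.germ (φ ⁻¹ᵁ V) _ hη (φ.app V a) :=
      congrArg (fun f => f.hom a) (Scheme.Hom.germ_stalkMap φ V _ hη)
    rw [h2] at h1
    have h3 := Scheme.algebraMap_germ_eq_germToFunctionField (X := Y.toScheme) (U := V) hη a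
    have h4 := Scheme.algebraMap_germ_eq_germToFunctionField (X := X.toScheme) (U := φ ⁻¹ᵁ V) hη
      (φ.app V a)
    exact h4.symm.trans (h1.symm.trans (congrArg (algebraMap Y.FunField X.FunField) h3))
  · refine IsIntegrallyClosed.of_localization_maximal fun p hp hpm => ?_
    let z : PrimeSpectrum Γ(X.toScheme, φ ⁻¹ᵁ V) := ⟨p, hpm.isPrime⟩
    have hz : hW.fromSpec z ∈ φ ⁻¹ᵁ V := by
      have : hW.fromSpec z ∈ Set.range hW.fromSpec := ⟨z, rfl⟩
      rwa [hW.range_fromSpec] at this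
    let _ := X.toScheme.presheaf.algebra_section_stalk ⟨_, hz⟩
    have hloc : IsLocalization.AtPrime (X.toScheme.presheaf.stalk (hW.fromSpec z)) p :=
      hW.isLocalization_stalk' z hz
    have := X.isIntegrallyClosed_stalk (hW.fromSpec z)
    exact IsIntegrallyClosed.of_equiv (IsLocalization.algEquiv p.primeCompl
      (X.toScheme.presheaf.stalk (hW.fromSpec z)) (Localization.AtPrime p)).toRingEquiv

end CurvePairing

/-! ### The places over a closed point -/

/-- If the integral closure of `A` in `K` is a finite module `C`, the same is true for any
localization of `A` which is noetherian. -/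
theorem Module.finite_integralClosure_of_isLocalization {A C : Type*} (R K : Type*) [CommRing A]
    [CommRing C] [CommRing R] [Field K] [Algebra A C] [Algebra A R] [Algebra A K] [Algebra C K]
    [Algebra R K] [IsScalarTower A R K] [IsScalarTower A C K] (M : Submonoid A)
    [IsLocalization M R] [IsNoetherianRing R] [Module.Finite A C] [IsDomain C]
    [IsFractionRing C K] [IsIntegrallyClosed C] : Module.Finite R (integralClosure R K) := by
  obtain ⟨s, hs⟩ := Module.Finite.fg_top (R := A) (M := C)
  let N : Submodule R K := Submodule.span R (algebraMap C K '' s)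
  have hN : N.FG := Submodule.fg_span (s.finite_toSet.image _)
  have hC : ∀ c : C, algebraMap C K c ∈ N := by
    intro c
    have hc : c ∈ Submodule.span A (s : Set C) := hs ▸ Submodule.mem_top
    induction hc using Submodule.span_induction with
    | mem x hx => exact Submodule.subset_span ⟨x, hx, rfl⟩
    | zero => simp
    | add x y _ _ hx hy => rw [map_add]; exact N.add_mem hx hy
    | smul a x _ hx =>
      rw [Algebra.smul_def, map_mul, ← IsScalarTower.algebraMap_apply,
        IsScalarTower.algebraMap_apply A R K, ← Algebra.smul_def]
      exact N.smul_mem _ hx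
  have hle : Subalgebra.toSubmodule (integralClosure R K) ≤ N := by
    intro y hy
    obtain ⟨m, hm⟩ := IsIntegral.exists_multiple_integral_of_isLocalization M y hy
    obtain ⟨c, hc⟩ := IsIntegrallyClosed.isIntegral_iff.1 (hm.tower_top (A := C))
    have hmy : (m : A) • y ∈ N := by
      rw [show (m : A) • y = algebraMap C K c from hc.symm]
      exact hC c
    rw [← IsScalarTower.algebraMap_smul R] at hmy
    obtain ⟨u, hu⟩ := IsLocalization.map_units R m
    have := N.smul_mem (↑u⁻¹ : R) hmy
    rwa [← hu, smul_smul, Units.inv_mul, one_smul] at this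
  have : IsNoetherian R N := isNoetherian_of_fg_of_noetherian N hN
  exact Module.Finite.of_injective (Submodule.inclusion hle) (Submodule.inclusion_injective hle)

namespace CurvePairing

variable {k : Type u} [Field k] {X Y : Curve k} (φ : X.toScheme ⟶ Y.toScheme) [IsFinite φ]
  [Algebra Y.FunField X.FunField] [IsPullback φ]

include φ in
theorem isAlgebraic_funField : Algebra.IsAlgebraic Y.FunField X.FunField := by
  obtain ⟨V, hV, hy, hne, C, _, _, _, _, _, hfin, hACK, hAFK, hfrac, -⟩ :=
    exists_affine φ (genericPoint Y.toScheme)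
  have hfr := functionField_isFractionRing_of_isAffineOpen Y.toScheme _ hV
  refine ⟨fun z => ?_⟩
  obtain ⟨a, b, hb, rfl⟩ := IsFractionRing.div_surjective (A := C) z
  have hc : ∀ c : C, IsIntegral Y.FunField (algebraMap C X.FunField c) := fun c =>
    ((Algebra.IsIntegral.isIntegral (R := Γ(Y.toScheme, V)) c).algebraMap
      (B := X.FunField)).tower_top
  rw [div_eq_mul_inv]
  exact ((hc a).isAlgebraic).mul ((hc b).isAlgebraic).inv

theorem finiteDimensional_funField (hφ : φ ≫ Y.str = X.str) :
    FiniteDimensional Y.FunField X.FunField := by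
  have := isScalarTower φ hφ
  have := X.essFiniteType
  have : Algebra.EssFiniteType Y.FunField X.FunField := Algebra.EssFiniteType.of_comp k _ _
  have := isAlgebraic_funField φ
  exact Algebra.finite_of_essFiniteType_of_isAlgebraic

/-- The local ring at `P` contains the local ring at `φ P`, which is a maximal subring of the
function field of `Y`. -/
theorem over_mapPt (P : X.Pt) : (X.place P).Over (Y.place (mapPt φ P)) := by
  have := isAlgebraic_funField φ
  refine (Place.eq_of_ring_le (P := Y.place (mapPt φ P)) ?_ fun htop => ?_).symm
  · rintro _ ⟨r, rfl⟩
    exact ⟨(φ.stalkMap P.1).hom r, (IsPullback.compat P.1 r).symm⟩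
  · refine (X.place P).ring_ne_top (eq_top_iff.2 fun z _ => ?_)
    let g : Y.FunField →+* (X.place P).ring :=
      (algebraMap Y.FunField X.FunField).codRestrict (X.place P).ring.toSubring fun x =>
        show x ∈ (X.place P).ring.comap (algebraMap Y.FunField X.FunField) from
          htop ▸ ValuationSubring.mem_top x
    obtain ⟨p, hp, hpz⟩ := Algebra.IsIntegral.isIntegral (R := Y.FunField) z
    have hz : IsIntegral (X.place P).ring z :=
      ⟨p.map g, hp.map g, by rw [Polynomial.eval₂_map]; exact hpz⟩
    obtain ⟨w, rfl⟩ := IsIntegrallyClosed.isIntegral_iff.1 hz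
    exact w.2

theorem over_iff (P : X.Pt) (Q : Y.Pt) : (X.place P).Over (Y.place Q) ↔ mapPt φ P = Q := by
  refine ⟨fun h => Y.place_injective ?_, fun h => h ▸ over_mapPt φ P⟩
  exact (over_mapPt φ P).symm.trans h

include φ in
/-- The local rings of `Y` are localizations of coordinate rings of affine open subsets, over
which `X` is finite and normal. -/
theorem finite_integralClosure (Q : Y.Pt) :
    Module.Finite (Y.place Q).ring (integralClosure (Y.place Q).ring X.FunField) := by
  obtain ⟨V, hV, hy, hne, C, _, _, _, _, _, hfin, hACK, hAFK, hfrac, hic⟩ := exists_affine φ Q.1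
  let _ := TopCat.Presheaf.algebra_section_stalk Y.toScheme.presheaf (⟨Q.1, hy⟩ : V)
  have hloc := hV.isLocalization_stalk ⟨Q.1, hy⟩
  let e : Y.localRing Q ≃+* (Y.place Q).ring := Place.rangeRingEquiv (K := Y.FunField) _
  let _ : Algebra Γ(Y.toScheme, V) (Y.place Q).ring :=
    (e.toRingHom.comp (algebraMap Γ(Y.toScheme, V) (Y.localRing Q))).toAlgebra
  let e' : Y.localRing Q ≃ₐ[Γ(Y.toScheme, V)] (Y.place Q).ring :=
    AlgEquiv.ofRingEquiv (f := e) fun _ => rfl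
  have := IsLocalization.isLocalization_of_algEquiv
    (hV.primeIdealOf ⟨Q.1, hy⟩).asIdeal.primeCompl e'
  have : IsScalarTower Γ(Y.toScheme, V) (Y.place Q).ring X.FunField := by
    refine .of_algebraMap_eq fun a => ?_
    rw [IsScalarTower.algebraMap_apply _ Y.FunField X.FunField]
    exact congrArg (algebraMap Y.FunField X.FunField)
      (Scheme.algebraMap_germ_eq_germToFunctionField (X := Y.toScheme) hy a).symm
  exact Module.finite_integralClosure_of_isLocalization (C := C) _ X.FunField
    (hV.primeIdealOf ⟨Q.1, hy⟩).asIdeal.primeCompl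

end CurvePairing

/-! ### Ramification indices and residue degrees -/

/-- The ramification index of an extension of discrete valuation rings is the order of a
uniformizer. -/
theorem Ideal.ramificationIdx_maximalIdeal_of_isDiscreteValuationRing {R S : Type*} [CommRing R]
    [IsDomain R] [IsDiscreteValuationRing R] [CommRing S] [IsDomain S] [IsDiscreteValuationRing S]
    [Algebra R S] [IsLocalHom (algebraMap R S)] [Module.IsTorsionFree R S] {ϖ : R} {π : S}
    (hϖ : Irreducible ϖ) (hπ : Irreducible π) {n : ℕ}
    (h : Associated (algebraMap R S ϖ) (π ^ n)) :
    (IsLocalRing.maximalIdeal S).ramificationIdx R = n := by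
  have hp := hϖ.maximalIdeal_eq
  have hq := hπ.maximalIdeal_eq
  have hover : (IsLocalRing.maximalIdeal S).LiesOver (IsLocalRing.maximalIdeal R) :=
    ⟨(IsLocalRing.maximalIdeal_comap (algebraMap R S)).symm⟩
  have hne := Ideal.map_ne_bot_of_ne_bot (S := S) (IsDiscreteValuationRing.not_a_field R)
  rw [IsDedekindDomain.ramificationIdx_eq_multiplicity (IsLocalRing.maximalIdeal R) _ hne,
    hp, Ideal.map_span, Set.image_singleton,
    Ideal.span_singleton_eq_span_singleton.2 h, ← Ideal.span_singleton_pow, ← hq]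
  refine multiplicity_pow_self (IsDiscreteValuationRing.not_a_field S) ?_ n
  rw [Ideal.isUnit_iff]
  exact Ideal.IsMaximal.ne_top inferInstance

namespace CurvePairing

variable {k : Type u} [Field k] {X Y : Curve k} (φ : X.toScheme ⟶ Y.toScheme) [IsFinite φ]
  [Algebra Y.FunField X.FunField] [IsPullback φ]

omit [IsFinite φ] [Algebra Y.FunField X.FunField] [IsPullback φ] in
theorem Curve.place_ord_of_irreducible (Q : X.Pt) {π : X.localRing Q} (hπ : Irreducible π) :
    (X.place Q).ord (algebraMap (X.localRing Q) X.FunField π) = 1 := by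
  rw [Place.ofDVR_ord, Ring.ordFrac_irreducible hπ, WithZero.log_exp]

omit [IsFinite φ] [Algebra Y.FunField X.FunField] [IsPullback φ] in
theorem Curve.place_ord_unit (Q : X.Pt) (u : (X.localRing Q)ˣ) :
    (X.place Q).ord (algebraMap (X.localRing Q) X.FunField u) = 0 := by
  have h1 : ∀ u : X.localRing Q, 0 ≤ (X.place Q).ord (algebraMap (X.localRing Q) X.FunField u) :=
    fun u => (X.place Q).ord_nonneg_of_mem ⟨u, rfl⟩
  have h2 := h1 u
  have h3 := h1 ↑u⁻¹
  have h4 := (X.place Q).ord_inv (algebraMap (X.localRing Q) X.FunField u)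
  have h5 : algebraMap (X.localRing Q) X.FunField ↑u⁻¹ =
      (algebraMap (X.localRing Q) X.FunField u)⁻¹ :=
    eq_inv_of_mul_eq_one_left (by rw [← map_mul, Units.inv_mul, map_one])
  rw [← h5] at h4
  omega

theorem resMap_over_mapPt (P : X.Pt) (h : (X.place P).Over (Y.place (mapPt φ P))) :
    h.resMap = (φ.residueFieldMap P.1).hom := by
  ext x
  obtain ⟨r, rfl⟩ := Y.toScheme.residue_surjective (φ P.1) x
  have h1 : algebraMap (Y.localRing (mapPt φ P)) Y.FunField r ∈ (Y.place (mapPt φ P)).ring :=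
    ⟨r, rfl⟩
  have h2 := h.resMap_eval h1
  have h3 := X.place_eval_algebraMap P ((φ.stalkMap P.1).hom r)
  rw [← IsPullback.compat] at h3
  have h4 := Y.place_eval_algebraMap (mapPt φ P) r
  exact (congrArg h.resMap h4.symm).trans (h2.trans <| h3.trans
    (congrArg (fun f => f.hom r) (Scheme.residue_residueFieldMap φ P.1)).symm)

theorem inertiaDeg_over_mapPt (P : X.Pt) (h : (X.place P).Over (Y.place (mapPt φ P))) :
    h.inertiaDeg = φ.residueDegree P.1 := by
  rw [Place.Over.inertiaDeg, resMap_over_mapPt φ P h]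
  rfl

theorem ramIdx_eq_ram (P : X.Pt) : (X.place P).ramIdx (Y.place (mapPt φ P)) = ram φ P := by
  have h := over_mapPt φ P
  set A := Y.place (mapPt φ P)
  have hdvrY : IsDiscreteValuationRing (Y.toScheme.presheaf.stalk (φ P.1)) :=
    inferInstanceAs (IsDiscreteValuationRing (Y.localRing (mapPt φ P)))
  obtain ⟨ϖ, hϖ⟩ := IsDiscreteValuationRing.exists_irreducible (Y.toScheme.presheaf.stalk (φ P.1))
  obtain ⟨π, hπ⟩ := IsDiscreteValuationRing.exists_irreducible (X.localRing P)
  let _ := (φ.stalkMap P.1).hom.toAlgebra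
  have hloc : IsLocalHom (algebraMap (Y.toScheme.presheaf.stalk (φ P.1)) (X.localRing P)) :=
    inferInstanceAs (IsLocalHom (φ.stalkMap P.1).hom)
  have hcompat : ∀ r, algebraMap Y.FunField X.FunField
      (algebraMap (Y.toScheme.presheaf.stalk (φ P.1)) Y.FunField r) =
        algebraMap (X.localRing P) X.FunField (algebraMap _ (X.localRing P) r) :=
    IsPullback.compat P.1
  have hinj : Function.Injective
      (algebraMap (Y.toScheme.presheaf.stalk (φ P.1)) (X.localRing P)) := by
    intro a b hab
    have := congrArg (algebraMap (X.localRing P) X.FunField) hab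
    rw [← hcompat, ← hcompat] at this
    exact IsFractionRing.injective _ _ ((algebraMap Y.FunField X.FunField).injective this)
  have htf : Module.IsTorsionFree (Y.toScheme.presheaf.stalk (φ P.1)) (X.localRing P) :=
    Module.isTorsionFree_iff_algebraMap_injective.2 hinj
  refine (Ideal.ramificationIdx_maximalIdeal_of_isDiscreteValuationRing hϖ hπ ?_).symm
  obtain ⟨n, u, hu⟩ := IsDiscreteValuationRing.associated_pow_irreducible
    ((map_ne_zero_iff _ hinj).2 hϖ.ne_zero) hπ
  have h1 : A.ord (algebraMap (Y.toScheme.presheaf.stalk (φ P.1)) Y.FunField ϖ) = 1 :=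
    Y.place_ord_of_irreducible (mapPt φ P) hϖ
  have h2 := h.ord_algebraMap (algebraMap (Y.toScheme.presheaf.stalk (φ P.1)) Y.FunField ϖ)
  have h3 := congrArg (fun z => (X.place P).ord (algebraMap (X.localRing P) X.FunField z)) hu
  simp only [map_mul, map_pow] at h3
  have hπ0 : algebraMap (X.localRing P) X.FunField π ≠ 0 := by simpa using hπ.ne_zero
  rw [Place.ord_mul, X.place_ord_unit, Place.ord_pow, X.place_ord_of_irreducible P hπ,
    ← hcompat, h2, h1] at h3
  · have h4 : (X.place P).ramIdx A = n := by
      have : ((X.place P).ramIdx A : ℤ) = n := by linarith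
      exact_mod_cast this
    rw [h4]
    exact ⟨u, hu⟩
  · rw [← hcompat]
    simpa using hϖ.ne_zero
  · simp

end CurvePairing

/-! ### Push-forward and pull-back of divisors -/

namespace CurvePairing

variable {k : Type u} [Field k] {X Y : Curve k}

@[simp] theorem Curve.divisor_apply (f : X.FunField) (Q : X.Pt) :
    X.divisor f Q = (X.place Q).ord f := X.ordAt_eq_ord f Q

theorem Curve.deg_apply (D : X.Div) :
    X.deg D = D.sum fun Q e => e * (Module.finrank k (X.resField Q) : ℤ) := rfl

section

variable (φ : X.toScheme ⟶ Y.toScheme) [IsFinite φ]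

theorem mem_fiber {P : X.Pt} {Q : Y.Pt} : P ∈ (finite_fiber φ Q).toFinset ↔ mapPt φ P = Q :=
  Set.Finite.mem_toFinset _

@[simp] theorem pushDiv_single (P : X.Pt) (d : ℤ) :
    pushDiv φ (Finsupp.single P d) = Finsupp.single (mapPt φ P) (d * φ.residueDegree P.1) := by
  simp [pushDiv]

theorem map_pullDiv {M : Type*} [AddCommGroup M] (L : X.Div →+ M) (E : Y.Div) :
    L (pullDiv φ E) = E.sum fun Q e =>
      ∑ P ∈ (finite_fiber φ Q).toFinset, L (Finsupp.single P (e * ram φ P)) := by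
  simp [pullDiv, Finsupp.liftAddHom_apply, map_finsuppSum]

theorem pushDiv_apply (D : X.Div) (Q : Y.Pt) :
    pushDiv φ D Q = ∑ P ∈ (finite_fiber φ Q).toFinset, D P * φ.residueDegree P.1 := by
  classical
  induction D using Finsupp.induction_linear with
  | zero => simp
  | add D E hD hE => simp [hD, hE, add_mul, Finset.sum_add_distrib]
  | single P d =>
    rw [pushDiv_single, Finsupp.single_apply]
    simp only [Finsupp.single_apply, ite_mul, zero_mul, Finset.sum_ite_eq, mem_fiber]

theorem pullDiv_apply (E : Y.Div) (P : X.Pt) : pullDiv φ E P = E (mapPt φ P) * ram φ P := by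
  classical
  have h := map_pullDiv φ (Finsupp.applyAddHom P) E
  simp only [Finsupp.applyAddHom_apply, Finsupp.single_apply, Finset.sum_ite_eq', mem_fiber] at h
  rw [h, Finsupp.sum, Finset.sum_ite_eq]
  split_ifs with hE
  · rfl
  · rw [Finsupp.notMem_support_iff.1 hE, zero_mul]

variable [Algebra Y.FunField X.FunField] [IsPullback φ]

theorem prod_fiber {M : Type*} [CommMonoid M] (Q : Y.Pt)
    [Fintype {P // (X.place P).Over (Y.place Q)}] (f : X.Pt → M) :
    ∏ P ∈ (finite_fiber φ Q).toFinset, f P =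
      ∏ P : {P // (X.place P).Over (Y.place Q)}, f P :=
  Finset.prod_subtype _ (fun P => by rw [mem_fiber, over_iff φ]) f

theorem sum_fiber {M : Type*} [AddCommMonoid M] (Q : Y.Pt)
    [Fintype {P // (X.place P).Over (Y.place Q)}] (f : X.Pt → M) :
    ∑ P ∈ (finite_fiber φ Q).toFinset, f P =
      ∑ P : {P // (X.place P).Over (Y.place Q)}, f P :=
  Finset.sum_subtype _ (fun P => by rw [mem_fiber, over_iff φ]) f

theorem inertiaDeg_eq {P : X.Pt} {Q : Y.Pt} (h : (X.place P).Over (Y.place Q)) :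
    h.inertiaDeg = φ.residueDegree P.1 := by
  obtain rfl := (over_iff φ P Q).1 h
  exact inertiaDeg_over_mapPt φ P h

theorem ramIdx_eq {P : X.Pt} {Q : Y.Pt} (h : (X.place P).Over (Y.place Q)) :
    (X.place P).ramIdx (Y.place Q) = ram φ P := by
  obtain rfl := (over_iff φ P Q).1 h
  exact ramIdx_eq_ram φ P

theorem divisor_algebraMap (g : Y.FunField) :
    X.divisor (algebraMap Y.FunField X.FunField g) = pullDiv φ (Y.divisor g) := by
  ext P
  rw [pullDiv_apply, Curve.divisor_apply, Curve.divisor_apply, (over_mapPt φ P).ord_algebraMap,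
    ramIdx_eq_ram, mul_comm]

variable (hφ : φ ≫ Y.str = X.str)
include hφ

theorem isFibre (Q : Y.Pt) : Place.IsFibre (Y.place Q)
    fun P : {P // (X.place P).Over (Y.place Q)} => X.place P := by
  have := isScalarTower φ hφ
  exact X.isComplete_place.isFibre (Y.place Q) (finite_integralClosure φ Q)

/-- `φ_* div g = div (N g)`. -/
theorem divisor_norm {g : X.FunField} (hg : g ≠ 0) :
    Y.divisor (Algebra.norm Y.FunField g) = pushDiv φ (X.divisor g) := by
  ext Q
  have := finiteDimensional_funField φ hφ
  have := X.isComplete_place.finite_over (Y.place Q)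
  have := Fintype.ofFinite {P // (X.place P).Over (Y.place Q)}
  rw [pushDiv_apply, sum_fiber φ Q, Curve.divisor_apply, (isFibre φ hφ Q).ord_norm hg]
  refine Finset.sum_congr rfl fun P _ => ?_
  rw [Curve.divisor_apply, inertiaDeg_eq φ, mul_comm]

/-- `(N g)(Q) = g(φ^* Q)`, after taking norms to `k`. -/
theorem norm_eval_norm (Q : Y.Pt) {g : X.FunField}
    (hg : ∀ P, mapPt φ P = Q → (X.place P).ord g = 0) :
    Algebra.norm k ((Y.place Q).eval (Algebra.norm Y.FunField g)) =
      ∏ P ∈ (finite_fiber φ Q).toFinset, Algebra.norm k ((X.place P).eval g) ^ ram φ P := by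
  have := finiteDimensional_funField φ hφ
  have := isScalarTower φ hφ
  have := X.isComplete_place.finite_over (Y.place Q)
  have := Fintype.ofFinite {P // (X.place P).Over (Y.place Q)}
  rw [prod_fiber φ Q, (isFibre φ hφ Q).eval_norm fun P => hg P ((over_iff φ _ _).1 P.2), map_prod]
  refine Finset.prod_congr rfl fun P _ => ?_
  have := X.isComplete_place.finite_residue P.1
  rw [map_pow, P.2.norm_resNorm, ramIdx_eq φ P.2]

/-- `deg φ^* E = [k(X) : k(Y)] deg E`. -/
theorem deg_pullDiv (E : Y.Div) :
    X.deg (pullDiv φ E) = Module.finrank Y.FunField X.FunField * Y.deg E := by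
  have := finiteDimensional_funField φ hφ
  have := isScalarTower φ hφ
  rw [map_pullDiv, Curve.deg_apply, Finsupp.mul_sum]
  refine Finsupp.sum_congr fun Q _ => ?_
  have := X.isComplete_place.finite_over (Y.place Q)
  have := Fintype.ofFinite {P // (X.place P).Over (Y.place Q)}
  rw [← (isFibre φ hφ Q).sum_ramIdx_mul_inertiaDeg, sum_fiber φ Q]
  push_cast
  rw [Finset.sum_mul]
  refine Finset.sum_congr rfl fun P _ => ?_
  have h : Module.finrank k (Y.resField Q) * P.2.inertiaDeg = Module.finrank k (X.resField P) :=
    P.2.finrank_mul_inertiaDeg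
  rw [Curve.deg_apply, Finsupp.sum_single_index (by simp), ← ramIdx_eq φ P.2, ← h]
  push_cast
  ring

theorem pullDiv_mem_Div0_of_isPullback {E : Y.Div} (hE : E ∈ Y.Div0) : pullDiv φ E ∈ X.Div0 := by
  rw [Curve.Div0, AddMonoidHom.mem_ker, deg_pullDiv φ hφ, (AddMonoidHom.mem_ker).1 hE, mul_zero]

end

end CurvePairing

/-! ### The pairing -/

namespace CurvePairing

namespace Curve

variable {k : Type u} [Field k] (X : Curve k)

theorem exists_ordAt_eq_one (Q : X.Pt) : ∃ π : X.FunField, X.ordAt π Q = 1 := by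
  obtain ⟨π, -, h⟩ := (X.place Q).exists_ord_eq_one
  exact ⟨π, by rw [ordAt_eq_ord, h]⟩

theorem ord_uniformizer (Q : X.Pt) : (X.place Q).ord (X.uniformizer Q) = 1 := by
  rw [uniformizer, dif_pos (X.exists_ordAt_eq_one Q), ← ordAt_eq_ord]
  exact (X.exists_ordAt_eq_one Q).choose_spec

theorem uniformizer_ne_zero (Q : X.Pt) : X.uniformizer Q ≠ 0 := by
  intro h
  have := X.ord_uniformizer Q
  simp [h] at this

/-- The unit part of a function at a closed point, with respect to the chosen uniformizer. -/
noncomputable def unitPart (Q : X.Pt) (f : X.FunField) : X.FunField :=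
  f / X.uniformizer Q ^ X.ordAt f Q

theorem unitPart_ne_zero (Q : X.Pt) {f : X.FunField} (hf : f ≠ 0) : X.unitPart Q f ≠ 0 :=
  div_ne_zero hf (zpow_ne_zero _ (X.uniformizer_ne_zero Q))

theorem ord_unitPart (Q : X.Pt) {f : X.FunField} (hf : f ≠ 0) :
    (X.place Q).ord (X.unitPart Q f) = 0 := by
  rw [unitPart, Place.ord_div _ hf (zpow_ne_zero _ (X.uniformizer_ne_zero Q)), Place.ord_zpow,
    ord_uniformizer, ordAt_eq_ord, mul_one, sub_self]

theorem unitPart_mul (Q : X.Pt) {f g : X.FunField} (hf : f ≠ 0) (hg : g ≠ 0) :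
    X.unitPart Q (f * g) = X.unitPart Q f * X.unitPart Q g := by
  simp only [unitPart, ordAt_eq_ord, Place.ord_mul _ hf hg, zpow_add₀ (X.uniformizer_ne_zero Q),
    mul_div_mul_comm]

/-- The norm of the leading coefficient of a function at a closed point. -/
noncomputable def leadNorm (Q : X.Pt) : X.FunFieldˣ →* kˣ where
  toFun f := Units.map (Algebra.norm k : X.resField Q →* k) (X.value (X.unitPart Q f) Q)
  map_one' := by
    ext
    have h1 := X.ord_unitPart Q (f := 1) one_ne_zero
    rw [Units.coe_map, coe_value _ (X.unitPart_ne_zero Q (by simp)) (by simpa using h1)]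
    have : X.unitPart Q ((1 : X.FunFieldˣ) : X.FunField) = algebraMap k X.FunField 1 := by
      simp [unitPart, ordAt_eq_ord]
    rw [this, map_one, ← map_one (algebraMap (X.localRing Q) X.FunField), place_eval_algebraMap]
    simp
  map_mul' f g := by
    ext
    have hf := X.ord_unitPart Q f.ne_zero
    have hg := X.ord_unitPart Q g.ne_zero
    have hfg := X.ord_unitPart Q (f * g).ne_zero
    change Algebra.norm k (X.value (X.unitPart Q ↑(f * g)) Q : X.resField Q) =
      Algebra.norm k (X.value (X.unitPart Q f) Q : X.resField Q) *
        Algebra.norm k (X.value (X.unitPart Q g) Q : X.resField Q)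
    rw [coe_value _ (X.unitPart_ne_zero Q (f * g).ne_zero) hfg,
      coe_value _ (X.unitPart_ne_zero Q f.ne_zero) hf,
      coe_value _ (X.unitPart_ne_zero Q g.ne_zero) hg, Units.val_mul,
      X.unitPart_mul Q f.ne_zero g.ne_zero,
      Place.eval_mul _ (Place.mem_of_ord_eq_zero _ hf) (Place.mem_of_ord_eq_zero _ hg), map_mul]

theorem leadNorm_of_ord_eq_zero (Q : X.Pt) {f : X.FunFieldˣ}
    (hf : (X.place Q).ord (f : X.FunField) = 0) :
    (X.leadNorm Q f : k) = Algebra.norm k ((X.place Q).eval (f : X.FunField)) := by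
  change Algebra.norm k (X.value (X.unitPart Q f) Q : X.resField Q) = _
  have : X.unitPart Q (f : X.FunField) = f := by
    rw [unitPart, ordAt_eq_ord, hf, zpow_zero, div_one]
  rw [this, coe_value _ f.ne_zero hf]

/-- The product of the norms of the leading coefficients of a function along a divisor. It is the
value of the function along the divisor if the two are disjoint. -/
noncomputable def evalDiv (f : X.FunFieldˣ) : X.Div →+ Additive kˣ :=
  Finsupp.liftAddHom fun Q => zmultiplesHom (Additive kˣ) (Additive.ofMul (X.leadNorm Q f))

theorem evalDiv_apply (f : X.FunFieldˣ) (E : X.Div) :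
    X.evalDiv f E = E.sum fun Q e => e • Additive.ofMul (X.leadNorm Q f) := rfl

theorem evalDiv_mul (f g : X.FunFieldˣ) (E : X.Div) :
    X.evalDiv (f * g) E = X.evalDiv f E + X.evalDiv g E := by
  simp only [evalDiv_apply, Finsupp.sum, map_mul, ofMul_mul, zsmul_add, Finset.sum_add_distrib]

theorem evalDiv_one (E : X.Div) : X.evalDiv 1 E = 0 := by
  simpa using X.evalDiv_mul 1 1 E

theorem evalDiv_inv (f : X.FunFieldˣ) (E : X.Div) : X.evalDiv f⁻¹ E = - X.evalDiv f E := by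
  rw [eq_neg_iff_add_eq_zero, ← evalDiv_mul, inv_mul_cancel, evalDiv_one]

theorem evalDiv_pow (f : X.FunFieldˣ) (n : ℕ) (E : X.Div) :
    X.evalDiv (f ^ n) E = n • X.evalDiv f E := by
  induction n with
  | zero => simp [evalDiv_one]
  | succ n ih => rw [pow_succ, evalDiv_mul, ih, succ_nsmul]

theorem coe_evalDiv {f : X.FunFieldˣ} {E : X.Div}
    (h : ∀ Q ∈ E.support, (X.place Q).ord (f : X.FunField) = 0) :
    (((X.evalDiv f E).toMul : kˣ) : k) =
      E.prod fun Q e => Algebra.norm k ((X.place Q).eval (f : X.FunField)) ^ e := by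
  rw [evalDiv_apply, Finsupp.sum, toMul_sum, Units.coe_prod]
  refine Finset.prod_congr rfl fun Q hQ => ?_
  rw [toMul_zsmul, toMul_ofMul, Units.val_zpow_eq_zpow_val, X.leadNorm_of_ord_eq_zero Q (h Q hQ)]

theorem pairingValue_eq (f : X.FunFieldˣ) (n : ℕ) (E : X.Div) :
    X.pairingValue f n E = X.evalDiv f E ⊗ₜ[ℤ] (((1 / n : ℚ)) : QmodZ) := by
  rw [pairingValue, evalDiv_apply, Finsupp.sum, Finsupp.sum, TensorProduct.sum_tmul]
  refine Finset.sum_congr rfl fun Q _ => ?_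
  exact TensorProduct.smul_tmul' _ _ _

theorem divisor_mul (f g : X.FunFieldˣ) :
    X.divisor ((f * g : X.FunFieldˣ) : X.FunField) = X.divisor f + X.divisor g :=
  X.divHom.map_add (Additive.ofMul f) (Additive.ofMul g)

theorem divisor_pow (f : X.FunFieldˣ) (n : ℕ) :
    X.divisor ((f ^ n : X.FunFieldˣ) : X.FunField) = n • X.divisor f :=
  X.divHom.map_nsmul n (Additive.ofMul f)

theorem divisor_inv (f : X.FunFieldˣ) :
    X.divisor ((f⁻¹ : X.FunFieldˣ) : X.FunField) = - X.divisor f :=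
  X.divHom.map_neg (Additive.ofMul f)

/-- A function without zeros and poles is a constant, possibly in a finite extension of `k`, and
takes the value one along divisors of degree zero. -/
theorem evalDiv_eq_zero {c : X.FunFieldˣ} (hc : X.divisor (c : X.FunField) = 0) {E : X.Div}
    (hE : E ∈ X.Div0) : X.evalDiv c E = 0 := by
  have hord : ∀ Q, (X.place Q).ord (c : X.FunField) = 0 := fun Q => by
    rw [← divisor_apply, hc, Finsupp.zero_apply]
  have h := X.isComplete_place.prod_norm_eval_of_isIntegral
    (X.isComplete_place.isIntegral_of_ord_eq_zero hord) c.ne_zero E hE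
  rw [← X.coe_evalDiv fun Q _ => hord Q] at h
  exact congrArg Additive.ofMul (Units.ext h)

theorem evalDiv_congr {f g : X.FunFieldˣ} (h : X.divisor (f : X.FunField) = X.divisor g)
    {E : X.Div} (hE : E ∈ X.Div0) : X.evalDiv f E = X.evalDiv g E := by
  have := X.evalDiv_eq_zero (c := f * g⁻¹) (by rw [divisor_mul, divisor_inv, h, add_neg_cancel]) hE
  rwa [evalDiv_mul, evalDiv_inv, add_neg_eq_zero] at this

/-- The pair `(f, n)` may be replaced by `(f ^ m, m n)`. -/
theorem tmul_one_div_eq {A : Type*} [AddCommGroup A] (a : A) {m : ℕ} (hm : 0 < m) (n : ℕ) :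
    a ⊗ₜ[ℤ] (((1 / n : ℚ)) : QmodZ) = (m • a) ⊗ₜ[ℤ] (((1 / (m * n : ℕ) : ℚ)) : QmodZ) := by
  rw [← natCast_zsmul, TensorProduct.smul_tmul, ← AddCircle.coe_zsmul]
  congr 2
  have : (m : ℚ) ≠ 0 := by exact_mod_cast hm.ne'
  simp only [zsmul_eq_mul, Int.cast_natCast, Nat.cast_mul]
  field_simp

/-- Tensoring with `1/n` kills `n`-th powers. -/
theorem nsmul_tmul_one_div {A : Type*} [AddCommGroup A] (a : A) {n : ℕ} (hn : 0 < n) :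
    (n • a) ⊗ₜ[ℤ] (((1 / n : ℚ)) : QmodZ) = 0 := by
  rw [← natCast_zsmul, TensorProduct.smul_tmul, ← AddCircle.coe_zsmul]
  have : (n : ℚ) ≠ 0 := by exact_mod_cast hn.ne'
  have h : ((n : ℤ) • (1 / n : ℚ)) = 1 := by
    simp only [zsmul_eq_mul, Int.cast_natCast]
    field_simp
  rw [h, AddCircle.coe_period, TensorProduct.tmul_zero]

theorem pairingValue_congr {D : X.Div} {f g : X.FunFieldˣ} {m n : ℕ} (hm : 0 < m) (hn : 0 < n)
    (hf : X.divisor (f : X.FunField) = m • D) (hg : X.divisor (g : X.FunField) = n • D) {E : X.Div}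
    (hE : E ∈ X.Div0) : X.pairingValue f m E = X.pairingValue g n E := by
  rw [pairingValue_eq, pairingValue_eq, tmul_one_div_eq _ hn, tmul_one_div_eq (X.evalDiv g E) hm,
    mul_comm, ← evalDiv_pow, ← evalDiv_pow,
    X.evalDiv_congr (f := f ^ n) (g := g ^ m) (by
      rw [divisor_pow, divisor_pow, hf, hg, smul_comm]) hE]

/-- The pairing does not depend on the choices in its definition. -/
theorem pairing_eq (D : X.DivT) {f : X.FunFieldˣ} {n : ℕ} (hn : 0 < n)
    (hf : X.divisor (f : X.FunField) = n • (D : X.Div)) {E : X.Div} (hE : E ∈ X.Div0) :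
    X.pairing D E = X.evalDiv f E ⊗ₜ[ℤ] (((1 / n : ℚ)) : QmodZ) := by
  rw [← pairingValue_eq]
  exact X.pairingValue_congr (X.exists_of_mem_DivT D).choose_spec.1 hn
    (X.exists_of_mem_DivT D).choose_spec.2 hf hE

theorem divisor_mem_principal (h : X.FunFieldˣ) : X.divisor (h : X.FunField) ∈ X.principal :=
  ⟨Additive.ofMul h, rfl⟩

/-- The pairing depends only on the class of its first argument: adding `div g` multiplies `f` by
`g ^ n`. -/
theorem pairing_congr {D D' : X.DivT} (h : X.cls D = X.cls D') {E : X.Div} (hE : E ∈ X.Div0) :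
    X.pairing D E = X.pairing D' E := by
  obtain ⟨⟨n, f⟩, hn, hf⟩ := X.exists_of_mem_DivT D
  obtain ⟨g, hg⟩ := (QuotientAddGroup.eq (s := X.principal)).1 h
  have hg' : X.divisor (g.toMul : X.FunFieldˣ) = -(D : X.Div) + D' := hg
  have hf' : X.divisor ((f * g.toMul ^ n : X.FunFieldˣ) : X.FunField) = n • (D' : X.Div) := by
    rw [divisor_mul, divisor_pow, hg', hf, ← smul_add, add_neg_cancel_left]
  rw [X.pairing_eq D hn hf hE, X.pairing_eq D' hn hf' hE, evalDiv_mul, evalDiv_pow,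
    TensorProduct.add_tmul, nsmul_tmul_one_div _ hn, add_zero]

/-- The moving lemma: a divisor is equivalent to one which avoids a given finite set. -/
theorem exists_disjoint (D : X.DivT) (S : Finset X.Pt) :
    ∃ D' : X.DivT, X.cls D' = X.cls D ∧ ∀ Q ∈ S, (D' : X.Div) Q = 0 := by
  obtain ⟨b, hb0, hb⟩ := Place.exists_ord_eq (P := fun Q : S => X.place Q)
    (fun Q Q' h => Subtype.ext (X.place_injective h)) fun Q => - (D : X.Div) Q
  have hcls : X.cls ((D : X.Div) + X.divisor b) = X.cls D := by
    have h : X.cls (X.divisor b) = 0 := (QuotientAddGroup.eq_zero_iff (N := X.principal) _).2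
      (X.divisor_mem_principal (Units.mk0 b hb0))
    rw [map_add, h, add_zero]
  refine ⟨⟨D + X.divisor b, ?_⟩, hcls, fun Q hQ => ?_⟩
  · change X.cls _ ∈ X.PicTors
    rw [hcls]
    exact D.2
  · rw [Finsupp.add_apply, divisor_apply, hb ⟨Q, hQ⟩, add_neg_cancel]

/-- Principal divisors have degree zero. -/
theorem deg_divisor (f : X.FunFieldˣ) : X.deg (X.divisor (f : X.FunField)) = 0 := by
  have := X.essFiniteType
  have h := X.isComplete_place.sum_ord_mul_finrank_eq_zero X.finrank_kaehlerDifferential f.ne_zero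
    (X.divisor (f : X.FunField)).support fun Q hQ => by
      rwa [Finsupp.mem_support_iff, divisor_apply]
  rw [deg_apply, Finsupp.sum, ← h]
  exact Finset.sum_congr rfl fun Q _ => by rw [divisor_apply]

theorem DivT_le_Div0 : X.DivT ≤ X.Div0 := by
  intro D hD
  obtain ⟨⟨n, f⟩, hn, hf⟩ := X.exists_of_mem_DivT ⟨D, hD⟩
  have h := X.deg_divisor f
  rw [hf, map_nsmul] at h
  exact (smul_eq_zero.1 h).resolve_left hn.ne'

/-- Weil's reciprocity law: `f(div g) = g(div f)` for functions with disjoint divisors. -/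
theorem evalDiv_divisor_comm {f g : X.FunFieldˣ}
    (h : ∀ Q, X.divisor (f : X.FunField) Q ≠ 0 → X.divisor (g : X.FunField) Q = 0) :
    X.evalDiv f (X.divisor (g : X.FunField)) = X.evalDiv g (X.divisor (f : X.FunField)) := by
  classical
  have := X.essFiniteType
  simp only [divisor_apply] at h
  have h' := X.isComplete_place.weil_reciprocity X.finrank_kaehlerDifferential f.ne_zero g.ne_zero
    h ((X.divisor (f : X.FunField)).support ∪ (X.divisor (g : X.FunField)).support)
    (fun Q hQ => Finset.mem_union_left _ (by rwa [Finsupp.mem_support_iff, divisor_apply]))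
    (fun Q hQ => Finset.mem_union_right _ (by rwa [Finsupp.mem_support_iff, divisor_apply]))
  refine congrArg Additive.ofMul (Units.ext ?_ : (X.evalDiv f _).toMul = (X.evalDiv g _).toMul)
  rw [coe_evalDiv, coe_evalDiv,
    Finsupp.prod_of_support_subset _ Finset.subset_union_right _ fun _ _ => zpow_zero _,
    Finsupp.prod_of_support_subset _ Finset.subset_union_left _ fun _ _ => zpow_zero _]
  · simpa only [divisor_apply] using h'
  · intro Q hQ
    rw [Finsupp.mem_support_iff, divisor_apply] at hQ
    exact h Q hQ
  · intro Q hQ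
    rw [Finsupp.mem_support_iff, divisor_apply] at hQ
    exact not_imp_comm.1 (h Q) hQ

/-- The pairing with a principal divisor vanishes: for disjoint divisors, reciprocity gives
`f(div h) = h(div f) = h(D) ^ n`. -/
theorem pairing_divisor (D : X.DivT) (h : X.FunFieldˣ) :
    X.pairing D (X.divisor (h : X.FunField)) = 0 := by
  obtain ⟨D', hD', hdisj⟩ := X.exists_disjoint D (X.divisor (h : X.FunField)).support
  obtain ⟨⟨n, f⟩, hn, hf⟩ := X.exists_of_mem_DivT D'
  have h0 : X.divisor (h : X.FunField) ∈ X.Div0 := X.deg_divisor h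
  rw [← X.pairing_congr hD' h0, X.pairing_eq D' hn hf h0, X.evalDiv_divisor_comm, hf, map_nsmul,
    nsmul_tmul_one_div _ hn]
  intro Q hQ
  by_contra h1
  rw [hf, Finsupp.smul_apply, hdisj Q (Finsupp.mem_support_iff.2 h1), smul_zero] at hQ
  exact hQ rfl

/-- The pairing is symmetric: if `div f = n D` and `div e = m E` are disjoint, then
`⟨D, E⟩ = f(div e) ⊗ 1/mn` and `⟨E, D⟩ = e(div f) ⊗ 1/mn`, which agree by reciprocity. -/
theorem pairing_comm (D E : X.DivT) : X.pairing D E = X.pairing E D := by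
  obtain ⟨D', hD', hdisj⟩ := X.exists_disjoint D (E : X.Div).support
  obtain ⟨g, hg⟩ := (QuotientAddGroup.eq (s := X.principal)).1 hD'
  have hg' : X.divisor (g.toMul : X.FunFieldˣ) = -(D' : X.Div) + D := hg
  obtain ⟨⟨m, e⟩, hm, he⟩ := X.exists_of_mem_DivT E
  obtain ⟨⟨n, f⟩, hn, hf⟩ := X.exists_of_mem_DivT D'
  have hD0 : (D : X.Div) ∈ X.Div0 := X.DivT_le_Div0 D.2
  have hD0' : (D' : X.Div) ∈ X.Div0 := X.DivT_le_Div0 D'.2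
  have hE0 : (E : X.Div) ∈ X.Div0 := X.DivT_le_Div0 E.2
  -- the second argument is moved by additivity and the vanishing on principal divisors
  have h1 : X.pairing E D = X.pairing E D' := by
    have h2 := X.pairing_divisor E g.toMul
    rw [hg', X.pairing_eq E hm he (add_mem (neg_mem hD0') hD0), map_add, map_neg,
      TensorProduct.add_tmul, TensorProduct.neg_tmul, ← X.pairing_eq E hm he hD0,
      ← X.pairing_eq E hm he hD0'] at h2
    exact (neg_add_eq_zero.1 h2).symm
  rw [h1, ← X.pairing_congr hD' hE0, X.pairing_eq D' hn hf hE0, X.pairing_eq E hm he hD0',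
    tmul_one_div_eq _ hm, tmul_one_div_eq (X.evalDiv e D') hn, ← map_nsmul, ← map_nsmul, ← hf,
    ← he, X.evalDiv_divisor_comm, mul_comm]
  intro Q hQ
  rw [he, Finsupp.smul_apply]
  by_contra h1
  rw [hf, Finsupp.smul_apply, hdisj Q (Finsupp.mem_support_iff.2 fun h2 => h1 (by simp [h2])),
    smul_zero] at hQ
  exact hQ rfl

end Curve

end CurvePairing

/-! ### The projection formula -/

namespace CurvePairing

variable {k : Type u} [Field k] {X Y : Curve k} (φ : X.toScheme ⟶ Y.toScheme) [IsFinite φ]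
  (hφ : φ ≫ Y.str = X.str)

theorem principal_le_comap_pullDiv : Y.principal ≤ X.principal.comap (pullDiv φ) := by
  obtain ⟨_, _⟩ := exists_isPullback φ
  rintro _ ⟨g, rfl⟩
  refine ⟨Additive.ofMul (Units.map (algebraMap Y.FunField X.FunField : _ →* _) g.toMul), ?_⟩
  exact divisor_algebraMap φ _

include hφ

theorem principal_le_comap_pushDiv : X.principal ≤ Y.principal.comap (pushDiv φ) := by
  obtain ⟨_, _⟩ := exists_isPullback φ
  rintro _ ⟨f, rfl⟩
  refine ⟨Additive.ofMul (Units.map (Algebra.norm Y.FunField : X.FunField →* _) f.toMul), ?_⟩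
  exact divisor_norm φ hφ f.toMul.ne_zero

theorem cls_pushDiv_eq {D D' : X.Div} (h : X.cls D = X.cls D') :
    Y.cls (pushDiv φ D) = Y.cls (pushDiv φ D') :=
  congrArg (QuotientAddGroup.map X.principal Y.principal (pushDiv φ)
    (principal_le_comap_pushDiv φ hφ)) h

theorem pushDiv_mem_DivT {D : X.Div} (hD : D ∈ X.DivT) : pushDiv φ D ∈ Y.DivT :=
  AddMonoidHom.isOfFinAddOrder (QuotientAddGroup.map X.principal Y.principal
    (pushDiv φ) (principal_le_comap_pushDiv φ hφ)) (x := X.cls D) hD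

omit hφ in
theorem pullDiv_mem_DivT {E : Y.Div} (hE : E ∈ Y.DivT) : pullDiv φ E ∈ X.DivT :=
  AddMonoidHom.isOfFinAddOrder (QuotientAddGroup.map Y.principal X.principal
    (pullDiv φ) (principal_le_comap_pullDiv φ)) (x := Y.cls E) hE

theorem pullDiv_mem_Div0 {E : Y.Div} (hE : E ∈ Y.Div0) : pullDiv φ E ∈ X.Div0 := by
  obtain ⟨_, _⟩ := exists_isPullback φ
  exact pullDiv_mem_Div0_of_isPullback φ hφ hE

/-- `N(f)(E) = f(φ^* E)`. -/
theorem evalDiv_norm [Algebra Y.FunField X.FunField] [IsPullback φ] {f : X.FunFieldˣ}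
    {g : Y.FunFieldˣ} (hg : (g : Y.FunField) = Algebra.norm Y.FunField (f : X.FunField)) {E : Y.Div}
    (h : ∀ P, mapPt φ P ∈ E.support → (X.place P).ord (f : X.FunField) = 0) :
    Y.evalDiv g E = X.evalDiv f (pullDiv φ E) := by
  rw [map_pullDiv, Y.evalDiv_apply]
  refine Finset.sum_congr rfl fun Q hQ => ?_
  have hQ' : ∀ P, mapPt φ P = Q → (X.place P).ord (f : X.FunField) = 0 :=
    fun P hP => h P (hP ▸ hQ)
  have h1 : Additive.ofMul (Y.leadNorm Q g) =
      ∑ P ∈ (finite_fiber φ Q).toFinset, ram φ P • Additive.ofMul (X.leadNorm P f) := by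
    refine congrArg Additive.ofMul (Units.ext ?_ : Y.leadNorm Q g =
      ∏ P ∈ (finite_fiber φ Q).toFinset, X.leadNorm P f ^ ram φ P)
    have h2 : (Y.place Q).ord (g : Y.FunField) = 0 := by
      rw [hg, ← Curve.divisor_apply, divisor_norm φ hφ f.ne_zero, pushDiv_apply]
      refine Finset.sum_eq_zero fun P hP => ?_
      rw [Curve.divisor_apply, hQ' P ((mem_fiber φ).1 hP), zero_mul]
    rw [Y.leadNorm_of_ord_eq_zero Q h2, Units.coe_prod, hg]
    refine (norm_eval_norm φ hφ Q hQ').trans (Finset.prod_congr rfl fun P hP => ?_)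
    rw [Units.val_pow_eq_pow_val, X.leadNorm_of_ord_eq_zero P (hQ' P ((mem_fiber φ).1 hP))]
  beta_reduce
  rw [h1, ← Finset.sum_zsmul]
  refine Finset.sum_congr rfl fun P _ => ?_
  rw [Curve.evalDiv_apply, Finsupp.sum_single_index (by simp), mul_zsmul, natCast_zsmul]

/-- The projection formula. If `div f = n D`, with `D` moved off the support of `φ^* E`, then
`div (N f) = n φ_* D` and `N(f)(E) = f(φ^* E)`. -/
theorem pairing_pushDiv (D : X.DivT) {E : Y.Div} (hE : E ∈ Y.Div0) :
    Y.pairing ⟨pushDiv φ D, pushDiv_mem_DivT φ hφ D.2⟩ E = X.pairing D (pullDiv φ E) := by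
  classical
  obtain ⟨_, _⟩ := exists_isPullback φ
  have hE' := pullDiv_mem_Div0 φ hφ hE
  obtain ⟨D', hD', hdisj⟩ := X.exists_disjoint D
    (E.support.biUnion fun Q => (finite_fiber φ Q).toFinset)
  obtain ⟨⟨n, f⟩, hn, hf⟩ := X.exists_of_mem_DivT D'
  have hN : Y.divisor ((Units.map (Algebra.norm Y.FunField : X.FunField →* Y.FunField) f :
      Y.FunFieldˣ) : Y.FunField) = n • pushDiv φ D' := by
    rw [← map_nsmul, ← hf]
    exact divisor_norm φ hφ f.ne_zero
  rw [← Y.pairing_congr (D := ⟨pushDiv φ D', pushDiv_mem_DivT φ hφ D'.2⟩)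
    (cls_pushDiv_eq φ hφ hD') hE, ← X.pairing_congr hD' hE',
    Y.pairing_eq _ hn hN hE, X.pairing_eq _ hn hf hE', evalDiv_norm φ hφ rfl]
  intro P hP
  rw [← Curve.divisor_apply, hf, Finsupp.smul_apply, hdisj P, smul_zero]
  exact Finset.mem_biUnion.2 ⟨_, hP, (mem_fiber φ).2 rfl⟩

end CurvePairing

theorem mainTheorem3 {k : Type u} [Field k] (X Y : CurvePairing.Curve k)
    (φ : X.toScheme ⟶ Y.toScheme) [IsFinite φ] (hφ : φ ≫ Y.str = X.str) :
    (∀ (D : X.DivT) (E : Y.Div0),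
      ∃ hD : CurvePairing.pushDiv φ D ∈ Y.DivT,
        CurvePairing.pullDiv φ E ∈ X.Div0 ∧
        Y.pairing ⟨CurvePairing.pushDiv φ D, hD⟩ E =
          X.pairing D (CurvePairing.pullDiv φ E)) ∧
    ∃ (hpush : X.principal ≤ Y.principal.comap (CurvePairing.pushDiv φ))
      (hpull : Y.principal ≤ X.principal.comap (CurvePairing.pullDiv φ)),
      QuotientAddGroup.map Y.principal X.principal (CurvePairing.pullDiv φ) hpull ''
          Y.intrinsic ⊆ X.intrinsic ∧
      QuotientAddGroup.map X.principal Y.principal (CurvePairing.pushDiv φ) hpush ''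
          X.intrinsic ⊆ Y.intrinsic := by
  refine ⟨fun D E => ⟨CurvePairing.pushDiv_mem_DivT φ hφ D.2,
    CurvePairing.pullDiv_mem_Div0 φ hφ E.2, CurvePairing.pairing_pushDiv φ hφ D E.2⟩,
    CurvePairing.principal_le_comap_pushDiv φ hφ, CurvePairing.principal_le_comap_pullDiv φ, ?_, ?_⟩
  · -- `⟨φ^* a, b⟩ = ⟨b, φ^* a⟩ = ⟨φ_* b, a⟩ = ⟨a, φ_* b⟩ = 0`
    rintro _ ⟨a, ⟨ha, ha0⟩, rfl⟩
    obtain ⟨D₀, rfl⟩ := QuotientAddGroup.mk'_surjective _ a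
    have hD₀ : D₀ ∈ Y.DivT := ha
    have hpull := CurvePairing.pullDiv_mem_DivT φ hD₀
    refine ⟨hpull, fun D E hD => ?_⟩
    rw [X.pairing_congr (D := D) (D' := ⟨_, hpull⟩) hD (X.DivT_le_Div0 E.2), X.pairing_comm,
      ← CurvePairing.pairing_pushDiv φ hφ E (Y.DivT_le_Div0 hD₀)]
    have hE := CurvePairing.pushDiv_mem_DivT φ hφ E.2
    exact (Y.pairing_comm ⟨_, hE⟩ ⟨D₀, hD₀⟩).trans (ha0 ⟨D₀, hD₀⟩ ⟨_, hE⟩ rfl)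
  · -- `⟨φ_* a, b⟩ = ⟨a, φ^* b⟩ = 0`
    rintro _ ⟨a, ⟨ha, ha0⟩, rfl⟩
    obtain ⟨D₀, rfl⟩ := QuotientAddGroup.mk'_surjective _ a
    have hD₀ : D₀ ∈ X.DivT := ha
    have hpush := CurvePairing.pushDiv_mem_DivT φ hφ hD₀
    refine ⟨hpush, fun D E hD => ?_⟩
    have hE0 := Y.DivT_le_Div0 E.2
    rw [Y.pairing_congr (D := D) (D' := ⟨_, hpush⟩) hD hE0]
    exact (CurvePairing.pairing_pushDiv φ hφ ⟨D₀, hD₀⟩ hE0).trans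
      (ha0 ⟨D₀, hD₀⟩ ⟨_, CurvePairing.pullDiv_mem_DivT φ E.2⟩ rfl)
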